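/- **Setting.** Let $X\subseteq\mathbb R^n$ be closed and convex, $\|\cdot\|$ the Euclidean norm, $f:\mathbb R^n\to\mathbb R$, $h:\mathbb{R}^n\to\mathbb R$ convex on $X$, $\Psi=f+h$ bounded below on $X$ with $\Psi^*=\inf_X\Psi$, and $L>0$. Let $\omega$ be a distance generating function on $X$ with modulus $\alpha>0$: $\omega$ is continuously differentiable on $X$ and $\langle x-z,\nabla\omega(x)-\nabla\omega(z)\rangle\ge\alpha\|x-z\|^2$ for $x,z\in X$. Put $V(x,z)=\omega(x)-\omega(z)-\langle\nabla\omega(z),x-z\rangle$, assume that $x^+=\arg\min_{u\in X}\{\langle g,u\rangle+\frac1\gamma V(u,x)+h(u)\}$ exists for all $\gamma>0$, $g\in\mathbb R^n$, $x\in X$, and let $P_X(x,g,\gamma)=\frac1\gamma(x-x^+)$. **Oracle.** A Borel function $F(x,\xi)$ is available such that almost surely $F(\cdot,\xi)$ is differentiable on $\mathbb R^n$ with $L$-Lipschitz gradient, and, for every noise sample $\xi$ used by the algorithm, conditionally on all samples drawn before it: (A3) $\mathbb E[F(x,\xi)]=f(x)$ for every $x\in\mathbb R^n$; (A1) $\mathbb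 E[\nabla_xF(x,\xi)]=\nabla f(x)$ and $\mathbb E\|\nabla_xF(x,\xi)-\nabla f(x)\|^2\le\sigma^2$ for every $x\in X$ (for independent samples these are conditions on the distribution of $\xi$; A3 makes $f$ differentiable on $\mathbb R^n$ with $L$-Lipschitz gradient). **RSPGF algorithm.** Given $x_1\in X$, $N\ge1$, stepsizes $\gamma_k$ with $0<\gamma_k\le\alpha/L$ and $\gamma_k<\alpha/L$ for at least one $k\in\{1,\dots,N\}$, batch sizes $m_k\ge1$ and $\mu>0$, let for $k=1,\dots,N$ $$G_{\mu,k}=\frac1{m_k}\sum_{i=1}^{m_k}\frac{F(x_k+\mu v_{k,i},\xi_{k,i})-F(x_k,\xi_{k,i})}{\mu}\,v_{k,i},\qquad x_{k+1}=\arg\min_{u\in X}\Big\{\langle G_{\mu,k},u\rangle+\frac1{\gamma_k}V(u,x_k)+h(u)\Big\},$$ where each $v_{k,i}$ is a standard Gaussian vector in $\mathbb R^n$ independent of $\xi_{k,i}$ and of all earlier samples. Let $R\in\{1,\dots,N\}$ be independent of all the samples with $$\Pr\{R=k\}=\frac{\alpha\gamma_k-L\gamma_k^2}{\sum_{j=1}^N(\alpha\gamma_j-L\gamma_j^2)},$$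 and let $\bar g_{\mu,X,k}=P_X(x_k,G_{\mu,k},\gamma_k)=(x_k-x_{k+1})/\gamma_k$, $D_\Psi=[(\Psi(x_1)-\Psi^*)/L]^{1/2}$ and $\tilde\sigma^2=2(n+4)[M^2+\sigma^2+\mu^2L^2(n+4)^2]$. **Theorem.** Suppose $\|\nabla f(x)\|\le M$ for all $x\in X$. Then: (a) $\displaystyle \mathbb E\|\bar g_{\mu,X,R}\|^2\le\frac{L D_\Psi^2+\mu^2Ln+(\tilde\sigma^2/\alpha)\sum_{k=1}^N\gamma_k/m_k}{\sum_{k=1}^N(\alpha\gamma_k-L\gamma_k^2)}.$ (b) If in addition $f$ is convex on $\mathbb R^n$, $x^*\in X$ is a minimizer of $\Psi$ over $X$, and $\gamma_1\le\gamma_2\le\dots\le\gamma_N$, then $$\mathbb E[\Psi(x_{R+1})-\Psi(x^*)]\le\frac{(\alpha-L\gamma_1)V(x^*,x_1)+(\tilde\sigma^2/2)\sum_{k=1}^N\gamma_k^2/m_k}{\sum_{k=1}^N(\alpha\gamma_k-L\gamma_k^2)}+\mu^2Ln,$$ where $x_{R+1}$ is the iterate computed in step $R$ (the point $x_R^+$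 that defines $\bar g_{\mu,X,R}$). The expectations are over $R$ and all samples, and both integrands are integrable. -/

import Mathlib

open MeasureTheory ProbabilityTheory
open scoped Gradient

noncomputable section

namespace RSPGF

/-- `ℝⁿ` with its Euclidean norm and inner product. -/
abbrev Vec (n : ℕ) : Type := EuclideanSpace ℝ (Fin n)

/-- `f ∈ C_L^{1,1}(ℝⁿ)`: differentiable, with an `L`-Lipschitz gradient. -/
def IsC11 {n : ℕ} (L : ℝ) (f : Vec n → ℝ) : Prop :=
  Differentiable ℝ f ∧ ∀ x y : Vec n, ‖∇ f y - ∇ f x‖ ≤ L * ‖y - x‖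

/-- `w` is a distance generating function on `X` with modulus `α`: it is continuously
differentiable on `X`, with gradient `gw`, and strongly convex. -/
structure IsDistanceGenerating {n : ℕ} (X : Set (Vec n)) (α : ℝ) (w : Vec n → ℝ)
    (gw : Vec n → Vec n) : Prop where
  hasGradient : ∀ x ∈ X, HasGradientWithinAt w (gw x) X x
  continuousOn : ContinuousOn gw X
  strong : ∀ x ∈ X, ∀ z ∈ X, α * ‖x - z‖ ^ 2 ≤ inner ℝ (x - z) (gw x - gw z)

/-- The prox-function `V(x, z) = w(x) - [w(z) + ⟨∇w(z), x - z⟩]`. -/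
def proxV {n : ℕ} (w : Vec n → ℝ) (gw : Vec n → Vec n) (x z : Vec n) : ℝ :=
  w x - (w z + inner ℝ (gw z) (x - z))

/-- The objective `u ↦ ⟨g, u⟩ + V(u, x) / γ + h(u)` of the generalized projection problem. -/
def projObjective {n : ℕ} (h w : Vec n → ℝ) (gw : Vec n → Vec n) (γ : ℝ) (g x u : Vec n) : ℝ :=
  inner ℝ g u + (1 / γ) * proxV w gw u x + h u

/-- `u` solves the generalized projection problem over `X`. -/
def IsProjSolution {n : ℕ} (X : Set (Vec n)) (h w : Vec n → ℝ) (gw : Vec n → Vec n)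
    (γ : ℝ) (g x u : Vec n) : Prop :=
  u ∈ X ∧ IsMinOn (projObjective h w gw γ g x) X u

open Classical in
/-- The generalized projection `x⁺ = argmin_{u ∈ X} {⟨g, u⟩ + V(u, x) / γ + h(u)}`
(the value `x` is a dummy when there is no minimizer). -/
def genProj {n : ℕ} (X : Set (Vec n)) (h w : Vec n → ℝ) (gw : Vec n → Vec n)
    (γ : ℝ) (g x : Vec n) : Vec n :=
  if hu : ∃ u, IsProjSolution X h w gw γ g x u then hu.choose else x

/-- `P_X(x, g, γ) = (x - x⁺) / γ`. -/
def projGrad {n : ℕ} (X : Set (Vec n)) (h w : Vec n → ℝ) (gw : Vec n → Vec n)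
    (x g : Vec n) (γ : ℝ) : Vec n :=
  (1 / γ) • (x - genProj X h w gw γ g x)

/-- `Ψ* = inf_{x ∈ X} (f(x) + h(x))`. -/
def optValue {n : ℕ} (X : Set (Vec n)) (f h : Vec n → ℝ) : ℝ :=
  sInf ((fun x => f x + h x) '' X)

/-- `D_Ψ = [(Ψ(x₁) - Ψ*) / L]^{1/2}`. -/
def DPsi {n : ℕ} (X : Set (Vec n)) (f h : Vec n → ℝ) (L : ℝ) (x₁ : Vec n) : ℝ :=
  Real.sqrt ((f x₁ + h x₁ - optValue X f h) / L)

/-- `G_μ(x, s, v) = (F(x + μ v, s) - F(x, s)) / μ · v`. -/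
def gradFree {n : ℕ} {S : Type*} (F : Vec n → S → ℝ) (μ : ℝ) (x : Vec n) (s : S) (v : Vec n) :
    Vec n :=
  ((F (x + μ • v) s - F x s) / μ) • v

/-- The mini-batch average of the `G_μ(x, s i, v i)` over a batch of size `m`. -/
def batchGrad {n : ℕ} {S : Type*} (F : Vec n → S → ℝ) (μ : ℝ) (m : ℕ) (x : Vec n)
    (s : ℕ → S) (v : ℕ → Vec n) : Vec n :=
  (1 / (m : ℝ)) • ∑ i ∈ Finset.range m, gradFree F μ x (s i) (v i)

/-- The iterates `x₁, x₂, …` of the RSPGF recursion, for given realizations `s k i`, `v k i` of the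
samples used at step `k ≥ 1` (the batch of step `k` is `i = 0, …, m k - 1`). Iterates are numbered
from `1`; index `0` is a dummy. -/
def iterate {n : ℕ} {S : Type*} (X : Set (Vec n)) (h w : Vec n → ℝ) (gw : Vec n → Vec n)
    (F : Vec n → S → ℝ) (μ : ℝ) (γ : ℕ → ℝ) (m : ℕ → ℕ) (x₁ : Vec n)
    (s : ℕ → ℕ → S) (v : ℕ → ℕ → Vec n) : ℕ → Vec n
  | 0 => x₁
  | 1 => x₁
  | k + 2 =>
    let x := iterate X h w gw F μ γ m x₁ s v (k + 1)
    genProj X h w gw (γ (k + 1)) (batchGrad F μ (m (k + 1)) x (s (k + 1)) (v (k + 1))) x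

/-- `ḡ_{μ,X,k} = P_X(x_k, G_{μ,k}, γ_k)`, along the same realization. -/
def stochProjGrad {n : ℕ} {S : Type*} (X : Set (Vec n)) (h w : Vec n → ℝ) (gw : Vec n → Vec n)
    (F : Vec n → S → ℝ) (μ : ℝ) (γ : ℕ → ℝ) (m : ℕ → ℕ) (x₁ : Vec n)
    (s : ℕ → ℕ → S) (v : ℕ → ℕ → Vec n) (k : ℕ) : Vec n :=
  projGrad X h w gw (iterate X h w gw F μ γ m x₁ s v k)
    (batchGrad F μ (m k) (iterate X h w gw F μ γ m x₁ s v k) (s k) (v k)) (γ k)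

/-- The σ-algebra of the past at the `i`-th call of step `k`: it is generated by all samples
`(ξ l j, v l j)` drawn earlier, that is at a step `l < k`, or at step `k` with `j < i`. -/
@[reducible] def past {n : ℕ} {Ω S : Type*} [MeasurableSpace S] (m : ℕ → ℕ)
    (ξ : ℕ → ℕ → Ω → S) (v : ℕ → ℕ → Ω → Vec n) (k i : ℕ) : MeasurableSpace Ω :=
  ⨆ (l : ℕ) (j : ℕ) (_ : 1 ≤ l ∧ j < m l ∧ (l < k ∨ (l = k ∧ j < i))),
    MeasurableSpace.comap (fun ω => (ξ l j ω, v l j ω)) inferInstance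

/-- The stochastic gradient `G(x, s) = ∇ₓ F(x, s)`. -/
def stochGrad {n : ℕ} {S : Type*} (F : Vec n → S → ℝ) (x : Vec n) (s : S) : Vec n :=
  ∇ (fun y => F y s) x

/-- Assumption A1 for one noise variable `ξ`, given the past `H`: at every `x ∈ X` the stochastic
gradient is unbiased, with variance at most `σ²`. -/
structure AssumptionA1 {n : ℕ} {Ω S : Type*} [MeasurableSpace Ω] (P : Measure Ω)
    (H : MeasurableSpace Ω) (X : Set (Vec n)) (f : Vec n → ℝ) (F : Vec n → S → ℝ) (σ : ℝ)
    (ξ : Ω → S) : Prop where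
  integrable : ∀ x ∈ X, Integrable (fun ω => stochGrad F x (ξ ω)) P
  unbiased : ∀ x ∈ X, P[fun ω => stochGrad F x (ξ ω) | H] =ᵐ[P] fun _ => ∇ f x
  integrable_sq : ∀ x ∈ X, Integrable (fun ω => ‖stochGrad F x (ξ ω) - ∇ f x‖ ^ 2) P
  variance : ∀ x ∈ X, P[fun ω => ‖stochGrad F x (ξ ω) - ∇ f x‖ ^ 2 | H] ≤ᵐ[P] fun _ => σ ^ 2

/-- Assumption A3 for one noise variable `ξ`, given the past `H`: the stochastic function value is
unbiased at every point of `ℝⁿ`. -/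
structure AssumptionA3 {n : ℕ} {Ω S : Type*} [MeasurableSpace Ω] (P : Measure Ω)
    (H : MeasurableSpace Ω) (f : Vec n → ℝ) (F : Vec n → S → ℝ) (ξ : Ω → S) : Prop where
  integrable : ∀ x, Integrable (fun ω => F x (ξ ω)) P
  unbiased : ∀ x, P[fun ω => F x (ξ ω) | H] =ᵐ[P] fun _ => f x

/-- `σ̃² = 2 (n + 4) [M² + σ² + μ² L² (n + 4)²]`. -/
def sigmaTildeSq (n : ℕ) (M σ μ L : ℝ) : ℝ :=
  2 * ((n : ℝ) + 4) * (M ^ 2 + σ ^ 2 + μ ^ 2 * L ^ 2 * ((n : ℝ) + 4) ^ 2)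

/-- `∑_{k=1}^N (α γ_k - L γ_k²)`. -/
def weightSum (α L : ℝ) (γ : ℕ → ℝ) (N : ℕ) : ℝ :=
  ∑ k ∈ Finset.Icc 1 N, (α * γ k - L * γ k ^ 2)

end RSPGF

end

noncomputable section

namespace RSPGF

/-! By Gaussian integration by parts the finite-difference estimator is an unbiased estimator of
`smoothGrad f μ`, the gradient of the smoothing f_μ(x) = E f(x + μ v) (`IsC11.integral_gradFree`).
The smoothing inherits the quadratic upper bound with the same `L`, inherits convexity, and differs
from f by at most μ² L n / 2 (`IsC11.abs_smooth_sub_le`). Hence RSPGF is an ordinary stochastic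
proximal gradient method for f_μ + h. Two passages between f and f_μ account for the term μ² L n in
(a), and two for the one in (b).

Noise: let δ_k be the difference between the direction used at step k and `smoothGrad f μ` at x_k.
Gaussian moments up to order six bound the second moment of a single finite difference by σ̃², and
the errors of a batch are mutually orthogonal, so E‖δ_k‖² ≤ σ̃² / m_k (`IsRun.isProxProcess`). The
noise samples need not be independent, and the oracle conditions hold at deterministic points only,
given the past. They are transferred to the random iterate by cutting the sample space into pieces
on which the iterate is nearly constant and using Lipschitz continuity (`integral_frozen_mul`,
`AssumptionA1.lintegral_sq_le`).

For (a), a step with projected gradient r decreases f_μ + h by (α γ - L γ² / 2)‖r‖², up to γ⟨δ, r⟩.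
Write r as the projected gradient of the exact direction, which is known from the past and so
orthogonal to δ in mean, plus a remainder of norm at most ‖δ‖ / α. The error becomes γ‖δ‖² / α and
the sum telescopes (`IsProxProcess.sum_integral_sq_projGrad_le`).

For (b), the three-point inequality for `proxV` is multiplied by α - L γ_k; completing a square
leaves the noise γ_k²‖δ_k‖² / 2. The weights α - L γ_k are nonincreasing, so summation by parts
leaves only V(x*, x₁) (`IsProxProcess.sum_integral_value_sub_le`).

The law of R is proportional to the weights in both sums, so averaging over R divides by
`weightSum`. Integrability comes from a pathwise form of the descent
(`IsProxProcess.value_add_sum_le`). -/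

/-! ### Gaussian integration by parts and Gaussian moments. -/

lemma hasDerivAt_gaussianPDFReal_std (t : ℝ) :
    HasDerivAt (gaussianPDFReal 0 1) (-(t * gaussianPDFReal 0 1 t)) t := by
  have h1 : HasDerivAt (fun x : ℝ => -(x - 0) ^ 2 / (2 * ((1 : NNReal) : ℝ))) (-t) t := by
    have := (((hasDerivAt_id t).sub_const 0).pow 2).neg.div_const (2 * ((1 : NNReal) : ℝ))
    refine this.congr_deriv ?_
    simp
    ring
  have h2 := h1.exp.const_mul (Real.sqrt (2 * Real.pi * ((1 : NNReal) : ℝ)))⁻¹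
  rw [gaussianPDFReal_def]
  refine h2.congr_deriv ?_
  ring

lemma integrable_gaussianReal_iff (g : ℝ → ℝ) :
    Integrable g (gaussianReal 0 1) ↔ Integrable (fun t => g t * gaussianPDFReal 0 1 t) := by
  rw [gaussianReal_of_var_ne_zero 0 one_ne_zero,
    integrable_withDensity_iff_integrable_smul' (measurable_gaussianPDF 0 1)
      (Filter.Eventually.of_forall fun _ => gaussianPDF_lt_top)]
  simp only [toReal_gaussianPDF, smul_eq_mul, mul_comm]

/-- One-dimensional Gaussian integration by parts. -/
theorem integral_id_mul_gaussianReal {φ φ' : ℝ → ℝ} (hd : ∀ t, HasDerivAt φ (φ' t) t)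
    (h0 : Integrable φ (gaussianReal 0 1)) (h1 : Integrable (fun t => t * φ t) (gaussianReal 0 1))
    (h2 : Integrable φ' (gaussianReal 0 1)) :
    ∫ t, t * φ t ∂(gaussianReal 0 1) = ∫ t, φ' t ∂(gaussianReal 0 1) := by
  rw [integrable_gaussianReal_iff] at h0 h1 h2
  rw [integral_gaussianReal_eq_integral_smul one_ne_zero,
    integral_gaussianReal_eq_integral_smul one_ne_zero]
  -- The density p satisfies p' = -t p, so the factor t is traded for a derivative of `φ`;
  -- integrability makes the boundary terms vanish.
  have h3 := integral_mul_deriv_eq_deriv_mul_of_integrable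
    (u := φ) (u' := φ') (v := gaussianPDFReal 0 1) (v' := fun t => -(t * gaussianPDFReal 0 1 t))
    (fun x _ => hd x) (fun x _ => hasDerivAt_gaussianPDFReal_std x)
    (by convert h1.neg using 1; ext t; simp; ring) h2 h0
  have h4 : ∀ t, gaussianPDFReal 0 1 t • (t * φ t) = -(φ t * -(t * gaussianPDFReal 0 1 t)) := by
    intro t; simp; ring
  simp_rw [h4, integral_neg, h3, neg_neg, smul_eq_mul, mul_comm]

/-- Isolates coordinate `i` as an independent scalar Gaussian, which reduces integration by parts to
one-dimensional slices. -/
lemma measurePreserving_insertNth_stdGaussian {n : ℕ} (i : Fin (n + 1)) :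
    MeasurePreserving (fun p : ℝ × (Fin n → ℝ) =>
      (WithLp.toLp 2 (i.insertNth p.1 p.2) : Vec (n + 1)))
      ((gaussianReal 0 1).prod (Measure.pi fun _ => gaussianReal 0 1))
      (stdGaussian (Vec (n + 1))) := by
  have h1 := (measurePreserving_piFinSuccAbove
    (fun _ : Fin (n + 1) => gaussianReal 0 1) i).symm
  have h2 : MeasurePreserving (WithLp.toLp 2 : (Fin (n + 1) → ℝ) → Vec (n + 1))
      (Measure.pi fun _ => gaussianReal 0 1) (stdGaussian (Vec (n + 1))) :=
    ⟨WithLp.measurable_toLp _ _, map_pi_eq_stdGaussian⟩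
  exact h2.comp h1

/-- Gaussian integration by parts along a coordinate. -/
theorem integral_coord_mul_stdGaussian {n : ℕ} {φ : Vec n → ℝ} (hφ : Differentiable ℝ φ)
    (i : Fin n) (h0 : Integrable φ (stdGaussian (Vec n)))
    (h1 : Integrable (fun v => v i * φ v) (stdGaussian (Vec n)))
    (h2 : Integrable (fun v => fderiv ℝ φ v (EuclideanSpace.single i 1)) (stdGaussian (Vec n))) :
    ∫ v, v i * φ v ∂(stdGaussian (Vec n)) =
      ∫ v, fderiv ℝ φ v (EuclideanSpace.single i 1) ∂(stdGaussian (Vec n)) := by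
  cases n with
  | zero => exact i.elim0
  | succ n =>
  have hp := measurePreserving_insertNth_stdGaussian i
  set T := fun p : ℝ × (Fin n → ℝ) => (WithLp.toLp 2 (i.insertNth p.1 p.2) : Vec (n + 1))
    with hT
  have k0 := (hp.integrable_comp h0.aestronglyMeasurable).2 h0
  have k1 := (hp.integrable_comp h1.aestronglyMeasurable).2 h1
  have k2 := (hp.integrable_comp h2.aestronglyMeasurable).2 h2
  have hT' : ∀ (t : ℝ) (y : Fin n → ℝ), HasDerivAt (fun s => T (s, y))
      (EuclideanSpace.single i (1 : ℝ)) t := by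
    intro t y
    have : (fun s => T (s, y)) = fun s => s • EuclideanSpace.single i (1 : ℝ) + T (0, y) := by
      ext s j
      refine Fin.succAboveCases i ?_ (fun j => ?_) j <;> simp [hT]
    rw [this]
    simpa using ((hasDerivAt_id t).smul_const (EuclideanSpace.single i (1 : ℝ))).add_const (T (0, y))
  rw [← hp.map_eq, integral_map hp.aemeasurable (by rw [hp.map_eq]; exact h1.aestronglyMeasurable),
    integral_map hp.aemeasurable (by rw [hp.map_eq]; exact h2.aestronglyMeasurable)]
  simp only [Function.comp_def] at k0 k1 k2
  rw [integral_prod_symm _ k1, integral_prod_symm _ k2]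
  refine integral_congr_ae ?_
  -- Integrability on the product descends only to almost every slice, which is enough under the
  -- outer integral.
  filter_upwards [k0.prod_left_ae, k1.prod_left_ae, k2.prod_left_ae] with y l0 l1 l2
  have hc : ∀ t : ℝ, (T (t, y)) i = t := by intro t; simp [hT]
  have := integral_id_mul_gaussianReal (φ := fun t => φ (T (t, y)))
    (φ' := fun t => fderiv ℝ φ (T (t, y)) (EuclideanSpace.single i 1))
    (fun t => (hφ (T (t, y))).hasFDerivAt.comp_hasDerivAt t (hT' t y)) l0
    (by simpa only [Function.comp_def, hc] using l1) l2
  simpa only [Function.comp_def, hc] using this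

/-- Gaussian vectors have moments of every order, so polynomial growth suffices. -/
lemma integrable_stdGaussian_of_growth {n : ℕ} {E : Type*} [NormedAddCommGroup E]
    {g : Vec n → E} (hg : AEStronglyMeasurable g (stdGaussian (Vec n))) (C : ℝ) (p : ℕ)
    (h : ∀ v, ‖g v‖ ≤ C * (1 + ‖v‖) ^ p) : Integrable g (stdGaussian (Vec n)) := by
  have h1 : MemLp (fun v : Vec n => 1 + ‖v‖) (p : ENNReal) (stdGaussian (Vec n)) :=
by
    have h2 : MemLp (id : Vec n → Vec n) p (stdGaussian (Vec n)) :=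
      IsGaussian.memLp_id (stdGaussian (Vec n)) p (ENNReal.natCast_ne_top p)
    exact (memLp_const (1 : ℝ)).add h2.norm
  have h2 : Integrable (fun v : Vec n => (1 + ‖v‖) ^ p) (stdGaussian (Vec n)) := by
    refine (h1.integrable_norm_pow' ).congr (Filter.Eventually.of_forall fun v => ?_)
    simp only [Real.norm_eq_abs, abs_of_nonneg (show 0 ≤ 1 + ‖v‖ by positivity)]
  exact (h2.const_mul C).mono' hg (Filter.Eventually.of_forall h)

/-- Gaussian integration by parts in the direction `a`. -/
theorem integral_inner_mul_stdGaussian {n : ℕ} {φ : Vec n → ℝ} {φ' : Vec n → Vec n →L[ℝ] ℝ}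
    (hφ : ∀ v, HasFDerivAt φ (φ' v) v) (C : ℝ) (p : ℕ) (h0 : ∀ v, |φ v| ≤ C * (1 + ‖v‖) ^ p)
    (h1 : ∀ v, ‖φ' v‖ ≤ C * (1 + ‖v‖) ^ p) (a : Vec n) :
    ∫ v, inner ℝ a v * φ v ∂(stdGaussian (Vec n)) = ∫ v, φ' v a ∂(stdGaussian (Vec n)) := by
  have hd : Differentiable ℝ φ := fun v => (hφ v).differentiableAt
  have hc : AEStronglyMeasurable φ (stdGaussian (Vec n)) := hd.continuous.aestronglyMeasurable
  have hφ' : ∀ v, fderiv ℝ φ v = φ' v := fun v => (hφ v).fderiv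
  have i0 : Integrable φ (stdGaussian (Vec n)) := integrable_stdGaussian_of_growth hc C p h0
  have i1 : ∀ i, Integrable (fun v => v i * φ v) (stdGaussian (Vec n)) := by
    intro i
    refine integrable_stdGaussian_of_growth
      ((by fun_prop : Continuous fun v : Vec n => v i).aestronglyMeasurable.mul hc)
      C (p + 1) fun v => ?_
    have a1 : ‖v i‖ ≤ 1 + ‖v‖ := (PiLp.norm_apply_le v i).trans (by linarith)
    rw [norm_mul, pow_succ, ← mul_assoc, mul_comm]
    exact mul_le_mul (h0 v) a1 (norm_nonneg _) ((abs_nonneg _).trans (h0 v))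
  have i2 : ∀ b, Integrable (fun v => φ' v b) (stdGaussian (Vec n)) := by
    intro b
    simp_rw [← hφ']
    refine integrable_stdGaussian_of_growth
      (measurable_fderiv_apply_const ℝ φ b).aestronglyMeasurable (C * ‖b‖) p fun v => ?_
    rw [hφ', mul_right_comm]
    exact (φ' v).le_of_opNorm_le (h1 v) b
  have ha : a = ∑ i, a i • EuclideanSpace.single i (1 : ℝ) := by
    ext j
    simp [Finset.sum_apply, Pi.single_apply]
  have e1 : ∀ v : Vec n, inner ℝ a v * φ v = ∑ i, a i * (v i * φ v) := by
    intro v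
    simp only [PiLp.inner_apply, RCLike.inner_apply, conj_trivial, Finset.sum_mul]
    exact Finset.sum_congr rfl fun i _ => by ring
  have e2 : ∀ v : Vec n, φ' v a = ∑ i, a i * φ' v (EuclideanSpace.single i 1) := by
    intro v
    conv_lhs => rw [ha]
    simp
  simp_rw [e1, e2]
  rw [integral_finsetSum _ fun i _ => (i1 i).const_mul _,
    integral_finsetSum _ fun i _ => (i2 _).const_mul _]
  refine Finset.sum_congr rfl fun i _ => ?_
  rw [integral_const_mul, integral_const_mul]
  congr 1
  have := integral_coord_mul_stdGaussian hd i i0 (i1 i) (by simpa only [hφ'] using i2 _)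
  simpa only [hφ'] using this

/-- Gaussian integration by parts for the radial field `v ↦ φ v • v`. -/
theorem integral_normSq_mul_stdGaussian {n : ℕ} {φ : Vec n → ℝ} {φ' : Vec n → Vec n →L[ℝ] ℝ}
    (hφ : ∀ v, HasFDerivAt φ (φ' v) v) (C : ℝ) (p : ℕ) (h0 : ∀ v, |φ v| ≤ C * (1 + ‖v‖) ^ p)
    (h1 : ∀ v, ‖φ' v‖ ≤ C * (1 + ‖v‖) ^ p) :
    ∫ v, ‖v‖ ^ 2 * φ v ∂(stdGaussian (Vec n)) =
      ∫ v, (n * φ v + φ' v v) ∂(stdGaussian (Vec n)) := by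
  have hd : Differentiable ℝ φ := fun v => (hφ v).differentiableAt
  have hφ' : ∀ v, fderiv ℝ φ v = φ' v := fun v => (hφ v).fderiv
  have hC : 0 ≤ C := by simpa using (abs_nonneg _).trans (h0 0)
  have hco : ∀ i (v : Vec n), HasFDerivAt (fun v : Vec n => v i)
      (EuclideanSpace.proj i : Vec n →L[ℝ] ℝ) v := fun i v =>
    (EuclideanSpace.proj i : Vec n →L[ℝ] ℝ).hasFDerivAt
  have hpr : ∀ i, ‖(EuclideanSpace.proj i : Vec n →L[ℝ] ℝ)‖ ≤ 1 := fun i =>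
    ContinuousLinearMap.opNorm_le_bound _ zero_le_one fun v => by
      simpa using PiLp.norm_apply_le v i
  have hv1 : ∀ i (v : Vec n), |v i| ≤ 1 + ‖v‖ := fun i v =>
    (PiLp.norm_apply_le v i).trans (by linarith)
  -- Multiplication by a coordinate raises the growth degree by one; the constant 2 C leaves room
  -- for the two terms of the product rule in `hb1`.
  have hb0 : ∀ i (v : Vec n), |v i * φ v| ≤ (2 * C) * (1 + ‖v‖) ^ (p + 1) := by
    intro i v
    rw [abs_mul]
    calc |v i| * |φ v| ≤ (1 + ‖v‖) * (C * (1 + ‖v‖) ^ p) :=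
          mul_le_mul (hv1 i v) (h0 v) (abs_nonneg _) (by positivity)
      _ ≤ _ := by
          rw [pow_succ]
          nlinarith [show 0 ≤ C * ((1 + ‖v‖) ^ p * (1 + ‖v‖)) by positivity]
  have hb1 : ∀ i (v : Vec n), ‖v i • φ' v + φ v • (EuclideanSpace.proj i : Vec n →L[ℝ] ℝ)‖ ≤
      (2 * C) * (1 + ‖v‖) ^ (p + 1) := by
    intro i v
    have a1 : |v i| * ‖φ' v‖ ≤ (1 + ‖v‖) * (C * (1 + ‖v‖) ^ p) :=
      mul_le_mul (hv1 i v) (h1 v) (norm_nonneg _) (by positivity)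
    have a2 : |φ v| * ‖(EuclideanSpace.proj i : Vec n →L[ℝ] ℝ)‖ ≤
        (C * (1 + ‖v‖) ^ p) * (1 + ‖v‖) :=
      mul_le_mul (h0 v) ((hpr i).trans (by linarith [norm_nonneg v])) (norm_nonneg _)
        (by positivity)
    refine (norm_add_le _ _).trans ?_
    rw [norm_smul, norm_smul, Real.norm_eq_abs, Real.norm_eq_abs, pow_succ]
    linarith
  -- Integration by parts in direction e_i for v ↦ v_i φ(v). The product rule yields φ once for
  -- every `i`, hence n φ in the sum, and the other terms add up to the radial derivative.
  have key : ∀ i : Fin n, ∫ v, v i * (v i * φ v) ∂(stdGaussian (Vec n)) =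
      ∫ v, (v i * φ' v (EuclideanSpace.single i 1) + φ v) ∂(stdGaussian (Vec n)) := by
    intro i
    have := integral_inner_mul_stdGaussian (fun v => (hco i v).mul (hφ v)) (2 * C) (p + 1)
      (hb0 i) (hb1 i) (EuclideanSpace.single i 1)
    simpa [EuclideanSpace.inner_single_left] using this
  have i0 : Integrable φ (stdGaussian (Vec n)) :=
    integrable_stdGaussian_of_growth hd.continuous.aestronglyMeasurable C p h0
  have i1 : ∀ i, Integrable (fun v => v i * (v i * φ v)) (stdGaussian (Vec n)) := by
    intro i
    refine integrable_stdGaussian_of_growth (Continuous.aestronglyMeasurable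
      ((by fun_prop : Continuous fun v : Vec n => v i).mul
        ((by fun_prop : Continuous fun v : Vec n => v i).mul hd.continuous)))
      (2 * C) (p + 2) fun v => ?_
    rw [norm_mul, pow_succ, ← mul_assoc, mul_comm]
    exact mul_le_mul (hb0 i v) (hv1 i v) (norm_nonneg _) (by positivity)
  have i2 : ∀ i, Integrable (fun v => v i * φ' v (EuclideanSpace.single i 1))
      (stdGaussian (Vec n)) := by
    intro i
    refine integrable_stdGaussian_of_growth (AEStronglyMeasurable.mul
      (by fun_prop : Continuous fun v : Vec n => v i).aestronglyMeasurable
      (by simpa only [hφ'] using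
        (measurable_fderiv_apply_const ℝ φ (EuclideanSpace.single i 1)).aestronglyMeasurable))
      C (p + 1) fun v => ?_
    rw [norm_mul, pow_succ, ← mul_assoc, mul_comm]
    refine mul_le_mul ?_ (hv1 i v) (norm_nonneg _) (by positivity)
    simpa using (φ' v).le_of_opNorm_le (h1 v) (EuclideanSpace.single i 1)
  have e1 : ∀ v : Vec n, ‖v‖ ^ 2 * φ v = ∑ i, v i * (v i * φ v) := by
    intro v
    rw [EuclideanSpace.real_norm_sq_eq, Finset.sum_mul]
    exact Finset.sum_congr rfl fun i _ => by ring
  have e2 : ∀ v : Vec n, (n * φ v + φ' v v) =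
      ∑ i, (v i * φ' v (EuclideanSpace.single i 1) + φ v) := by
    intro v
    have hv : v = ∑ i, v i • EuclideanSpace.single i (1 : ℝ) := by
      ext j
      simp [Finset.sum_apply, Pi.single_apply]
    have : φ' v v = ∑ i, v i * φ' v (EuclideanSpace.single i 1) := by
      refine (congrArg (φ' v) hv).trans ?_
      rw [map_sum]
      exact Finset.sum_congr rfl fun i _ => by rw [map_smul, smul_eq_mul]
    rw [this, Finset.sum_add_distrib]
    simp [add_comm]
  have i3 : ∀ i, Integrable (fun v => v i * φ' v (EuclideanSpace.single i 1) + φ v)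
      (stdGaussian (Vec n)) := fun i => (i2 i).add i0
  simp_rw [e1, e2]
  rw [integral_finsetSum _ fun i _ => i1 i, integral_finsetSum _ fun i _ => i3 i]
  exact Finset.sum_congr rfl fun i _ => key i

/-- For φ homogeneous of degree d, Euler's identity φ'(v) v = d φ(v) turns the radial formula into
E‖v‖² φ = (n + d) E φ. The choices φ = ‖v‖^d with d = 0, 2, 4 give the second, fourth and sixth
moments, and φ = ⟨a, v⟩² gives the mixed one. -/
theorem integral_normSq_stdGaussian (n : ℕ) :
    ∫ v, ‖v‖ ^ 2 ∂(stdGaussian (Vec n)) = n := by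
  have := integral_normSq_mul_stdGaussian (n := n) (φ := fun _ => 1) (φ' := fun _ => 0)
    (fun v => hasFDerivAt_const 1 v) 1 0 (by simp) (by simp)
  simpa using this

theorem integral_norm_pow_four_stdGaussian (n : ℕ) :
    ∫ v, ‖v‖ ^ 4 ∂(stdGaussian (Vec n)) = n * (n + 2) := by
  have := integral_normSq_mul_stdGaussian (n := n) (φ := fun v => ‖v‖ ^ 2)
    (fun v => (hasStrictFDerivAt_norm_sq v).hasFDerivAt) 2 2
    (fun v => by
      rw [abs_of_nonneg (by positivity)]
      nlinarith [norm_nonneg v])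
    (fun v => by
      rw [← Nat.cast_smul_eq_nsmul ℝ, norm_smul, innerSL_apply_norm]
      norm_num
      nlinarith [norm_nonneg v])
  have e : ∀ v : Vec n, ‖v‖ ^ 2 * ‖v‖ ^ 2 = ‖v‖ ^ 4 := fun v => by ring
  simp_rw [e] at this
  rw [this]
  have e' : ∀ v : Vec n, (n * ‖v‖ ^ 2 + (2 • innerSL ℝ v) v : ℝ) = (n + 2) * ‖v‖ ^ 2 := by
    intro v
    simp
    ring
  simp_rw [e']
  rw [integral_const_mul, integral_normSq_stdGaussian]
  ring

theorem integral_norm_pow_six_stdGaussian (n : ℕ) :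
    ∫ v, ‖v‖ ^ 6 ∂(stdGaussian (Vec n)) = n * (n + 2) * (n + 4) := by
  have hd : ∀ v : Vec n, HasFDerivAt (fun v : Vec n => (‖v‖ ^ 2) ^ 2)
      ((2 * ‖v‖ ^ 2) • (2 • innerSL ℝ v)) v := fun v => by
    simpa using (hasStrictFDerivAt_norm_sq v).hasFDerivAt.pow 2
  have := integral_normSq_mul_stdGaussian (n := n) hd 4 4
    (fun v => by
      rw [abs_of_nonneg (by positivity), ← pow_mul]
      have : ‖v‖ ^ 4 ≤ (1 + ‖v‖) ^ 4 := by gcongr; linarith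
      have h2 : 0 ≤ ‖v‖ ^ 4 := by positivity
      norm_num
      linarith)
    (fun v => by
      rw [← Nat.cast_smul_eq_nsmul ℝ, norm_smul, norm_smul, innerSL_apply_norm, Real.norm_eq_abs,
        abs_of_nonneg (by positivity)]
      have : ‖v‖ ^ 3 ≤ (1 + ‖v‖) ^ 3 := by gcongr; linarith
      have h2 : (1 + ‖v‖) ^ 3 ≤ (1 + ‖v‖) ^ 4 :=
        pow_le_pow_right₀ (by linarith [norm_nonneg v]) (by norm_num)
      norm_num
      nlinarith)
  have e : ∀ v : Vec n, ‖v‖ ^ 2 * (‖v‖ ^ 2) ^ 2 = ‖v‖ ^ 6 := fun v => by ring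
  simp_rw [e] at this
  rw [this]
  have e' : ∀ v : Vec n, (n * (‖v‖ ^ 2) ^ 2 + ((2 * ‖v‖ ^ 2) • (2 • innerSL ℝ v)) v : ℝ) =
      (n + 4) * ‖v‖ ^ 4 := by
    intro v
    simp
    ring
  simp_rw [e']
  rw [integral_const_mul, integral_norm_pow_four_stdGaussian]
  ring

theorem integral_inner_sq_stdGaussian {n : ℕ} (a : Vec n) :
    ∫ v, inner ℝ a v ^ 2 ∂(stdGaussian (Vec n)) = ‖a‖ ^ 2 := by
  have := integral_inner_mul_stdGaussian (n := n) (φ := fun v => inner ℝ a v)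
    (φ' := fun _ => innerSL ℝ a) (fun v => (innerSL ℝ a).hasFDerivAt) ‖a‖ 1
    (fun v => (abs_real_inner_le_norm a v).trans (by nlinarith [norm_nonneg a, norm_nonneg v]))
    (fun v => by
      rw [innerSL_apply_norm]
      nlinarith [norm_nonneg a, norm_nonneg v, mul_nonneg (norm_nonneg a) (norm_nonneg v)]) a
  simpa [← pow_two] using this

theorem integral_normSq_mul_inner_sq_stdGaussian {n : ℕ} (a : Vec n) :
    ∫ v, ‖v‖ ^ 2 * inner ℝ a v ^ 2 ∂(stdGaussian (Vec n)) = (n + 2) * ‖a‖ ^ 2 := by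
  have hd : ∀ v : Vec n, HasFDerivAt (fun v : Vec n => inner ℝ a v ^ 2)
      ((2 * inner ℝ a v) • innerSL ℝ a) v := fun v => by
    simpa using (innerSL ℝ a).hasFDerivAt.pow 2
  have hi : ∀ v : Vec n, |inner ℝ a v| ≤ ‖a‖ * ‖v‖ := abs_real_inner_le_norm a
  have := integral_normSq_mul_stdGaussian (n := n) hd (2 * ‖a‖ ^ 2) 2
    (fun v => by
      rw [abs_pow]
      calc |inner ℝ a v| ^ 2 ≤ (‖a‖ * ‖v‖) ^ 2 := by gcongr; exact hi v
        _ ≤ (‖a‖ * (1 + ‖v‖)) ^ 2 := by gcongr; linarith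
        _ ≤ _ := by rw [mul_pow]; nlinarith [show 0 ≤ ‖a‖ ^ 2 * (1 + ‖v‖) ^ 2 by positivity])
    (fun v => by
      rw [norm_smul, innerSL_apply_norm, norm_mul, Real.norm_eq_abs, Real.norm_eq_abs]
      norm_num
      calc 2 * |inner ℝ a v| * ‖a‖ ≤ 2 * (‖a‖ * ‖v‖) * ‖a‖ := by gcongr; exact hi v
        _ = 2 * ‖a‖ ^ 2 * ‖v‖ := by ring
        _ ≤ _ := by gcongr; nlinarith [norm_nonneg v])
  rw [this]
  have e' : ∀ v : Vec n, (n * inner ℝ a v ^ 2 + ((2 * inner ℝ a v) • innerSL ℝ a) v : ℝ) =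
      (n + 2) * inner ℝ a v ^ 2 := by
    intro v
    simp
    ring
  simp_rw [e']
  rw [integral_const_mul, integral_inner_sq_stdGaussian]

/-! ### Derivatives along segments. -/

/-- The gradient of a distance generating function exists only relative to `X`, so segments are
differentiated relative to [0, 1]. -/
lemma hasDerivWithinAt_comp_segment {n : ℕ} {X : Set (Vec n)} (hX : Convex ℝ X) {w : Vec n → ℝ}
    {g x u : Vec n} (hx : x ∈ X) (hu : u ∈ X) {t : ℝ} (hw : HasGradientWithinAt w g X
      (x + t • (u - x))) :
    HasDerivWithinAt (fun s : ℝ => w (x + s • (u - x))) (inner ℝ g (u - x)) (Set.Icc 0 1) t := by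
  have h1 : HasDerivWithinAt (fun s : ℝ => x + s • (u - x)) (u - x) (Set.Icc 0 1) t := by
    have := (((hasDerivAt_id t).smul_const (u - x)).const_add x).hasDerivWithinAt
      (s := Set.Icc 0 1)
    rwa [one_smul] at this
  have h3 := hw.hasFDerivWithinAt.comp_hasDerivWithinAt t h1
    (fun t ht => hX.add_smul_sub_mem hx hu ht)
  rwa [InnerProductSpace.toDual_apply_apply] at h3

lemma le_of_hasDerivWithinAt_Icc {φ : ℝ → ℝ} {c c' : ℝ}
    (hφ : HasDerivWithinAt φ c' (Set.Icc 0 1) 0)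
    (h : ∀ t : ℝ, 0 < t → t ≤ 1 → t * c ≤ φ t - φ 0) : c ≤ c' := by
  have h4 := hφ.mono (Set.Ioc_subset_Icc_self (a := (0 : ℝ)) (b := 1))
  rw [hasDerivWithinAt_iff_tendsto_slope' (by simp), nhdsWithin_Ioc_eq_nhdsGT zero_lt_one] at h4
  refine ge_of_tendsto h4 ?_
  filter_upwards [Ioc_mem_nhdsGT zero_lt_one] with t ht
  have := h t ht.1 ht.2
  rw [slope_def_field, sub_zero, le_div_iff₀ ht.1]
  linarith

/-- A lower bound for the increments of `w` along a segment bounds its directional derivative. -/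
lemma le_inner_gradientWithin {n : ℕ} {X : Set (Vec n)} (hX : Convex ℝ X) {w : Vec n → ℝ}
    {g x u : Vec n} (hw : HasGradientWithinAt w g X x) (hx : x ∈ X) (hu : u ∈ X) {c : ℝ}
    (h : ∀ t : ℝ, 0 < t → t ≤ 1 → t * c ≤ w (x + t • (u - x)) - w x) :
    c ≤ inner ℝ g (u - x) := by
  have e : x + (0 : ℝ) • (u - x) = x := by rw [zero_smul, add_zero]
  refine le_of_hasDerivWithinAt_Icc
    (hasDerivWithinAt_comp_segment hX hx hu (t := 0) (by rwa [e])) fun t ht ht' => ?_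
  rw [e]
  exact h t ht ht'

lemma hasDerivAt_comp_segment {n : ℕ} {f : Vec n → ℝ} (hf : Differentiable ℝ f) (x d : Vec n)
    (t : ℝ) : HasDerivAt (fun s : ℝ => f (x + s • d)) (inner ℝ (∇ f (x + t • d)) d) t := by
  have h1 : HasDerivAt (fun s : ℝ => x + s • d) d t := by
    simpa using ((hasDerivAt_id t).smul_const d).const_add x
  have h2 := (hf (x + t • d)).hasGradientAt.hasFDerivAt
  have h3 := h2.comp_hasDerivAt t h1
  rwa [InnerProductSpace.toDual_apply_apply] at h3

lemma ConvexOn.inner_gradient_le {n : ℕ} {f : Vec n → ℝ} (hf : ConvexOn ℝ Set.univ f)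
    (hd : Differentiable ℝ f) (x y : Vec n) : inner ℝ (∇ f x) (y - x) ≤ f y - f x := by
  -- Convexity bounds the increments of f from above, whereas `le_inner_gradientWithin` wants a
  -- lower bound; hence the change of sign.
  have h1 : HasGradientWithinAt (fun z => - f z) (-∇ f x) Set.univ x := by
    have := (hd x).hasGradientAt.hasFDerivAt.neg
    rw [hasGradientWithinAt_iff_hasFDerivWithinAt]
    rw [map_neg]
    exact this.hasFDerivWithinAt
  have := le_inner_gradientWithin convex_univ h1 (Set.mem_univ x) (Set.mem_univ y)
    (c := -(f y - f x)) (fun t ht ht' => by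
      have := hf.2 (Set.mem_univ x) (Set.mem_univ y) (by linarith : 0 ≤ 1 - t) ht.le (by ring)
      have e : (1 - t) • x + t • y = x + t • (y - x) := by
        rw [sub_smul, one_smul, smul_sub]; abel
      rw [e] at this
      simp only [smul_eq_mul] at this
      linarith)
  rw [inner_neg_left] at this
  linarith

/-! ### Functions with Lipschitz gradient. -/

section C11

variable {n : ℕ} {L : ℝ} {f : Vec n → ℝ}

/-- The quadratic Taylor bound for functions with Lipschitz gradient. -/
lemma IsC11.abs_sub_le (hf : IsC11 L f) (x y : Vec n) :
    |f y - f x - inner ℝ (∇ f x) (y - x)| ≤ L / 2 * ‖y - x‖ ^ 2 := by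
  set d := y - x with hd
  have h1 : ∀ t : ℝ, HasDerivAt (fun s : ℝ => f (x + s • d) - f x - s * inner ℝ (∇ f x) d)
      (inner ℝ (∇ f (x + t • d)) d - inner ℝ (∇ f x) d) t := fun t => by
    refine (((hasDerivAt_comp_segment hf.1 x d t).sub_const (f x)).sub
      ((hasDerivAt_id t).mul_const (inner ℝ (∇ f x) d))).congr_deriv ?_
    rw [one_mul]
  have h2 : ∀ t : ℝ, HasDerivAt (fun s : ℝ => L / 2 * ‖d‖ ^ 2 * s ^ 2) (L * ‖d‖ ^ 2 * t) t :=
    fun t => by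
      refine ((hasDerivAt_pow 2 t).const_mul (L / 2 * ‖d‖ ^ 2)).congr_deriv ?_
      simp
      ring
  -- On the segment the Taylor remainder has derivative at most L‖d‖² t in absolute value, which is
  -- the derivative of the comparison function in `h2`.
  have := image_norm_le_of_norm_deriv_right_le_deriv_boundary (a := 0) (b := 1)
    (fun t _ => (h1 t).continuousAt.continuousWithinAt)
    (fun t _ => (h1 t).hasDerivWithinAt) (by simp) h2
    (fun t ht => by
      rw [← inner_sub_left]
      refine (norm_inner_le_norm _ _).trans ?_
      have := hf.2 x (x + t • d)
      rw [add_sub_cancel_left, norm_smul, Real.norm_eq_abs, abs_of_nonneg ht.1] at this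
      nlinarith [norm_nonneg d])
    (x := 1) (by simp)
  simpa [hd] using this

lemma IsC11.le_quadratic (hf : IsC11 L f) (x y : Vec n) :
    f y ≤ f x + inner ℝ (∇ f x) (y - x) + L / 2 * ‖y - x‖ ^ 2 := by
  linarith [(abs_le.1 (hf.abs_sub_le x y)).2]

lemma IsC11.continuous_gradient (hf : IsC11 L f) : Continuous (∇ f) := by
  refine (LipschitzWith.of_dist_le_mul (K := L.toNNReal) fun x y => ?_).continuous
  rw [dist_eq_norm, dist_eq_norm]
  exact (hf.2 y x).trans (by gcongr; exact Real.le_coe_toNNReal L)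

lemma IsC11.abs_sub_le_growth (hf : IsC11 L f) (x d : Vec n) :
    |f (x + d) - f x| ≤ ‖∇ f x‖ * ‖d‖ + L / 2 * ‖d‖ ^ 2 := by
  have h1 := hf.abs_sub_le x (x + d)
  rw [add_sub_cancel_left] at h1
  have h2 := abs_real_inner_le_norm (∇ f x) d
  have : f (x + d) - f x = (f (x + d) - f x - inner ℝ (∇ f x) d) + inner ℝ (∇ f x) d := by ring
  rw [this]
  exact (abs_add_le _ _).trans (by linarith)

lemma IsC11.norm_gradient_add_le (hf : IsC11 L f) (x d : Vec n) :
    ‖∇ f (x + d)‖ ≤ ‖∇ f x‖ + L * ‖d‖ := by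
  have h1 := hf.2 x (x + d)
  rw [add_sub_cancel_left] at h1
  have : ∇ f (x + d) = ∇ f x + (∇ f (x + d) - ∇ f x) := by abel
  rw [this]
  exact (norm_add_le _ _).trans (by linarith)

/-- A fixed increment of a function with Lipschitz gradient is Lipschitz in the base point. -/
lemma IsC11.abs_increment_sub_le (hf : IsC11 L f) (c x y : Vec n) :
    |(f (x + c) - f x) - (f (y + c) - f y)| ≤ L * ‖c‖ * ‖x - y‖ := by
  have h1 : ∀ z ∈ (Set.univ : Set (Vec n)), HasFDerivWithinAt (fun z => f (z + c) - f z)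
      (InnerProductSpace.toDual ℝ (Vec n) (∇ f (z + c) - ∇ f z)) Set.univ z := by
    intro z _
    have a1 := (hf.1 (z + c)).hasGradientAt.hasFDerivAt.comp z
      ((hasFDerivAt_id z).add_const c)
    rw [ContinuousLinearMap.comp_id] at a1
    have a2 := (hf.1 z).hasGradientAt.hasFDerivAt
    rw [map_sub]
    exact (a1.sub a2).hasFDerivWithinAt
  -- Mean value inequality: the gradient ∇f(z + c) - ∇f(z) of the increment has norm at most L‖c‖.
  have h2 := convex_univ.norm_image_sub_le_of_norm_hasFDerivWithin_le (C := L * ‖c‖) h1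
    (fun z _ => by
      rw [LinearIsometryEquiv.norm_map]
      have := hf.2 z (z + c)
      rwa [add_sub_cancel_left] at this) (Set.mem_univ y) (Set.mem_univ x)
  exact h2

end C11

/-! ### Gaussian smoothing and the finite-difference estimator. -/

section Smoothing

variable {n : ℕ} {L : ℝ} {f : Vec n → ℝ}

/-- The Gaussian smoothing `x ↦ E f(x + μ v)` of `f`. -/
def smooth (f : Vec n → ℝ) (μ : ℝ) (x : Vec n) : ℝ := ∫ v, f (x + μ • v) ∂(stdGaussian (Vec n))

/-- The gradient `x ↦ E ∇f(x + μ v)` of the Gaussian smoothing of `f`. -/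
def smoothGrad (f : Vec n → ℝ) (μ : ℝ) (x : Vec n) : Vec n :=
  ∫ v, ∇ f (x + μ • v) ∂(stdGaussian (Vec n))

lemma integrable_norm_pow_stdGaussian (p : ℕ) :
    Integrable (fun v : Vec n => ‖v‖ ^ p) (stdGaussian (Vec n)) :=
  integrable_stdGaussian_of_growth (by fun_prop) 1 p fun v => by
    rw [one_mul, norm_pow, norm_norm]
    gcongr
    linarith

lemma integrable_id_stdGaussian : Integrable (fun v : Vec n => v) (stdGaussian (Vec n)) :=
  IsGaussian.integrable_id

lemma IsC11.abs_shift_le (hL : 0 ≤ L) {μ : ℝ} (hμ : 0 ≤ μ) (hf : IsC11 L f) (x v : Vec n) :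
    |f (x + μ • v) - f x| ≤ (‖∇ f x‖ * μ + L / 2 * μ ^ 2) * (1 + ‖v‖) ^ 2 := by
  refine (hf.abs_sub_le_growth x (μ • v)).trans ?_
  rw [norm_smul, Real.norm_eq_abs, abs_of_nonneg hμ]
  have h1 : ‖v‖ ≤ (1 + ‖v‖) ^ 2 := by nlinarith [norm_nonneg v]
  have h2 : ‖v‖ ^ 2 ≤ (1 + ‖v‖) ^ 2 := by nlinarith [norm_nonneg v]
  calc ‖∇ f x‖ * (μ * ‖v‖) + L / 2 * (μ * ‖v‖) ^ 2
      = (‖∇ f x‖ * μ) * ‖v‖ + (L / 2 * μ ^ 2) * ‖v‖ ^ 2 := by ring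
    _ ≤ (‖∇ f x‖ * μ) * (1 + ‖v‖) ^ 2 + (L / 2 * μ ^ 2) * (1 + ‖v‖) ^ 2 := by gcongr
    _ = _ := by ring

lemma IsC11.integrable_shift_sub (hL : 0 ≤ L) {μ : ℝ} (hμ : 0 ≤ μ) (hf : IsC11 L f) (x : Vec n) :
    Integrable (fun v => f (x + μ • v) - f x) (stdGaussian (Vec n)) := by
  have := hf.1.continuous
  exact integrable_stdGaussian_of_growth (Continuous.aestronglyMeasurable (by fun_prop)) _ 2
    (hf.abs_shift_le hL hμ x)

lemma IsC11.integrable_shift (hL : 0 ≤ L) {μ : ℝ} (hμ : 0 ≤ μ) (hf : IsC11 L f) (x : Vec n) :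
    Integrable (fun v => f (x + μ • v)) (stdGaussian (Vec n)) := by
  refine ((hf.integrable_shift_sub hL hμ x).add (integrable_const (f x))).congr
    (Filter.Eventually.of_forall fun v => ?_)
  simp

lemma IsC11.norm_gradient_shift_le {μ : ℝ} (hμ : 0 ≤ μ) (hf : IsC11 L f)
    (x v : Vec n) : ‖∇ f (x + μ • v)‖ ≤ ‖∇ f x‖ + L * μ * ‖v‖ := by
  have := hf.norm_gradient_add_le x (μ • v)
  rw [norm_smul, Real.norm_eq_abs, abs_of_nonneg hμ] at this
  linarith

lemma IsC11.integrable_gradient_shift {μ : ℝ} (hμ : 0 ≤ μ) (hf : IsC11 L f)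
    (x : Vec n) : Integrable (fun v => ∇ f (x + μ • v)) (stdGaussian (Vec n)) := by
  have := hf.continuous_gradient
  refine Integrable.mono' (((integrable_const ‖∇ f x‖)).add
    ((integrable_norm_pow_stdGaussian 1).const_mul (L * μ)))
    (Continuous.aestronglyMeasurable (by fun_prop)) (Filter.Eventually.of_forall fun v => ?_)
  simpa using hf.norm_gradient_shift_le hμ x v

lemma IsC11.inner_smoothGrad {μ : ℝ} (hμ : 0 ≤ μ) (hf : IsC11 L f) (x a : Vec n) :
    inner ℝ (smoothGrad f μ x) a = ∫ v, inner ℝ (∇ f (x + μ • v)) a ∂(stdGaussian (Vec n)) := by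
  rw [smoothGrad, real_inner_comm, ← integral_inner (hf.integrable_gradient_shift hμ x) a]
  simp_rw [real_inner_comm]

/-- The Gaussian finite-difference representation of the gradient of the smoothing. -/
theorem IsC11.integral_gradFree (hL : 0 ≤ L) {μ : ℝ} (hμ : 0 < μ) (hf : IsC11 L f)
    (x a : Vec n) :
    ∫ v, (f (x + μ • v) - f x) / μ * inner ℝ v a ∂(stdGaussian (Vec n)) =
      inner ℝ (smoothGrad f μ x) a := by
  have hd : ∀ v : Vec n, HasFDerivAt (fun v => (f (x + μ • v) - f x) / μ)
      (InnerProductSpace.toDual ℝ (Vec n) (∇ f (x + μ • v))) v := by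
    intro v
    have h1 : HasFDerivAt (fun v : Vec n => x + μ • v) (μ • ContinuousLinearMap.id ℝ (Vec n)) v :=
      ((hasFDerivAt_id v).const_smul μ).const_add x
    have h2 := ((hf.1 (x + μ • v)).hasGradientAt.hasFDerivAt.comp v h1).sub_const (f x)
    have h3 := h2.mul_const (μ⁻¹)
    simp only [Function.comp_def, ← div_eq_mul_inv] at h3
    refine h3.congr_fderiv ?_
    ext z
    simp
    field_simp
  -- The factor μ from the chain rule cancels the 1/μ of the quotient, leaving ∇f(x + μ v). The
  -- growth constant adds one bound for the quotient and one for its derivative.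
  have := integral_inner_mul_stdGaussian hd
    ((‖∇ f x‖ * μ + L / 2 * μ ^ 2) / μ + ‖∇ f x‖ + L * μ) 2
    (fun v => by
      rw [abs_div, abs_of_pos hμ, div_le_iff₀ hμ]
      refine (hf.abs_shift_le hL hμ.le x v).trans ?_
      have : (‖∇ f x‖ * μ + L / 2 * μ ^ 2) ≤
          ((‖∇ f x‖ * μ + L / 2 * μ ^ 2) / μ + ‖∇ f x‖ + L * μ) * μ := by
        rw [add_mul, add_mul, div_mul_cancel₀ _ hμ.ne']
        have h1 := mul_nonneg (norm_nonneg (∇ f x)) hμ.le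
        have h2 := mul_nonneg (mul_nonneg hL hμ.le) hμ.le
        linarith
      calc _ ≤ ((‖∇ f x‖ * μ + L / 2 * μ ^ 2) / μ + ‖∇ f x‖ + L * μ) * μ * (1 + ‖v‖) ^ 2 := by
            gcongr
        _ = _ := by ring)
    (fun v => by
      rw [LinearIsometryEquiv.norm_map]
      refine (hf.norm_gradient_shift_le hμ.le x v).trans ?_
      have h1 : ‖v‖ ≤ (1 + ‖v‖) ^ 2 := by nlinarith [norm_nonneg v]
      have h2 : 1 ≤ (1 + ‖v‖) ^ 2 := by nlinarith [norm_nonneg v]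
      have h3 : 0 ≤ (‖∇ f x‖ * μ + L / 2 * μ ^ 2) / μ := by positivity
      calc ‖∇ f x‖ + L * μ * ‖v‖ ≤ ‖∇ f x‖ * (1 + ‖v‖) ^ 2 + L * μ * (1 + ‖v‖) ^ 2 := by
            gcongr
            nlinarith [norm_nonneg (∇ f x)]
        _ ≤ _ := by nlinarith) a
  rw [hf.inner_smoothGrad hμ.le]
  simp_rw [mul_comm _ (inner ℝ _ a : ℝ), real_inner_comm]
  simp_rw [this, InnerProductSpace.toDual_apply_apply, real_inner_comm]

/-- The linear Taylor term has mean zero, so the error is of second order in μ; the quadratic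
remainder contributes E‖v‖² = n. -/
theorem IsC11.abs_smooth_sub_le (hL : 0 ≤ L) {μ : ℝ} (hμ : 0 ≤ μ) (hf : IsC11 L f) (x : Vec n) :
    |smooth f μ x - f x| ≤ μ ^ 2 * L * n / 2 := by
  have i1 := hf.integrable_shift_sub hL hμ x
  have i3 : Integrable (fun v : Vec n => μ • v) (stdGaussian (Vec n)) :=
    integrable_id_stdGaussian.smul μ
  have i2 : Integrable (fun v : Vec n => inner ℝ (∇ f x) (μ • v)) (stdGaussian (Vec n)) :=
    i3.const_inner (∇ f x)
  have e1 : ∫ v : Vec n, inner ℝ (∇ f x) (μ • v) ∂(stdGaussian (Vec n)) = 0 := by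
    rw [integral_inner i3, integral_smul,
      integral_id_stdGaussian, smul_zero, inner_zero_right]
  have e2 : smooth f μ x - f x =
      ∫ v : Vec n, ((f (x + μ • v) - f x) - inner ℝ (∇ f x) (μ • v)) ∂(stdGaussian (Vec n)) := by
    rw [integral_sub i1 i2, e1, integral_sub (hf.integrable_shift hL hμ x) (integrable_const _)]
    simp [smooth]
  rw [e2, ← Real.norm_eq_abs]
  refine (norm_integral_le_of_norm_le
    ((integrable_norm_pow_stdGaussian 2).const_mul (L / 2 * μ ^ 2))
    (Filter.Eventually.of_forall fun v => ?_)).trans ?_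
  · have := hf.abs_sub_le x (x + μ • v)
    rw [add_sub_cancel_left, norm_smul, Real.norm_eq_abs, abs_of_nonneg hμ] at this
    exact this.trans (by linarith)
  · rw [integral_const_mul, integral_normSq_stdGaussian]
    linarith

theorem IsC11.smooth_le_quadratic (hL : 0 ≤ L) {μ : ℝ} (hμ : 0 ≤ μ) (hf : IsC11 L f)
    (x y : Vec n) :
    smooth f μ y ≤ smooth f μ x + inner ℝ (smoothGrad f μ x) (y - x) + L / 2 * ‖y - x‖ ^ 2 := by
  have i1 : Integrable (fun v => inner ℝ (∇ f (x + μ • v)) (y - x)) (stdGaussian (Vec n)) :=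
    (hf.integrable_gradient_shift hμ x).inner_const _
  have i2 : Integrable (fun v => f (x + μ • v) + inner ℝ (∇ f (x + μ • v)) (y - x))
      (stdGaussian (Vec n)) := (hf.integrable_shift hL hμ x).add i1
  have : smooth f μ y ≤ ∫ v, ((f (x + μ • v) + inner ℝ (∇ f (x + μ • v)) (y - x)) +
      L / 2 * ‖y - x‖ ^ 2) ∂(stdGaussian (Vec n)) :=
    integral_mono (hf.integrable_shift hL hμ y) (i2.add (integrable_const _)) fun v => by
      have := hf.le_quadratic (x + μ • v) (y + μ • v)
      rwa [add_sub_add_right_eq_sub] at this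
  refine this.trans_eq ?_
  rw [integral_add i2 (integrable_const _), integral_add (hf.integrable_shift hL hμ x) i1,
    hf.inner_smoothGrad hμ, smooth]
  simp

theorem IsC11.smooth_convex_le (hL : 0 ≤ L) {μ : ℝ} (hμ : 0 ≤ μ) (hf : IsC11 L f)
    (hc : ConvexOn ℝ Set.univ f) (x y : Vec n) :
    smooth f μ x + inner ℝ (smoothGrad f μ x) (y - x) ≤ smooth f μ y := by
  have i1 : Integrable (fun v => inner ℝ (∇ f (x + μ • v)) (y - x)) (stdGaussian (Vec n)) :=
    (hf.integrable_gradient_shift hμ x).inner_const _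
  rw [hf.inner_smoothGrad hμ, smooth, ← integral_add (hf.integrable_shift hL hμ x) i1]
  refine integral_mono ((hf.integrable_shift hL hμ x).add i1) (hf.integrable_shift hL hμ y)
    fun v => ?_
  have := ConvexOn.inner_gradient_le hc hf.1 (x + μ • v) (y + μ • v)
  rw [add_sub_add_right_eq_sub] at this
  linarith

lemma IsC11.norm_smoothGrad_sub_le {μ : ℝ} (hμ : 0 ≤ μ) (hf : IsC11 L f) (x y : Vec n) :
    ‖smoothGrad f μ y - smoothGrad f μ x‖ ≤ L * ‖y - x‖ := by
  rw [smoothGrad, smoothGrad, ← integral_sub (hf.integrable_gradient_shift hμ y)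
    (hf.integrable_gradient_shift hμ x)]
  refine (norm_integral_le_of_norm_le (integrable_const (L * ‖y - x‖))
    (Filter.Eventually.of_forall fun v => ?_)).trans_eq (by simp)
  have := hf.2 (x + μ • v) (y + μ • v)
  rwa [add_sub_add_right_eq_sub] at this

lemma IsC11.continuous_smoothGrad {μ : ℝ} (hμ : 0 ≤ μ) (hf : IsC11 L f) :
    Continuous (smoothGrad f μ) := by
  refine (LipschitzWith.of_dist_le_mul (K := L.toNNReal) fun x y => ?_).continuous
  rw [dist_eq_norm, dist_eq_norm]
  exact (hf.norm_smoothGrad_sub_le hμ y x).trans (by gcongr; exact Real.le_coe_toNNReal L)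

lemma IsC11.norm_smoothGrad_le {μ : ℝ} (hμ : 0 ≤ μ) (hf : IsC11 L f) (x : Vec n) :
    ‖smoothGrad f μ x‖ ≤ ‖∇ f x‖ + L * μ * ∫ v : Vec n, ‖v‖ ∂(stdGaussian (Vec n)) := by
  have i1 : Integrable (fun v : Vec n => L * μ * ‖v‖) (stdGaussian (Vec n)) :=
    integrable_id_stdGaussian.norm.const_mul _
  refine (norm_integral_le_of_norm_le ((integrable_const ‖∇ f x‖).add i1)
    (Filter.Eventually.of_forall fun v => hf.norm_gradient_shift_le hμ x v)).trans_eq ?_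
  simp only [Pi.add_apply]
  rw [integral_add (integrable_const _) i1, integral_const_mul]
  simp

/-- The second moment of the Gaussian finite-difference estimator. -/
theorem IsC11.integral_sq_gradFree_le {μ : ℝ} (hμ : 0 < μ) (hf : IsC11 L f)
    (x : Vec n) :
    Integrable (fun v => ‖((f (x + μ • v) - f x) / μ) • v‖ ^ 2) (stdGaussian (Vec n)) ∧
    ∫ v, ‖((f (x + μ • v) - f x) / μ) • v‖ ^ 2 ∂(stdGaussian (Vec n)) ≤
      μ ^ 2 * L ^ 2 / 2 * (n * (n + 2) * (n + 4)) + 2 * (n + 2) * ‖∇ f x‖ ^ 2 := by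
  -- The quotient D differs from s = ⟨∇f(x), v⟩ by at most L μ‖v‖² / 2. Then D² ≤ 2 (D - s)² + 2 s²
  -- is multiplied by ‖v‖².
  have hb : ∀ v : Vec n, ‖((f (x + μ • v) - f x) / μ) • v‖ ^ 2 ≤
      μ ^ 2 * L ^ 2 / 2 * ‖v‖ ^ 6 + 2 * (‖v‖ ^ 2 * inner ℝ (∇ f x) v ^ 2) := by
    intro v
    have h1 := hf.abs_sub_le x (x + μ • v)
    rw [add_sub_cancel_left, norm_smul, Real.norm_eq_abs μ, abs_of_pos hμ,
      real_inner_smul_right] at h1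
    set D := (f (x + μ • v) - f x) / μ with hD
    have hD' : f (x + μ • v) - f x = μ * D := by rw [hD]; field_simp
    set s := inner ℝ (∇ f x) v
    have h2 : |D - s| ≤ L / 2 * μ * ‖v‖ ^ 2 := by
      rw [hD', ← mul_sub, abs_mul, abs_of_pos hμ] at h1
      have : μ * |D - s| ≤ μ * (L / 2 * μ * ‖v‖ ^ 2) := h1.trans_eq (by ring)
      exact le_of_mul_le_mul_left this hμ
    have h3 : (D - s) ^ 2 ≤ (L / 2 * μ * ‖v‖ ^ 2) ^ 2 := by
      rw [← sq_abs]
      gcongr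
    have h4 : D ^ 2 ≤ 2 * (L / 2 * μ * ‖v‖ ^ 2) ^ 2 + 2 * s ^ 2 := by
      nlinarith [sq_nonneg (D - 2 * s)]
    rw [norm_smul, mul_pow, Real.norm_eq_abs, sq_abs]
    calc D ^ 2 * ‖v‖ ^ 2 ≤ (2 * (L / 2 * μ * ‖v‖ ^ 2) ^ 2 + 2 * s ^ 2) * ‖v‖ ^ 2 := by gcongr
      _ = _ := by ring
  have i6 : Integrable (fun v : Vec n => μ ^ 2 * L ^ 2 / 2 * ‖v‖ ^ 6) (stdGaussian (Vec n)) :=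
    (integrable_norm_pow_stdGaussian 6).const_mul _
  have i4 : Integrable (fun v : Vec n => 2 * (‖v‖ ^ 2 * inner ℝ (∇ f x) v ^ 2))
      (stdGaussian (Vec n)) := by
    refine (((integrable_norm_pow_stdGaussian 4).const_mul (‖∇ f x‖ ^ 2)).mono'
      (by fun_prop) (Filter.Eventually.of_forall fun v => ?_)).const_mul 2
    rw [Real.norm_eq_abs, abs_of_nonneg (by positivity)]
    calc ‖v‖ ^ 2 * inner ℝ (∇ f x) v ^ 2 ≤ ‖v‖ ^ 2 * (‖∇ f x‖ * ‖v‖) ^ 2 := by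
          rw [← sq_abs (inner ℝ _ _)]
          gcongr
          exact abs_real_inner_le_norm _ _
      _ = _ := by ring
  have i := i6.add i4
  have hc := hf.1.continuous
  have i0 : Integrable (fun v => ‖((f (x + μ • v) - f x) / μ) • v‖ ^ 2) (stdGaussian (Vec n)) :=
    i.mono' (Continuous.aestronglyMeasurable (by fun_prop)) (Filter.Eventually.of_forall fun v => by
      rw [Real.norm_eq_abs, abs_of_nonneg (by positivity)]
      exact hb v)
  refine ⟨i0, (integral_mono i0 i hb).trans_eq ?_⟩
  simp only [Pi.add_apply]
  rw [integral_add i6 i4, integral_const_mul, integral_const_mul,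
    integral_norm_pow_six_stdGaussian, integral_normSq_mul_inner_sq_stdGaussian]
  ring

end Smoothing

/-! ### Generalized projections. -/

section Prox

variable {n : ℕ} {X : Set (Vec n)} {α : ℝ} {h w : Vec n → ℝ} {gw : Vec n → Vec n}

/-- On the segment from `z` to `x`, subtract from `w` its linear part and the quadratic α/2 ‖d‖² s².
Strong monotonicity of `gw` makes the derivative of the difference nonnegative; compare the
endpoints. -/
lemma IsDistanceGenerating.le_proxV (hw : IsDistanceGenerating X α w gw) (hX : Convex ℝ X)
    {x z : Vec n} (hx : x ∈ X) (hz : z ∈ X) : α / 2 * ‖x - z‖ ^ 2 ≤ proxV w gw x z := by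
  set d := x - z with hd
  have hmem : ∀ t ∈ Set.Icc (0 : ℝ) 1, z + t • d ∈ X := fun t ht =>
    hX.add_smul_sub_mem hz hx ht
  have h1 : ∀ t ∈ Set.Icc (0 : ℝ) 1, HasDerivWithinAt
      (fun s : ℝ => w (z + s • d) - s * inner ℝ (gw z) d - α / 2 * ‖d‖ ^ 2 * s ^ 2)
      (inner ℝ (gw (z + t • d)) d - inner ℝ (gw z) d - α * ‖d‖ ^ 2 * t) (Set.Icc 0 1) t := by
    intro t ht
    have a1 := hasDerivWithinAt_comp_segment hX hz hx (hw.hasGradient _ (hmem t ht))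
    have a2 := ((hasDerivAt_id t).mul_const (inner ℝ (gw z) d)).hasDerivWithinAt
      (s := Set.Icc 0 1)
    have a3 := ((hasDerivAt_pow 2 t).const_mul (α / 2 * ‖d‖ ^ 2)).hasDerivWithinAt
      (s := Set.Icc 0 1)
    refine ((a1.sub a2).sub a3).congr_deriv ?_
    simp
    ring
  have h2 : MonotoneOn
      (fun s : ℝ => w (z + s • d) - s * inner ℝ (gw z) d - α / 2 * ‖d‖ ^ 2 * s ^ 2)
      (Set.Icc 0 1) := by
    refine monotoneOn_of_hasDerivWithinAt_nonneg (convex_Icc 0 1)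
      (fun t ht => (h1 t ht).continuousWithinAt)
      (fun t ht => (h1 t (interior_subset ht)).mono interior_subset) fun t ht => ?_
    rw [interior_Icc] at ht
    have := hw.strong _ (hmem t ⟨ht.1.le, ht.2.le⟩) z hz
    rw [add_sub_cancel_left, norm_smul, Real.norm_eq_abs, abs_of_pos ht.1, mul_pow,
      real_inner_smul_left, real_inner_comm, inner_sub_left] at this
    have h3 : t * (α * ‖d‖ ^ 2 * t) ≤ t * (inner ℝ (gw (z + t • d)) d - inner ℝ (gw z) d) := by
      linarith
    have := le_of_mul_le_mul_left h3 ht.1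
    linarith
  have h3 := h2 (Set.left_mem_Icc.2 zero_le_one) (Set.right_mem_Icc.2 zero_le_one) zero_le_one
  simp only [zero_smul, add_zero, zero_mul, one_smul, one_mul, hd, add_sub_cancel] at h3
  rw [proxV]
  linarith

/-- The variational inequality with parameter `p` that characterizes generalized projections. -/
def IsProxPoint (X : Set (Vec n)) (h : Vec n → ℝ) (gw : Vec n → Vec n) (γ : ℝ) (p u : Vec n) :
    Prop :=
  u ∈ X ∧ ∀ z ∈ X, 0 ≤ inner ℝ (p + gw u) (z - u) + γ * (h z - h u)

/-- First-order optimality in which only `w` is differentiated: `h` enters through convexity along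
the segment from `u` to `z`, so minimality gives a linear lower bound for the increments of `w`. The
data `g` and `x` survive only in the combination γ g - ∇ω(x). -/
lemma IsProjSolution.isProxPoint (hX : Convex ℝ X) (hh : ConvexOn ℝ X h)
    (hw : IsDistanceGenerating X α w gw) {γ : ℝ} (hγ : 0 < γ) {g x u : Vec n}
    (hu : IsProjSolution X h w gw γ g x u) : IsProxPoint X h gw γ (γ • g - gw x) u := by
  refine ⟨hu.1, fun z hz => ?_⟩
  have key := le_inner_gradientWithin hX (hw.hasGradient u hu.1) hu.1 hz
    (c := -(inner ℝ (γ • g - gw x) (z - u) + γ * (h z - h u))) (fun t ht ht' => by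
      have hmem : u + t • (z - u) ∈ X := hX.add_smul_sub_mem hu.1 hz ⟨ht.le, ht'⟩
      have h1 : projObjective h w gw γ g x u ≤ projObjective h w gw γ g x (u + t • (z - u)) :=
        hu.2 hmem
      have h2 := hh.2 hu.1 hz (by linarith : 0 ≤ 1 - t) ht.le (by ring)
      have e : (1 - t) • u + t • z = u + t • (z - u) := by
        rw [sub_smul, one_smul, smul_sub]; abel
      rw [e] at h2
      simp only [smul_eq_mul] at h2
      have e2 : u + t • (z - u) - x = (u - x) + t • (z - u) := by abel
      simp only [projObjective, proxV] at h1
      rw [e2, inner_add_right, inner_add_right, real_inner_smul_right,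
        real_inner_smul_right] at h1
      rw [inner_sub_left, real_inner_smul_left]
      set W := w (u + t • (z - u))
      set A := inner ℝ g (z - u)
      set B := inner ℝ (gw x) (z - u)
      have h3 : 0 ≤ γ * (t * A + (1 / γ) * (W - w u - t * B) + t * (h z - h u)) := by
        refine mul_nonneg hγ.le ?_
        have : (1 / γ) * (W - w u - t * B) = (1 / γ) * (W - (w x + (inner ℝ (gw x) (u - x) + t * B)))
          - (1 / γ) * (w u - (w x + inner ℝ (gw x) (u - x))) := by ring
        linarith
      have h4 : γ * (t * A + (1 / γ) * (W - w u - t * B) + t * (h z - h u)) =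
          γ * t * A + (W - w u - t * B) + γ * t * (h z - h u) := by
        field_simp
      linarith)
  rw [inner_add_left]
  linarith

/-- Each inequality is tested at the other point; adding them cancels `h`, and strong monotonicity
of `gw` does the rest. -/
lemma IsProxPoint.norm_sub_le (hw : IsDistanceGenerating X α w gw) {γ : ℝ}
    {p₁ p₂ u₁ u₂ : Vec n} (h₁ : IsProxPoint X h gw γ p₁ u₁) (h₂ : IsProxPoint X h gw γ p₂ u₂) :
    α * ‖u₁ - u₂‖ ≤ ‖p₁ - p₂‖ := by
  have a1 := h₁.2 u₂ h₂.1
  have a2 := h₂.2 u₁ h₁.1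
  have a3 := hw.strong u₁ h₁.1 u₂ h₂.1
  have e : u₂ - u₁ = -(u₁ - u₂) := by abel
  rw [e, inner_neg_right, inner_add_left] at a1
  rw [inner_add_left] at a2
  rw [real_inner_comm, inner_sub_left] at a3
  have a4 : -inner ℝ (p₁ - p₂) (u₁ - u₂) ≤ ‖p₁ - p₂‖ * ‖u₁ - u₂‖ :=
    (neg_le_abs _).trans (abs_real_inner_le_norm _ _)
  rw [inner_sub_left] at a4
  rcases (norm_nonneg (u₁ - u₂)).eq_or_lt with h0 | h0
  · rw [← h0, mul_zero]
    positivity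
  · refine le_of_mul_le_mul_right ?_ h0
    nlinarith

lemma IsProxPoint.eq (hα : 0 < α) (hw : IsDistanceGenerating X α w gw) {γ : ℝ} {p u₁ u₂ : Vec n}
    (h₁ : IsProxPoint X h gw γ p u₁) (h₂ : IsProxPoint X h gw γ p u₂) : u₁ = u₂ := by
  have := h₁.norm_sub_le hw h₂
  rw [sub_self, norm_zero] at this
  have h0 : ‖u₁ - u₂‖ ≤ 0 := by
    by_contra hc
    push Not at hc
    nlinarith [mul_pos hα hc]
  exact sub_eq_zero.1 (norm_le_zero_iff.1 h0)

lemma isProjSolution_genProj {γ : ℝ} {g x : Vec n}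
    (hu : ∃ u, IsProjSolution X h w gw γ g x u) :
    IsProjSolution X h w gw γ g x (genProj X h w gw γ g x) := by
  rw [genProj, dif_pos hu]
  exact hu.choose_spec

/-- The solution map of the generalized projection problem factors through a continuous resolvent
along which `h` is continuous. -/
theorem exists_continuous_resolvent (hX : Convex ℝ X) (hh : ConvexOn ℝ X h) (hα : 0 < α)
    (hw : IsDistanceGenerating X α w gw) {γ : ℝ} (hγ : 0 < γ)
    (hsolv : ∀ g : Vec n, ∀ x ∈ X, ∃ u, IsProjSolution X h w gw γ g x u)
    {x₁ : Vec n} (hx₁ : x₁ ∈ X) :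
    ∃ T : Vec n → Vec n, Continuous T ∧ (∀ p, T p ∈ X) ∧ Continuous (fun p => h (T p)) ∧
      ∀ g, ∀ x ∈ X, genProj X h w gw γ g x = T (γ • g - gw x) := by
  -- Because `g` is unrestricted, every parameter is reached from the one base point `x₁`: γ • γ⁻¹ •
  -- (p + gw x₁) - gw x₁ = p.
  set T : Vec n → Vec n := fun p => genProj X h w gw γ (γ⁻¹ • (p + gw x₁)) x₁ with hT
  have hTp : ∀ p, IsProxPoint X h gw γ p (T p) := by
    intro p
    have := (isProjSolution_genProj (hsolv (γ⁻¹ • (p + gw x₁)) x₁ hx₁)).isProxPoint hX hh hw hγ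
    rwa [smul_inv_smul₀ hγ.ne', add_sub_cancel_right] at this
  have hTc : Continuous T := by
    refine (LipschitzWith.of_dist_le_mul (K := (α⁻¹).toNNReal) fun p q => ?_).continuous
    rw [Real.coe_toNNReal _ (by positivity), dist_eq_norm, dist_eq_norm, inv_mul_eq_div,
      le_div_iff₀ hα, mul_comm]
    exact (hTp p).norm_sub_le hw (hTp q)
  have hgT : Continuous (fun p => gw (T p)) :=
    hw.continuousOn.comp_continuous hTc fun p => (hTp p).1
  refine ⟨T, hTc, fun p => (hTp p).1, ?_, fun g x hx => ?_⟩
  -- Convexity alone does not make `h` continuous up to the boundary of `X`. The inequalities at `T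
  -- p` and `T q`, each tested at the other point, squeeze `h (T p)`.
  · rw [continuous_iff_continuousAt]
    intro q
    have hu : Filter.Tendsto (fun p => h (T q) + γ⁻¹ * inner ℝ (p + gw (T p)) (T q - T p))
        (nhds q) (nhds (h (T q))) := by
      have : Continuous fun p => h (T q) + γ⁻¹ * inner ℝ (p + gw (T p)) (T q - T p) :=
        continuous_const.add (continuous_const.mul
          ((continuous_id.add hgT).inner (continuous_const.sub hTc)))
      simpa using this.tendsto q
    have hl : Filter.Tendsto (fun p => h (T q) - γ⁻¹ * inner ℝ (q + gw (T q)) (T p - T q))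
        (nhds q) (nhds (h (T q))) := by
      have : Continuous fun p => h (T q) - γ⁻¹ * inner ℝ (q + gw (T q)) (T p - T q) := by fun_prop
      simpa using this.tendsto q
    refine tendsto_of_tendsto_of_tendsto_of_le_of_le hl hu (fun p => ?_) fun p => ?_
    · have := (hTp q).2 (T p) (hTp p).1
      have h2 := mul_nonneg (inv_nonneg.2 hγ.le) this
      rw [mul_add, inv_mul_cancel_left₀ hγ.ne'] at h2
      simp only
      linarith
    · have := (hTp p).2 (T q) (hTp q).1
      have h2 := mul_nonneg (inv_nonneg.2 hγ.le) this
      rw [mul_add, inv_mul_cancel_left₀ hγ.ne'] at h2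
      simp only
      linarith
  · exact ((isProjSolution_genProj (hsolv g x hx)).isProxPoint hX hh hw hγ).eq hα hw (hTp _)

/-- At a common `x` the parameters differ by γ (g₁ - g₂), and this γ cancels the 1/γ in `projGrad`.
-/
lemma norm_projGrad_sub_le (hX : Convex ℝ X) (hh : ConvexOn ℝ X h) (hα : 0 < α)
    (hw : IsDistanceGenerating X α w gw) {γ : ℝ} (hγ : 0 < γ)
    (hsolv : ∀ g : Vec n, ∀ x ∈ X, ∃ u, IsProjSolution X h w gw γ g x u) {x : Vec n} (hx : x ∈ X)
    (g₁ g₂ : Vec n) :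
    ‖projGrad X h w gw x g₁ γ - projGrad X h w gw x g₂ γ‖ ≤ ‖g₁ - g₂‖ / α := by
  have h1 := (isProjSolution_genProj (hsolv g₁ x hx)).isProxPoint hX hh hw hγ
  have h2 := (isProjSolution_genProj (hsolv g₂ x hx)).isProxPoint hX hh hw hγ
  have h3 := h2.norm_sub_le hw h1
  rw [sub_sub_sub_cancel_right, ← smul_sub, norm_smul, Real.norm_eq_abs, abs_of_pos hγ,
    norm_sub_rev g₂] at h3
  rw [projGrad, projGrad, ← smul_sub, sub_sub_sub_cancel_left, norm_smul, Real.norm_eq_abs,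
    abs_of_pos (by positivity), le_div_iff₀ hα, one_div, mul_assoc, inv_mul_le_iff₀ hγ]
  linarith

lemma sub_genProj {γ : ℝ} (hγ : 0 < γ) (g x : Vec n) :
    x - genProj X h w gw γ g x = γ • projGrad X h w gw x g γ := by
  rw [projGrad, smul_smul, mul_one_div_cancel hγ.ne', one_smul]

/-- Decrease of a composite objective along one stochastic projected gradient step. -/
theorem proj_step_descent (hX : Convex ℝ X) (hh : ConvexOn ℝ X h)
    (hw : IsDistanceGenerating X α w gw) {L γ : ℝ} (hγ : 0 < γ)
    {g g' x u : Vec n} {φ φ₁ : ℝ} (hx : x ∈ X) (hu : IsProjSolution X h w gw γ g x u)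
    (hφ : φ₁ ≤ φ + inner ℝ g' (u - x) + L / 2 * ‖u - x‖ ^ 2) :
    (α * γ - L * γ ^ 2 / 2) * ‖(1 / γ) • (x - u)‖ ^ 2 ≤
      (φ + h x) - (φ₁ + h u) + γ * inner ℝ (g - g') ((1 / γ) • (x - u)) := by
  have h1 := (hu.isProxPoint hX hh hw hγ).2 x hx
  have h2 := hw.strong u hu.1 x hx
  set q := (1 / γ) • (x - u) with hq
  have e : x - u = γ • q := by rw [hq, smul_smul, mul_one_div_cancel hγ.ne', one_smul]
  have e' : u - x = -(γ • q) := by rw [← e, neg_sub]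
  rw [e', norm_neg, norm_smul, Real.norm_eq_abs, abs_of_pos hγ, mul_pow] at hφ h2
  rw [inner_neg_right, real_inner_smul_right] at hφ
  rw [inner_neg_left, real_inner_smul_left, real_inner_comm, inner_sub_left] at h2
  rw [e, real_inner_smul_right, inner_add_left, inner_sub_left, real_inner_smul_left] at h1
  rw [inner_sub_left]
  set a := inner ℝ g q
  set b := inner ℝ g' q
  set c := inner ℝ (gw u) q
  set d := inner ℝ (gw x) q
  -- The variational inequality at z = x combined with strong monotonicity; a factor γ from x - u =
  -- γ q is common to all terms and is cancelled.
  have h3 : 0 ≤ γ * (γ * a - α * γ * ‖q‖ ^ 2 + (h x - h u)) := by nlinarith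
  have h4 := nonneg_of_mul_nonneg_right h3 hγ
  linarith

/-- The three-point inequality for one stochastic projected gradient step. -/
theorem proj_step_three_point (hX : Convex ℝ X) (hh : ConvexOn ℝ X h)
    (hw : IsDistanceGenerating X α w gw) {L γ : ℝ} (hγ : 0 < γ)
    {g g' x u z : Vec n} {φ φ₁ φz : ℝ} (hx : x ∈ X) (hz : z ∈ X)
    (hu : IsProjSolution X h w gw γ g x u) (hαγ : 0 ≤ α - L * γ)
    (hφ : φ₁ ≤ φ + inner ℝ g' (u - x) + L / 2 * ‖u - x‖ ^ 2)
    (hφz : φ + inner ℝ g' (z - x) ≤ φz) :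
    (α * γ - L * γ ^ 2) * ((φ₁ + h u) - (φz + h z)) ≤
      (α - L * γ) * (proxV w gw z x - proxV w gw z u) +
      (α * γ - L * γ ^ 2) * inner ℝ (g - g') (z - x) + γ ^ 2 / 2 * ‖g - g'‖ ^ 2 := by
  have h1 := (hu.isProxPoint hX hh hw hγ).2 z hz
  have h2 := hw.le_proxV hX hu.1 hx
  have ezu : z - u = (z - x) - (u - x) := by abel
  -- The three-point identity: the values of `w` cancel and only linear terms remain.
  have hthree : inner ℝ (gw u - gw x) (z - u) =
      proxV w gw z x - proxV w gw z u - proxV w gw u x := by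
    simp only [proxV, inner_sub_left]
    rw [ezu]
    simp only [inner_sub_right]
    ring
  have e1 : γ • g - gw x + gw u = γ • g + (gw u - gw x) := by abel
  rw [e1, inner_add_left, hthree, real_inner_smul_left, ezu, inner_sub_right] at h1
  have h3 : -inner ℝ (g - g') (u - x) ≤ ‖g - g'‖ * ‖u - x‖ :=
    (neg_le_abs _).trans (abs_real_inner_le_norm _ _)
  set β := α - L * γ with hβ
  have hw' : α * γ - L * γ ^ 2 = β * γ := by rw [hβ]; ring
  rw [hw']
  rw [inner_sub_left] at h3 ⊢
  set a := inner ℝ g (z - x)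
  set b := inner ℝ g (u - x)
  set a' := inner ℝ g' (z - x)
  set b' := inner ℝ g' (u - x)
  set D := ‖u - x‖
  set δ := ‖g - g'‖
  -- The bound V(u, x) ≥ α/2 D² outweighs the smoothness term γ L/2 D²; the surplus β/2 D² is kept
  -- to absorb the noise.
  have h5 : γ * ((φ₁ + h u) - (φz + h z)) ≤ proxV w gw z x - proxV w gw z u + γ * (a - a')
      + γ * (δ * D) - β / 2 * D ^ 2 := by
    have k1 : γ * (φ₁ - φz) ≤ γ * (b' - a' + L / 2 * D ^ 2) :=
      mul_le_mul_of_nonneg_left (by linarith) hγ.le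
    have k2 : γ * (-(b - b')) ≤ γ * (δ * D) := mul_le_mul_of_nonneg_left h3 hγ.le
    rw [hβ]
    nlinarith
  have h6 := mul_le_mul_of_nonneg_left h5 hαγ
  -- Completing the square, β γ δ D - β² D² / 2 ≤ γ² δ² / 2. Multiplying by β beforehand is what
  -- makes the noise coefficient free of β.
  nlinarith [sq_nonneg (γ * δ - β * D)]

end Prox

/-! ### Freezing random parameters, and regularity of the mean of the oracle. -/

/-- A random point of `X` is constant up to `ε` on the pieces of a countable measurable
partition. -/
lemma exists_partition_norm_sub_le {n : ℕ} {Ω : Type*} {H : MeasurableSpace Ω} {X : Set (Vec n)}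
    (hX : X.Nonempty) {x : Ω → Vec n} (hx : Measurable[H] x) (hxX : ∀ ω, x ω ∈ X) {ε : ℝ}
    (hε : 0 < ε) :
    ∃ (a : ℕ → Vec n) (A : ℕ → Set Ω), (∀ j, a j ∈ X) ∧ (∀ j, MeasurableSet[H] (A j)) ∧
      Pairwise (Function.onFun Disjoint A) ∧ ⋃ j, A j = Set.univ ∧
      ∀ j, ∀ ω ∈ A j, ‖x ω - a j‖ ≤ ε := by
  have : Nonempty X := hX.to_subtype
  set a : ℕ → Vec n := fun j => (TopologicalSpace.denseSeq X j : Vec n)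
  set B : ℕ → Set Ω := fun j => x ⁻¹' Metric.ball (a j) ε
  have hB : ∀ j, MeasurableSet[H] (B j) := fun j => hx measurableSet_ball
  refine ⟨a, disjointed B, fun j => (TopologicalSpace.denseSeq X j).2,
    fun j => MeasurableSet.disjointed hB j, disjoint_disjointed B, ?_, fun j ω hω => ?_⟩
  · rw [iUnion_disjointed, Set.eq_univ_iff_forall]
    intro ω
    obtain ⟨j, hj⟩ := (TopologicalSpace.denseRange_denseSeq X).exists_dist_lt
      (⟨x ω, hxX ω⟩ : X) hε
    exact Set.mem_iUnion.2 ⟨j, hj⟩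
  · have : x ω ∈ Metric.ball (a j) ε := disjointed_subset B j hω
    rw [mem_ball_iff_norm] at this
    exact this.le

section Oracle

variable {n : ℕ} {Ω S : Type*} {H : MeasurableSpace Ω} {mΩ : MeasurableSpace Ω} [MeasurableSpace S]
  {P : Measure Ω} [IsProbabilityMeasure P]

/-- Freezing: a conditional expectation with constant value `φ a` at every parameter `a` may be
evaluated at a random parameter that is measurable with respect to the past. -/
theorem integral_frozen_mul (hH : H ≤ mΩ) {Φ : Vec n → Ω → ℝ} {φ : Vec n → ℝ} {K : ℝ}
    (hΦ : ∀ᵐ ω ∂P, ∀ a b, |Φ a ω - Φ b ω| ≤ K * ‖a - b‖) (hφ : ∀ a b, |φ a - φ b| ≤ K * ‖a - b‖)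
    (hK : 0 ≤ K) (hint : ∀ a, Integrable (Φ a) P) (hcond : ∀ a, P[Φ a | H] =ᵐ[P] fun _ => φ a)
    {x : Ω → Vec n} (hx : Measurable[H] x) {Z : Ω → ℝ} (hZ : StronglyMeasurable[H] Z)
    (hZi : Integrable Z P) (h1 : Integrable (fun ω => Φ (x ω) ω * Z ω) P)
    (h2 : Integrable (fun ω => φ (x ω) * Z ω) P) :
    ∫ ω, Φ (x ω) ω * Z ω ∂P = ∫ ω, φ (x ω) * Z ω ∂P := by
  -- Replacing x by a constant on a piece costs at most K ε |Z| in each of the two integrals; for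
  -- constant parameters they agree.
  have key : ∀ ε : ℝ, 0 < ε →
      |∫ ω, Φ (x ω) ω * Z ω ∂P - ∫ ω, φ (x ω) * Z ω ∂P| ≤ 2 * K * ε * ∫ ω, |Z ω| ∂P := by
    intro ε hε
    obtain ⟨a, A, -, hA, hdisj, hU, hd⟩ :=
      exists_partition_norm_sub_le Set.univ_nonempty hx (fun _ => Set.mem_univ _) hε
    have hA' : ∀ j, MeasurableSet (A j) := fun j => hH _ (hA j)
    have s1 : HasSum (fun j => ∫ ω in A j, Φ (x ω) ω * Z ω ∂P) (∫ ω, Φ (x ω) ω * Z ω ∂P) := by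
      have := hasSum_integral_iUnion hA' hdisj h1.integrableOn
      rwa [hU, setIntegral_univ] at this
    have s2 : HasSum (fun j => ∫ ω in A j, φ (x ω) * Z ω ∂P) (∫ ω, φ (x ω) * Z ω ∂P) := by
      have := hasSum_integral_iUnion hA' hdisj h2.integrableOn
      rwa [hU, setIntegral_univ] at this
    have s3 : HasSum (fun j => 2 * K * ε * ∫ ω in A j, |Z ω| ∂P)
        (2 * K * ε * ∫ ω, |Z ω| ∂P) := by
      have := hasSum_integral_iUnion hA' hdisj hZi.abs.integrableOn
      rw [hU, setIntegral_univ] at this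
      exact this.mul_left _
    have hj : ∀ j, |∫ ω in A j, Φ (x ω) ω * Z ω ∂P - ∫ ω in A j, φ (x ω) * Z ω ∂P| ≤
        2 * K * ε * ∫ ω in A j, |Z ω| ∂P := by
      intro j
      -- Integrability of both factors is not enough for the product. On `A j`, however, `Φ (a j)`
      -- is within K ε of Φ at the random point, whose product with `Z` is integrable by `h1`.
      have i3 : Integrable (fun ω => Φ (a j) ω * (A j).indicator Z ω) P := by
        have b1 : Integrable ((A j).indicator fun ω => Φ (x ω) ω * Z ω) P := h1.indicator (hA' j)
        have b2 : Integrable (fun ω => |(A j).indicator (fun ω => Φ (x ω) ω * Z ω) ω| +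
          K * ε * |Z ω|) P := b1.abs.add (hZi.abs.const_mul (K * ε))
        refine b2.mono' ((hint (a j)).aestronglyMeasurable.mul
          (hZi.indicator (hA' j)).aestronglyMeasurable) ?_
        filter_upwards [hΦ] with ω hω
        by_cases hωA : ω ∈ A j
        · rw [Set.indicator_of_mem hωA, Set.indicator_of_mem hωA, Real.norm_eq_abs, abs_mul,
            abs_mul, ← add_mul]
          refine mul_le_mul_of_nonneg_right ?_ (abs_nonneg _)
          have c1 := hω (a j) (x ω)
          rw [norm_sub_rev] at c1
          have c2 := mul_le_mul_of_nonneg_left (hd j ω hωA) hK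
          have c3 := abs_sub_abs_le_abs_sub (Φ (a j) ω) (Φ (x ω) ω)
          linarith
        · rw [Set.indicator_of_notMem hωA, Set.indicator_of_notMem hωA]
          simp
          positivity
      have e1 : ∫ ω in A j, Φ (a j) ω * Z ω ∂P = ∫ ω in A j, φ (a j) * Z ω ∂P := by
        have hm : P[fun ω => Φ (a j) ω * (A j).indicator Z ω | H] =ᵐ[P]
            fun ω => φ (a j) * (A j).indicator Z ω := by
          refine (condExp_mul_of_stronglyMeasurable_right (hZ.indicator (hA j)) i3
            (hint (a j))).trans ?_
          filter_upwards [hcond (a j)] with ω hω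
          simp [hω]
        have hm2 := integral_condExp (μ := P) hH (f := fun ω => Φ (a j) ω * (A j).indicator Z ω)
        rw [integral_congr_ae hm] at hm2
        rw [← integral_indicator (hA' j), ← integral_indicator (hA' j)]
        simp_rw [Set.indicator_mul_right]
        exact hm2.symm
      have i3' : IntegrableOn (fun ω => Φ (a j) ω * Z ω) (A j) P := by
        rw [← integrable_indicator_iff (hA' j)]
        refine i3.congr (Filter.Eventually.of_forall fun ω => ?_)
        simp only [Set.indicator_mul_right]
      have i4 : IntegrableOn (fun ω => φ (a j) * Z ω) (A j) P := (hZi.const_mul _).integrableOn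
      have e2 : ∫ ω in A j, Φ (x ω) ω * Z ω ∂P - ∫ ω in A j, φ (x ω) * Z ω ∂P =
          ∫ ω in A j, ((Φ (x ω) ω * Z ω - Φ (a j) ω * Z ω) - (φ (x ω) * Z ω - φ (a j) * Z ω)) ∂P := by
        have i5 : IntegrableOn (fun ω => Φ (x ω) ω * Z ω - Φ (a j) ω * Z ω) (A j) P :=
          h1.integrableOn.sub i3'
        have i6 : IntegrableOn (fun ω => φ (x ω) * Z ω - φ (a j) * Z ω) (A j) P :=
          h2.integrableOn.sub i4
        rw [integral_sub i5 i6,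
          integral_sub h1.integrableOn i3', integral_sub h2.integrableOn i4, e1]
        ring
      rw [e2, ← integral_const_mul, ← Real.norm_eq_abs]
      refine norm_integral_le_of_norm_le (hZi.abs.const_mul _).integrableOn ?_
      filter_upwards [ae_restrict_of_ae hΦ, ae_restrict_mem (hA' j)] with ω hω hωA
      have c1 := hω (x ω) (a j)
      have c2 := hφ (x ω) (a j)
      have c3 := mul_le_mul_of_nonneg_left (hd j ω hωA) hK
      rw [← sub_mul, ← sub_mul, ← sub_mul, Real.norm_eq_abs, abs_mul]
      refine mul_le_mul_of_nonneg_right ((abs_sub _ _).trans ?_) (abs_nonneg _)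
      linarith
    rw [abs_le]
    constructor
    · rw [← neg_le_neg_iff, neg_neg]
      refine hasSum_le (fun j => ?_) (s1.sub s2).neg s3
      exact (neg_le_abs _).trans (hj j)
    · exact hasSum_le (fun j => (le_abs_self _).trans (hj j)) (s1.sub s2) s3
  set I := ∫ ω, |Z ω| ∂P
  have hI : 0 ≤ I := integral_nonneg fun _ => abs_nonneg _
  rw [← sub_eq_zero, ← abs_nonpos_iff]
  refine le_of_forall_pos_le_add fun δ hδ => ?_
  have hpos : 0 < 2 * K * I + 1 := by positivity
  refine (key (δ / (2 * K * I + 1)) (by positivity)).trans ?_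
  rw [zero_add]
  calc 2 * K * (δ / (2 * K * I + 1)) * I = δ * (2 * K * I / (2 * K * I + 1)) := by ring
    _ ≤ δ * 1 := by
        gcongr
        rw [div_le_one hpos]
        linarith
    _ = δ := mul_one δ

omit [IsProbabilityMeasure P] in
/-- The stochastic gradient at a random point is measurable. -/
lemma aestronglyMeasurable_stochGrad {F : Vec n → S → ℝ} (hF : Measurable (Function.uncurry F))
    {ξ : Ω → S} (hξ : Measurable ξ) (hd : ∀ᵐ ω ∂P, Differentiable ℝ fun y => F y (ξ ω))
    {x : Ω → Vec n} (hx : Measurable x) :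
    AEStronglyMeasurable (fun ω => stochGrad F (x ω) (ξ ω)) P := by
  have hcoord : ∀ i : Fin n, AEStronglyMeasurable
      (fun ω => stochGrad F (x ω) (ξ ω) i) P := by
    intro i
    -- A partial derivative is the limit of difference quotients with steps 1/(k + 1), and these are
    -- measurable because `F` is jointly measurable.
    refine aestronglyMeasurable_of_tendsto_ae Filter.atTop
      (f := fun (k : ℕ) ω => ((1 : ℝ) / (k + 1))⁻¹ *
        (F (x ω + ((1 : ℝ) / (k + 1)) • EuclideanSpace.single i (1 : ℝ)) (ξ ω) - F (x ω) (ξ ω)))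
      (fun k => ?_) ?_
    · have m1 : Measurable fun ω =>
          F (x ω + ((1 : ℝ) / (k + 1)) • EuclideanSpace.single i (1 : ℝ)) (ξ ω) :=
        hF.comp ((hx.add_const _).prodMk hξ)
      have m2 : Measurable fun ω => F (x ω) (ξ ω) := hF.comp (hx.prodMk hξ)
      exact ((m1.sub m2).const_mul _).aestronglyMeasurable
    · filter_upwards [hd] with ω hω
      have h1 := hasDerivAt_comp_segment hω (x ω) (EuclideanSpace.single i 1) 0
      rw [hasDerivAt_iff_tendsto_slope_zero] at h1
      have h2 : Filter.Tendsto (fun k : ℕ => (1 : ℝ) / (k + 1)) Filter.atTop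
          (nhdsWithin 0 {0}ᶜ) := by
        refine tendsto_nhdsWithin_iff.2 ⟨tendsto_one_div_add_atTop_nhds_zero_nat, ?_⟩
        refine Filter.Eventually.of_forall fun k => ?_
        simp only [Set.mem_compl_iff, Set.mem_singleton_iff]
        positivity
      have h3 := h1.comp h2
      have e : inner ℝ (∇ (fun y => F y (ξ ω)) (x ω + (0 : ℝ) • EuclideanSpace.single i (1 : ℝ)))
          (EuclideanSpace.single i 1) = stochGrad F (x ω) (ξ ω) i := by
        rw [zero_smul, add_zero, EuclideanSpace.inner_single_right]
        simp [stochGrad]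
      rw [e] at h3
      refine h3.congr fun k => ?_
      simp
  have hm : AEMeasurable (fun ω => WithLp.ofLp (stochGrad F (x ω) (ξ ω))) P :=
    aemeasurable_pi_lambda _ fun i => (hcoord i).aemeasurable
  exact ((WithLp.measurable_toLp 2 (Fin n → ℝ)).comp_aemeasurable hm).aestronglyMeasurable

lemma integrable_stochGrad {L : ℝ} {F : Vec n → S → ℝ}
    (hF : Measurable (Function.uncurry F)) {ξ : Ω → S} (hξ : Measurable ξ)
    (hC : ∀ᵐ ω ∂P, IsC11 L fun y => F y (ξ ω)) {x₁ : Vec n}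
    (hg : Integrable (fun ω => stochGrad F x₁ (ξ ω)) P) (x : Vec n) :
    Integrable (fun ω => stochGrad F x (ξ ω)) P := by
  refine (hg.norm.add (integrable_const (L * ‖x - x₁‖))).mono'
    (aestronglyMeasurable_stochGrad hF hξ (hC.mono fun ω hω => hω.1) measurable_const) ?_
  filter_upwards [hC] with ω hω
  have := hω.norm_gradient_add_le x₁ (x - x₁)
  rwa [add_sub_cancel] at this

/-- Recognizes a candidate gradient without differentiating under an integral: a quadratic remainder
is o(‖y - x‖). -/
lemma isC11_of_quadratic_bound {L : ℝ} {f : Vec n → ℝ} {g : Vec n → Vec n}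
    (hq : ∀ x y, |f y - f x - inner ℝ (g x) (y - x)| ≤ L / 2 * ‖y - x‖ ^ 2)
    (hg : ∀ x y, ‖g y - g x‖ ≤ L * ‖y - x‖) : IsC11 L f ∧ ∀ x, ∇ f x = g x := by
  have h1 : ∀ x, HasGradientAt f (g x) x := by
    intro x
    rw [hasGradientAt_iff_hasFDerivAt, hasFDerivAt_iff_isLittleO_nhds_zero]
    refine Asymptotics.IsBigO.trans_isLittleO (g := fun v : Vec n => ‖v‖ ^ 2) ?_
      (Asymptotics.isLittleO_norm_pow_id one_lt_two)
    refine Asymptotics.IsBigO.of_bound (L / 2) (Filter.Eventually.of_forall fun v => ?_)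
    have := hq x (x + v)
    rw [add_sub_cancel_left] at this
    simpa using this
  have h2 : ∀ x, ∇ f x = g x := fun x => (h1 x).gradient
  refine ⟨⟨fun x => (h1 x).differentiableAt, fun x y => ?_⟩, h2⟩
  rw [h2, h2]
  exact hg x y

/-- The mean of an unbiased oracle with `L`-Lipschitz gradients has an `L`-Lipschitz gradient. -/
theorem isC11_of_oracle {L : ℝ} {f : Vec n → ℝ} {F : Vec n → S → ℝ}
    (hF : Measurable (Function.uncurry F)) {ξ : Ω → S} (hξ : Measurable ξ)
    (hC : ∀ᵐ ω ∂P, IsC11 L fun y => F y (ξ ω)) (hint : ∀ x, Integrable (fun ω => F x (ξ ω)) P)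
    (hf : ∀ x, ∫ ω, F x (ξ ω) ∂P = f x) {x₁ : Vec n}
    (hg : Integrable (fun ω => stochGrad F x₁ (ξ ω)) P) : IsC11 L f := by
  have hgx := integrable_stochGrad hF hξ hC hg
  -- The candidate is the mean stochastic gradient; the Taylor and Lipschitz bounds of the oracle
  -- pass to expectations with the same `L`.
  refine (isC11_of_quadratic_bound (g := fun x => ∫ ω, stochGrad F x (ξ ω) ∂P)
    (fun x y => ?_) fun x y => ?_).1
  · have i1 : Integrable (fun ω => inner ℝ (stochGrad F x (ξ ω)) (y - x)) P :=
      (hgx x).inner_const _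
    have e1 : inner ℝ (∫ ω, stochGrad F x (ξ ω) ∂P) (y - x) =
        ∫ ω, inner ℝ (stochGrad F x (ξ ω)) (y - x) ∂P := by
      rw [real_inner_comm, ← integral_inner (hgx x)]
      simp_rw [real_inner_comm]
    have i2 : Integrable (fun ω => F y (ξ ω) - F x (ξ ω)) P := (hint y).sub (hint x)
    rw [e1, ← hf, ← hf, ← integral_sub (hint y) (hint x), ← integral_sub i2 i1,
      ← Real.norm_eq_abs]
    refine (norm_integral_le_of_norm_le (integrable_const (L / 2 * ‖y - x‖ ^ 2)) ?_).trans_eq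
      (by simp)
    filter_upwards [hC] with ω hω
    exact hω.abs_sub_le x y
  · rw [← integral_sub (hgx y) (hgx x)]
    refine (norm_integral_le_of_norm_le (integrable_const (L * ‖y - x‖)) ?_).trans_eq (by simp)
    filter_upwards [hC] with ω hω
    exact hω.2 x y

end Oracle

/-! ### Moments of a single oracle call at a random point. -/

section Sample

variable {n : ℕ} {Ω S : Type*} {H : MeasurableSpace Ω} {mΩ : MeasurableSpace Ω}
  [MeasurableSpace S] {P : Measure Ω} [IsProbabilityMeasure P]

omit [MeasurableSpace S] in
/-- At a fixed point the second moment of the stochastic gradient is at most `M² + σ²` on every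
event of the past. -/
lemma AssumptionA1.setLIntegral_sq_le (hH : H ≤ mΩ) {X : Set (Vec n)} {f : Vec n → ℝ}
    {F : Vec n → S → ℝ} {σ M : ℝ} {ξ : Ω → S} (hA : AssumptionA1 P H X f F σ ξ) {a : Vec n}
    (ha : a ∈ X) (hM : ‖∇ f a‖ ≤ M) {A : Set Ω} (hAm : MeasurableSet[H] A) :
    ∫⁻ ω in A, ENNReal.ofReal (‖stochGrad F a (ξ ω)‖ ^ 2) ∂P ≤
      ENNReal.ofReal (M ^ 2 + σ ^ 2) * P A := by
  have i0 := hA.integrable a ha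
  have i1 := hA.integrable_sq a ha
  have i2 : Integrable (fun ω => 2 * inner ℝ (∇ f a) (stochGrad F a (ξ ω))) P :=
    (i0.const_inner _).const_mul 2
  -- Integrated over a past event, the first term gives at most σ² and the cross term 2‖∇f(a)‖², of
  -- which the last term removes one copy (all times the probability of the event).
  have e : ∀ ω, ‖stochGrad F a (ξ ω)‖ ^ 2 = ‖stochGrad F a (ξ ω) - ∇ f a‖ ^ 2 +
      2 * inner ℝ (∇ f a) (stochGrad F a (ξ ω)) - ‖∇ f a‖ ^ 2 := by
    intro ω
    rw [norm_sub_sq_real, real_inner_comm]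
    ring
  have i12 : Integrable (fun ω => ‖stochGrad F a (ξ ω) - ∇ f a‖ ^ 2 +
      2 * inner ℝ (∇ f a) (stochGrad F a (ξ ω))) P := i1.add i2
  have i3 : Integrable (fun ω => ‖stochGrad F a (ξ ω)‖ ^ 2) P := by
    simp_rw [e]
    exact i12.sub (integrable_const _)
  have s1 : ∫ ω in A, ‖stochGrad F a (ξ ω) - ∇ f a‖ ^ 2 ∂P ≤ σ ^ 2 * P.real A := by
    rw [← setIntegral_condExp hH i1 hAm]
    calc _ ≤ ∫ ω in A, σ ^ 2 ∂P :=
          integral_mono_ae integrable_condExp.integrableOn (integrable_const _)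
            (ae_restrict_of_ae (hA.variance a ha))
      _ = _ := by simp [mul_comm]
  have s2 : ∫ ω in A, stochGrad F a (ξ ω) ∂P = P.real A • ∇ f a := by
    rw [← setIntegral_condExp hH i0 hAm,
      integral_congr_ae (ae_restrict_of_ae (hA.unbiased a ha))]
    simp
  have s3 : ∫ ω in A, ‖stochGrad F a (ξ ω)‖ ^ 2 ∂P ≤ (M ^ 2 + σ ^ 2) * P.real A := by
    simp_rw [e]
    rw [integral_sub i12.integrableOn (integrable_const _), integral_add i1.integrableOn
      i2.integrableOn, integral_const_mul, integral_inner i0.integrableOn, s2,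
      real_inner_smul_right, real_inner_self_eq_norm_sq]
    simp only [integral_const, smul_eq_mul, measureReal_restrict_apply_univ]
    have h1 : ‖∇ f a‖ ^ 2 ≤ M ^ 2 := by gcongr
    have h2 := mul_le_mul_of_nonneg_right h1 (measureReal_nonneg (μ := P) (s := A))
    linarith
  rw [← ofReal_integral_eq_lintegral_ofReal i3.integrableOn
    (Filter.Eventually.of_forall fun ω => by positivity)]
  refine (ENNReal.ofReal_le_ofReal s3).trans_eq ?_
  rw [ENNReal.ofReal_mul (by positivity), measureReal_def,
    ENNReal.ofReal_toReal (measure_ne_top P A)]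

omit [MeasurableSpace S] in
/-- The second moment of the stochastic gradient at a random point measurable with respect to the
past. -/
theorem AssumptionA1.lintegral_sq_le (hH : H ≤ mΩ) {X : Set (Vec n)} (hX : X.Nonempty) {L : ℝ}
    (hL : 0 ≤ L) {f : Vec n → ℝ} {F : Vec n → S → ℝ}
    {σ M : ℝ} {ξ : Ω → S}
    (hC : ∀ᵐ ω ∂P, IsC11 L fun y => F y (ξ ω)) (hA : AssumptionA1 P H X f F σ ξ)
    (hM : ∀ a ∈ X, ‖∇ f a‖ ≤ M) {x : Ω → Vec n} (hx : Measurable[H] x) (hxX : ∀ ω, x ω ∈ X) :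
    ∫⁻ ω, ENNReal.ofReal (‖stochGrad F (x ω) (ξ ω)‖ ^ 2) ∂P ≤ ENNReal.ofReal (M ^ 2 + σ ^ 2) := by
  -- The squared norm is not globally Lipschitz in the point, so freezing is done with a relative
  -- error 1 + ε, and with integrals in [0, ∞] since finiteness is not yet known.
  have key : ∀ ε : ℝ, 0 < ε → ∫⁻ ω, ENNReal.ofReal (‖stochGrad F (x ω) (ξ ω)‖ ^ 2) ∂P ≤
      ENNReal.ofReal ((1 + ε) * (M ^ 2 + σ ^ 2) + (1 + ε) * ε * L ^ 2) := by
    intro ε hε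
    -- The centres are taken in `X`, where A1 and the gradient bound are available.
    obtain ⟨a, A, haX, hA', hdisj, hU, hd⟩ := exists_partition_norm_sub_le hX hx hxX hε
    have hAm : ∀ j, MeasurableSet (A j) := fun j => hH _ (hA' j)
    have hj : ∀ j, ∫⁻ ω in A j, ENNReal.ofReal (‖stochGrad F (x ω) (ξ ω)‖ ^ 2) ∂P ≤
        ENNReal.ofReal ((1 + ε) * (M ^ 2 + σ ^ 2) + (1 + ε) * ε * L ^ 2) * P (A j) := by
      intro j
      calc ∫⁻ ω in A j, ENNReal.ofReal (‖stochGrad F (x ω) (ξ ω)‖ ^ 2) ∂P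
          ≤ ∫⁻ ω in A j, (ENNReal.ofReal (1 + ε) *
              ENNReal.ofReal (‖stochGrad F (a j) (ξ ω)‖ ^ 2) +
              ENNReal.ofReal ((1 + ε) * ε * L ^ 2)) ∂P := by
            refine lintegral_mono_ae ?_
            filter_upwards [ae_restrict_of_ae hC, ae_restrict_mem (hAm j)] with ω hω hωA
            rw [← ENNReal.ofReal_mul (by positivity), ← ENNReal.ofReal_add (by positivity)
              (by positivity)]
            refine ENNReal.ofReal_le_ofReal ?_
            have c1 := hω.norm_gradient_add_le (a j) (x ω - a j)
            rw [add_sub_cancel] at c1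
            have c2 := mul_le_mul_of_nonneg_left (hd j ω hωA) hL
            have c3 : ‖stochGrad F (x ω) (ξ ω)‖ ≤ ‖stochGrad F (a j) (ξ ω)‖ + L * ε :=
              c1.trans (by simp only [stochGrad]; linarith)
            set r := ‖stochGrad F (a j) (ξ ω)‖
            have c4 : ‖stochGrad F (x ω) (ξ ω)‖ ^ 2 ≤ (r + L * ε) ^ 2 := by gcongr
            -- The right side exceeds (r + L ε)² by exactly ε (r - L)².
            nlinarith [mul_nonneg hε.le (sq_nonneg (r - L))]
        _ = ENNReal.ofReal (1 + ε) *
              ∫⁻ ω in A j, ENNReal.ofReal (‖stochGrad F (a j) (ξ ω)‖ ^ 2) ∂P +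
              ENNReal.ofReal ((1 + ε) * ε * L ^ 2) * P (A j) := by
            rw [lintegral_add_right _ measurable_const,
              lintegral_const_mul' _ _ ENNReal.ofReal_ne_top, setLIntegral_const]
        _ ≤ ENNReal.ofReal (1 + ε) * (ENNReal.ofReal (M ^ 2 + σ ^ 2) * P (A j)) +
              ENNReal.ofReal ((1 + ε) * ε * L ^ 2) * P (A j) := by
            gcongr
            exact hA.setLIntegral_sq_le hH (haX j) (hM _ (haX j)) (hA' j)
        _ = _ := by
            rw [← mul_assoc, ← ENNReal.ofReal_mul (by positivity), ← add_mul,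
              ← ENNReal.ofReal_add (by positivity) (by positivity)]
    calc ∫⁻ ω, ENNReal.ofReal (‖stochGrad F (x ω) (ξ ω)‖ ^ 2) ∂P
        = ∑' j, ∫⁻ ω in A j, ENNReal.ofReal (‖stochGrad F (x ω) (ξ ω)‖ ^ 2) ∂P := by
          rw [← lintegral_iUnion hAm hdisj, hU, setLIntegral_univ]
      _ ≤ ∑' j, ENNReal.ofReal ((1 + ε) * (M ^ 2 + σ ^ 2) + (1 + ε) * ε * L ^ 2) * P (A j) :=
          ENNReal.tsum_le_tsum hj
      _ = _ := by
          rw [ENNReal.tsum_mul_left, ← measure_iUnion hdisj hAm, hU, measure_univ, mul_one]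
  have hlim : Filter.Tendsto (fun ε : ℝ =>
      ENNReal.ofReal ((1 + ε) * (M ^ 2 + σ ^ 2) + (1 + ε) * ε * L ^ 2))
      (nhdsWithin 0 (Set.Ioi 0)) (nhds (ENNReal.ofReal (M ^ 2 + σ ^ 2))) := by
    have : Continuous fun ε : ℝ =>
        ENNReal.ofReal ((1 + ε) * (M ^ 2 + σ ^ 2) + (1 + ε) * ε * L ^ 2) :=
      ENNReal.continuous_ofReal.comp (by fun_prop)
    have h2 := this.tendsto 0
    simp only [add_zero, one_mul, mul_zero, zero_mul] at h2
    exact h2.mono_left nhdsWithin_le_nhds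
  refine ge_of_tendsto hlim ?_
  filter_upwards [self_mem_nhdsWithin] with ε hε
  exact key ε hε

/-- The joint law of independent variables, with one of them kept on the original space. -/
lemma map_prodMk_eq_map_prod {T E : Type*} [MeasurableSpace T] [MeasurableSpace E] {U : Ω → T}
    {V : Ω → E} {ν : Measure E} [SFinite ν] (hU : Measurable U) (hV : Measurable V)
    (hν : P.map V = ν) (hind : IndepFun U V P) :
    P.map (fun ω => (U ω, V ω)) = (P.prod ν).map (Prod.map U id) := by
  rw [(indepFun_iff_map_prod_eq_prod_map_map hU.aemeasurable hV.aemeasurable).1 hind, hν,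
    ← Measure.map_prod_map P ν hU measurable_id, Measure.map_id]

lemma lintegral_indep {T E : Type*} [MeasurableSpace T] [MeasurableSpace E] {U : Ω → T}
    {V : Ω → E} {ν : Measure E} [SFinite ν] (hU : Measurable U) (hV : Measurable V)
    (hν : P.map V = ν) (hind : IndepFun U V P) {g : T × E → ENNReal} (hg : Measurable g) :
    ∫⁻ ω, g (U ω, V ω) ∂P = ∫⁻ ω, ∫⁻ v, g (U ω, v) ∂ν ∂P := by
  rw [← lintegral_map hg (hU.prodMk hV), map_prodMk_eq_map_prod hU hV hν hind,
    lintegral_map hg (hU.prodMap measurable_id),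
    lintegral_prod (fun p => g (Prod.map U id p)) (hg.comp (hU.prodMap measurable_id)).aemeasurable]
  rfl

lemma integrable_indep_iff {T E : Type*} [MeasurableSpace T] [MeasurableSpace E] {U : Ω → T}
    {V : Ω → E} {ν : Measure E} [SFinite ν] (hU : Measurable U) (hV : Measurable V)
    (hν : P.map V = ν) (hind : IndepFun U V P) {g : T × E → ℝ} (hg : Measurable g) :
    Integrable (fun ω => g (U ω, V ω)) P ↔
      Integrable (fun p : Ω × E => g (U p.1, p.2)) (P.prod ν) := by
  have h1 := integrable_map_measure (μ := P) (f := fun ω => (U ω, V ω)) (g := g)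
    hg.aestronglyMeasurable (hU.prodMk hV).aemeasurable
  have h2 := integrable_map_measure (μ := P.prod ν) (f := Prod.map U (id : E → E)) (g := g)
    hg.aestronglyMeasurable (hU.prodMap measurable_id).aemeasurable
  rw [map_prodMk_eq_map_prod hU hV hν hind] at h1
  exact h1.symm.trans h2

lemma integral_indep {T E : Type*} [MeasurableSpace T] [MeasurableSpace E] {U : Ω → T}
    {V : Ω → E} {ν : Measure E} [SFinite ν] (hU : Measurable U) (hV : Measurable V)
    (hν : P.map V = ν) (hind : IndepFun U V P) {g : T × E → ℝ} (hg : Measurable g) :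
    ∫ ω, g (U ω, V ω) ∂P = ∫ p : Ω × E, g (U p.1, p.2) ∂(P.prod ν) := by
  rw [← integral_map (hU.prodMk hV).aemeasurable hg.aestronglyMeasurable,
    map_prodMk_eq_map_prod hU hV hν hind,
    integral_map (hU.prodMap measurable_id).aemeasurable hg.aestronglyMeasurable]
  rfl

variable (H P) in
/-- The data of one call of the oracle at a random point `x` determined by the past `H`. -/
structure IsSample (X : Set (Vec n)) (L σ M : ℝ)
    (f : Vec n → ℝ) (F : Vec n → S → ℝ) (ξ : Ω → S) (v x : Ω → Vec n) : Prop where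
  le : H ≤ mΩ
  measurable_F : Measurable (Function.uncurry F)
  measurable_ξ : Measurable ξ
  measurable_v : Measurable v
  c11 : ∀ᵐ ω ∂P, IsC11 L fun y => F y (ξ ω)
  a1 : AssumptionA1 P H X f F σ ξ
  a3 : AssumptionA3 P H f F ξ
  law : P.map v = stdGaussian (Vec n)
  indep : Indep (MeasurableSpace.comap v inferInstance)
    (H ⊔ MeasurableSpace.comap ξ inferInstance) P
  measurable_x : Measurable[H] x
  mem : ∀ ω, x ω ∈ X
  bound : ∀ a ∈ X, ‖∇ f a‖ ≤ M

namespace IsSample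

variable {X : Set (Vec n)} {L σ M : ℝ} {f : Vec n → ℝ} {F : Vec n → S → ℝ} {ξ : Ω → S}
  {v x : Ω → Vec n}

lemma nonempty (hs : IsSample H P X L σ M f F ξ v x) : X.Nonempty :=
  have : Nonempty Ω := nonempty_of_isProbabilityMeasure P
  ⟨x (Classical.arbitrary Ω), hs.mem _⟩

lemma isC11 (hs : IsSample H P X L σ M f F ξ v x) : IsC11 L f := by
  obtain ⟨x₁, hx₁⟩ := hs.nonempty
  refine isC11_of_oracle hs.measurable_F hs.measurable_ξ hs.c11 hs.a3.integrable (fun y => ?_)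
    (hs.a1.integrable x₁ hx₁)
  rw [← integral_condExp hs.le, integral_congr_ae (hs.a3.unbiased y)]
  simp

omit [IsProbabilityMeasure P] in
lemma indepFun {T : Type*} [MeasurableSpace T] (hs : IsSample H P X L σ M f F ξ v x) {U : Ω → T}
    (hU : Measurable[H] U) : IndepFun (fun ω => (U ω, ξ ω)) v P := by
  refine indep_of_indep_of_le_left hs.indep.symm (Measurable.comap_le ?_)
  refine Measurable.prodMk (hU.mono le_sup_left le_rfl) ?_
  exact (comap_measurable ξ).mono le_sup_right le_rfl

omit [IsProbabilityMeasure P] in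
lemma measurable_increment (hs : IsSample H P X L σ M f F ξ v x) (μ : ℝ) :
    Measurable fun p : (Vec n × S) × Vec n =>
      (F (p.1.1 + μ • p.2) p.1.2 - F p.1.1 p.1.2) / μ := by
  have h1 : Measurable fun p : (Vec n × S) × Vec n => F (p.1.1 + μ • p.2) p.1.2 :=
    hs.measurable_F.comp (by fun_prop : Measurable fun p : (Vec n × S) × Vec n =>
      (p.1.1 + μ • p.2, p.1.2))
  have h2 : Measurable fun p : (Vec n × S) × Vec n => F p.1.1 p.1.2 :=
    hs.measurable_F.comp measurable_fst
  exact (h1.sub h2).div_const μ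

omit [IsProbabilityMeasure P] in
lemma measurable_gradFree (hs : IsSample H P X L σ M f F ξ v x) (μ : ℝ) :
    Measurable fun ω => gradFree F μ (x ω) (ξ ω) (v ω) :=
  ((hs.measurable_increment μ).comp
    (((hs.measurable_x.mono hs.le le_rfl).prodMk hs.measurable_ξ).prodMk hs.measurable_v)).smul
    hs.measurable_v

/-- For fixed ξ this is the Gaussian estimator of F(·, ξ), so the independent direction is
integrated out before ξ; what remains is the second moment of the stochastic gradient, at most M² +
σ². The dimension factors are then rounded up to powers of n + 4. -/
lemma lintegral_sq_gradFree_le (hs : IsSample H P X L σ M f F ξ v x) (hL : 0 ≤ L) {μ : ℝ}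
    (hμ : 0 < μ) :
    ∫⁻ ω, ENNReal.ofReal (‖gradFree F μ (x ω) (ξ ω) (v ω)‖ ^ 2) ∂P ≤
      ENNReal.ofReal (sigmaTildeSq n M σ μ L) := by
  have hm : Measurable fun p : (Vec n × S) × Vec n => ENNReal.ofReal
      (‖((F (p.1.1 + μ • p.2) p.1.2 - F p.1.1 p.1.2) / μ) • p.2‖ ^ 2) :=
    (((hs.measurable_increment μ).smul measurable_snd).norm.pow_const 2).ennreal_ofReal
  have h1 := lintegral_indep ((hs.measurable_x.mono hs.le le_rfl).prodMk hs.measurable_ξ)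
    hs.measurable_v hs.law (hs.indepFun hs.measurable_x) hm
  simp only at h1
  simp only [gradFree]
  rw [h1]
  set c : ℝ := μ ^ 2 * L ^ 2 / 2 * (n * (n + 2) * (n + 4))
  have hc : 0 ≤ c := by positivity
  calc _ ≤ ∫⁻ ω, (ENNReal.ofReal c + ENNReal.ofReal (2 * (n + 2)) *
        ENNReal.ofReal (‖stochGrad F (x ω) (ξ ω)‖ ^ 2)) ∂P := by
        refine lintegral_mono_ae ?_
        filter_upwards [hs.c11] with ω hω
        obtain ⟨i, hi⟩ := hω.integral_sq_gradFree_le hμ (x ω)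
        rw [← ofReal_integral_eq_lintegral_ofReal i
          (Filter.Eventually.of_forall fun v => by positivity),
          ← ENNReal.ofReal_mul (by positivity), ← ENNReal.ofReal_add hc (by positivity)]
        exact ENNReal.ofReal_le_ofReal hi
    _ = ENNReal.ofReal c + ENNReal.ofReal (2 * (n + 2)) *
        ∫⁻ ω, ENNReal.ofReal (‖stochGrad F (x ω) (ξ ω)‖ ^ 2) ∂P := by
        rw [lintegral_add_left measurable_const, lintegral_const_mul' _ _ ENNReal.ofReal_ne_top,
          lintegral_const, measure_univ, mul_one]
    _ ≤ ENNReal.ofReal c + ENNReal.ofReal (2 * (n + 2)) * ENNReal.ofReal (M ^ 2 + σ ^ 2) := by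
        gcongr
        exact hs.a1.lintegral_sq_le hs.le hs.nonempty hL hs.c11 hs.bound hs.measurable_x hs.mem
    _ = ENNReal.ofReal (c + 2 * (n + 2) * (M ^ 2 + σ ^ 2)) := by
        rw [← ENNReal.ofReal_mul (by positivity), ← ENNReal.ofReal_add hc (by positivity)]
    _ ≤ _ := by
        refine ENNReal.ofReal_le_ofReal ?_
        rw [sigmaTildeSq]
        have hn : (0 : ℝ) ≤ n := n.cast_nonneg
        have h3 : (n : ℝ) * (n + 2) * (n + 4) ≤ (n + 4) * (n + 4) * (n + 4) := by
          gcongr <;> linarith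
        have h4 : c ≤ μ ^ 2 * L ^ 2 / 2 * ((n + 4) * (n + 4) * (n + 4)) :=
          mul_le_mul_of_nonneg_left h3 (by positivity)
        have h5 : 0 ≤ μ ^ 2 * L ^ 2 * (((n : ℝ) + 4) * (n + 4) * (n + 4)) := by positivity
        have h6 : 0 ≤ M ^ 2 + σ ^ 2 := by positivity
        nlinarith

theorem memLp_gradFree (hs : IsSample H P X L σ M f F ξ v x) (hL : 0 ≤ L) {μ : ℝ}
    (hμ : 0 < μ) : MemLp (fun ω => gradFree F μ (x ω) (ξ ω) (v ω)) 2 P := by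
  rw [memLp_two_iff_integrable_sq_norm (hs.measurable_gradFree μ).aestronglyMeasurable]
  refine ⟨((hs.measurable_gradFree μ).norm.pow_const 2).aestronglyMeasurable, ?_⟩
  rw [hasFiniteIntegral_iff_ofReal (Filter.Eventually.of_forall fun ω => by positivity)]
  exact (hs.lintegral_sq_gradFree_le hL hμ).trans_lt ENNReal.ofReal_lt_top

theorem integral_sq_gradFree_le (hs : IsSample H P X L σ M f F ξ v x) (hL : 0 ≤ L) {μ : ℝ}
    (hμ : 0 < μ) :
    ∫ ω, ‖gradFree F μ (x ω) (ξ ω) (v ω)‖ ^ 2 ∂P ≤ sigmaTildeSq n M σ μ L := by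
  rw [integral_eq_lintegral_of_nonneg_ae (Filter.Eventually.of_forall fun ω => by positivity)
    ((hs.measurable_gradFree μ).norm.pow_const 2).aestronglyMeasurable]
  refine ENNReal.toReal_le_of_le_ofReal ?_ (hs.lintegral_sq_gradFree_le hL hμ)
  rw [sigmaTildeSq]
  positivity

end IsSample

end Sample

lemma integrable_inner_of_memLp {n : ℕ} {Ω : Type*} {mΩ : MeasurableSpace Ω} {P : Measure Ω}
    {U V : Ω → Vec n} (hU : MemLp U 2 P) (hV : MemLp V 2 P) :
    Integrable (fun ω => inner ℝ (U ω) (V ω)) P := by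
  refine (hU.norm.integrable_mul hV.norm).mono' (hU.1.inner hV.1)
    (Filter.Eventually.of_forall fun ω => ?_)
  exact norm_inner_le_norm _ _

namespace IsSample

variable {n : ℕ} {Ω S : Type*} {H : MeasurableSpace Ω} {mΩ : MeasurableSpace Ω}
  [MeasurableSpace S] {P : Measure Ω} [IsProbabilityMeasure P]
variable {X : Set (Vec n)} {L σ M : ℝ} {f : Vec n → ℝ} {F : Vec n → S → ℝ} {ξ : Ω → S}
  {v x : Ω → Vec n}

/-- The Gaussian finite-difference estimator is an unbiased estimator of the gradient of the
smoothing, given the past. -/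
theorem integral_inner_gradFree (hs : IsSample H P X L σ M f F ξ v x) (hL : 0 ≤ L) {μ : ℝ}
    (hμ : 0 < μ) {Y : Ω → Vec n} (hY : Measurable[H] Y) (hY2 : MemLp Y 2 P) :
    ∫ ω, inner ℝ (gradFree F μ (x ω) (ξ ω) (v ω)) (Y ω) ∂P =
      ∫ ω, inner ℝ (smoothGrad f μ (x ω)) (Y ω) ∂P := by
  have hf := hs.isC11
  have hYm : Measurable Y := hY.mono hs.le le_rfl
  have hxm : Measurable x := hs.measurable_x.mono hs.le le_rfl
  have hU : Measurable[H] fun ω => (x ω, Y ω) := hs.measurable_x.prodMk hY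
  have hm : Measurable fun p : ((Vec n × Vec n) × S) × Vec n =>
      (F (p.1.1.1 + μ • p.2) p.1.2 - F p.1.1.1 p.1.2) / μ * inner ℝ p.2 p.1.1.2 := by
    have h1 := (hs.measurable_increment μ).comp
      (by fun_prop : Measurable fun p : ((Vec n × Vec n) × S) × Vec n =>
        ((p.1.1.1, p.1.2), p.2))
    exact h1.mul (by fun_prop)
  have eg : ∀ ω, inner ℝ (gradFree F μ (x ω) (ξ ω) (v ω)) (Y ω) =
      (F (x ω + μ • v ω) (ξ ω) - F (x ω) (ξ ω)) / μ * inner ℝ (v ω) (Y ω) := fun ω => by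
    rw [gradFree, real_inner_smul_left]
  have hUm : Measurable fun ω => ((x ω, Y ω), ξ ω) := (hxm.prodMk hYm).prodMk hs.measurable_ξ
  have hind := hs.indepFun hU
  have i0 : Integrable (fun ω => (F (x ω + μ • v ω) (ξ ω) - F (x ω) (ξ ω)) / μ *
      inner ℝ (v ω) (Y ω)) P := by
    simp_rw [← eg]
    exact integrable_inner_of_memLp (hs.memLp_gradFree hL hμ) hY2
  have i1 := (integrable_indep_iff hUm hs.measurable_v hs.law hind hm).1 i0
  have e1 := integral_indep hUm hs.measurable_v hs.law hind hm
  simp only at i1 e1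
  simp_rw [eg]
  rw [e1, integral_prod_symm _ i1]
  have i2 : Integrable (fun p : Ω × Vec n => (f (x p.1 + μ • p.2) - f (x p.1)) / μ *
      inner ℝ p.2 (Y p.1)) (P.prod (stdGaussian (Vec n))) := by
    have hfm : Measurable f := hf.1.continuous.measurable
    have m1 : Measurable (fun p : Ω × Vec n => (f (x p.1 + μ • p.2) - f (x p.1)) / μ *
        inner ℝ p.2 (Y p.1)) := by fun_prop
    have b1 : Integrable (fun p : Ω × Vec n => ‖Y p.1‖ *
        ((M * μ + L / 2 * μ ^ 2) / μ * (1 + ‖p.2‖) ^ 3)) (P.prod (stdGaussian (Vec n))) := by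
      have b0 : Integrable (fun v : Vec n => (1 + ‖v‖) ^ 3) (stdGaussian (Vec n)) := by
        refine integrable_stdGaussian_of_growth
          (Continuous.aestronglyMeasurable (by fun_prop)) 1 3 fun v => ?_
        rw [Real.norm_eq_abs, abs_of_nonneg (by positivity), one_mul]
      exact Integrable.mul_prod (hY2.integrable one_le_two).norm (b0.const_mul _)
    refine b1.mono' m1.aestronglyMeasurable (Filter.Eventually.of_forall fun p => ?_)
    have h1 := hf.abs_shift_le hL hμ.le (x p.1) p.2
    have h2 := hs.bound _ (hs.mem p.1)
    rw [norm_mul, norm_div, Real.norm_eq_abs, Real.norm_eq_abs μ, abs_of_pos hμ]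
    have h3 : |f (x p.1 + μ • p.2) - f (x p.1)| ≤ (M * μ + L / 2 * μ ^ 2) * (1 + ‖p.2‖) ^ 2 :=
      h1.trans (by gcongr)
    have hnn : 0 ≤ (M * μ + L / 2 * μ ^ 2) * (1 + ‖p.2‖) ^ 2 := (abs_nonneg _).trans h3
    calc |f (x p.1 + μ • p.2) - f (x p.1)| / μ * ‖inner ℝ p.2 (Y p.1)‖
        ≤ ((M * μ + L / 2 * μ ^ 2) * (1 + ‖p.2‖) ^ 2) / μ * ((1 + ‖p.2‖) * ‖Y p.1‖) := by
          gcongr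
          refine (norm_inner_le_norm _ _).trans ?_
          gcongr
          linarith
      _ = _ := by ring
  -- With the direction held at `w`, the increment F(a + μ w, ξ) - F(a, ξ) is L‖μ w‖-Lipschitz in
  -- `a`, so A3 may be evaluated at the random iterate and `F` is replaced by f.
  have e2 : ∫ w, ∫ ω, (F (x ω + μ • w) (ξ ω) - F (x ω) (ξ ω)) / μ * inner ℝ w (Y ω) ∂P
        ∂(stdGaussian (Vec n)) =
      ∫ w, ∫ ω, (f (x ω + μ • w) - f (x ω)) / μ * inner ℝ w (Y ω) ∂P ∂(stdGaussian (Vec n)) := by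
    refine integral_congr_ae ?_
    filter_upwards [i1.prod_left_ae, i2.prod_left_ae] with w j1 j2
    have hK : 0 ≤ L * ‖μ • w‖ := by positivity
    have hZ : StronglyMeasurable[H] fun ω => μ⁻¹ * inner ℝ w (Y ω) :=
      Measurable.stronglyMeasurable (Measurable.const_mul
        ((by fun_prop : Measurable fun y : Vec n => inner ℝ w y).comp hY) _)
    have hZi : Integrable (fun ω => μ⁻¹ * inner ℝ w (Y ω)) P :=
      ((hY2.integrable one_le_two).const_inner w).const_mul _
    have a1 : ∀ a b c : ℝ, (a - b) / μ * c = (a - b) * (μ⁻¹ * c) := fun a b c => by ring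
    simp_rw [a1] at j1 j2 ⊢
    refine integral_frozen_mul hs.le (K := L * ‖μ • w‖)
      (Φ := fun a ω => F (a + μ • w) (ξ ω) - F a (ξ ω)) (φ := fun a => f (a + μ • w) - f a)
      ?_ (fun a b => hf.abs_increment_sub_le _ a b) hK (fun a => ?_) (fun a => ?_)
      hs.measurable_x hZ hZi j1 j2
    · filter_upwards [hs.c11] with ω hω a b
      exact hω.abs_increment_sub_le _ a b
    · exact (hs.a3.integrable _).sub (hs.a3.integrable _)
    · refine (condExp_sub (hs.a3.integrable (a + μ • w)) (hs.a3.integrable a) H).trans ?_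
      filter_upwards [hs.a3.unbiased (a + μ • w), hs.a3.unbiased a] with ω h1 h2
      rw [Pi.sub_apply, h1, h2]
  -- The order of integration is reversed again, so that the finite-difference formula for f applies
  -- at each ω.
  rw [e2, ← integral_prod_symm (fun p : Ω × Vec n => (f (x p.1 + μ • p.2) - f (x p.1)) / μ *
      inner ℝ p.2 (Y p.1)) i2, integral_prod _ i2]
  refine integral_congr_ae (Filter.Eventually.of_forall fun ω => ?_)
  exact hf.integral_gradFree hL hμ (x ω) (Y ω)

lemma measurable_smoothGrad (hs : IsSample H P X L σ M f F ξ v x) {μ : ℝ} (hμ : 0 ≤ μ) :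
    Measurable[H] fun ω => smoothGrad f μ (x ω) :=
  (hs.isC11.continuous_smoothGrad hμ).measurable.comp hs.measurable_x

lemma memLp_smoothGrad (hs : IsSample H P X L σ M f F ξ v x) {μ : ℝ}
    (hμ : 0 ≤ μ) : MemLp (fun ω => smoothGrad f μ (x ω)) 2 P := by
  refine MemLp.of_bound ((hs.measurable_smoothGrad hμ).mono hs.le le_rfl).aestronglyMeasurable
    (M + L * μ * ∫ v : Vec n, ‖v‖ ∂(stdGaussian (Vec n))) (Filter.Eventually.of_forall fun ω => ?_)
  refine (hs.isC11.norm_smoothGrad_le hμ (x ω)).trans ?_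
  gcongr
  exact hs.bound _ (hs.mem ω)

lemma memLp_error (hs : IsSample H P X L σ M f F ξ v x) (hL : 0 ≤ L) {μ : ℝ} (hμ : 0 < μ) :
    MemLp (fun ω => gradFree F μ (x ω) (ξ ω) (v ω) - smoothGrad f μ (x ω)) 2 P :=
  (hs.memLp_gradFree hL hμ).sub (hs.memLp_smoothGrad hμ.le)

theorem integral_inner_error (hs : IsSample H P X L σ M f F ξ v x) (hL : 0 ≤ L) {μ : ℝ}
    (hμ : 0 < μ) {Y : Ω → Vec n} (hY : Measurable[H] Y) (hY2 : MemLp Y 2 P) :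
    ∫ ω, inner ℝ (gradFree F μ (x ω) (ξ ω) (v ω) - smoothGrad f μ (x ω)) (Y ω) ∂P = 0 := by
  simp_rw [inner_sub_left]
  rw [integral_sub (integrable_inner_of_memLp (hs.memLp_gradFree hL hμ) hY2)
    (integrable_inner_of_memLp (hs.memLp_smoothGrad hμ.le) hY2),
    hs.integral_inner_gradFree hL hμ hY hY2, sub_self]

/-- Centring does not increase the second moment: testing unbiasedness against `smoothGrad` itself
reduces the expansion to E‖G‖² - E‖∇f_μ‖². -/
theorem integral_sq_error_le (hs : IsSample H P X L σ M f F ξ v x) (hL : 0 ≤ L) {μ : ℝ}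
    (hμ : 0 < μ) :
    ∫ ω, ‖gradFree F μ (x ω) (ξ ω) (v ω) - smoothGrad f μ (x ω)‖ ^ 2 ∂P ≤
      sigmaTildeSq n M σ μ L := by
  have hG := hs.memLp_gradFree hL hμ
  have hg := hs.memLp_smoothGrad hμ.le
  have i1 : Integrable (fun ω => ‖gradFree F μ (x ω) (ξ ω) (v ω)‖ ^ 2) P := hG.integrable_norm_pow
    two_ne_zero
  have i2 : Integrable (fun ω => ‖smoothGrad f μ (x ω)‖ ^ 2) P := hg.integrable_norm_pow two_ne_zero
  have i3 : Integrable (fun ω => 2 * inner ℝ (gradFree F μ (x ω) (ξ ω) (v ω))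
    (smoothGrad f μ (x ω))) P := (integrable_inner_of_memLp hG hg).const_mul 2
  have i13 : Integrable (fun ω => ‖gradFree F μ (x ω) (ξ ω) (v ω)‖ ^ 2 -
    2 * inner ℝ (gradFree F μ (x ω) (ξ ω) (v ω)) (smoothGrad f μ (x ω))) P := i1.sub i3
  simp_rw [norm_sub_sq_real]
  rw [integral_add i13 i2, integral_sub i1 i3, integral_const_mul,
    hs.integral_inner_gradFree hL hμ (hs.measurable_smoothGrad hμ.le) hg]
  simp_rw [real_inner_self_eq_norm_sq]
  have h1 : 0 ≤ ∫ ω, ‖smoothGrad f μ (x ω)‖ ^ 2 ∂P := integral_nonneg fun _ => by positivity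
  linarith [hs.integral_sq_gradFree_le hL hμ]

end IsSample

/-! ### Abstract stochastic proximal gradient processes. -/

lemma sum_Icc_sub_succ (a : ℕ → ℝ) (N : ℕ) :
    ∑ k ∈ Finset.Icc 1 N, (a k - a (k + 1)) = a 1 - a (N + 1) := by
  induction N with
  | zero => simp
  | succ N ih =>
    rw [Finset.sum_Icc_succ_top (by omega), ih]
    ring

/-- Summation by parts for nonincreasing nonnegative weights. -/
lemma sum_mul_sub_succ_le {β V : ℕ → ℝ} {N : ℕ} (hN : 1 ≤ N)
    (hβ : ∀ k ∈ Finset.Icc 1 N, 0 ≤ β k) (hanti : AntitoneOn β (Set.Icc 1 N))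
    (hV : ∀ k ∈ Finset.Icc 1 (N + 1), 0 ≤ V k) :
    ∑ k ∈ Finset.Icc 1 N, β k * (V k - V (k + 1)) ≤ β 1 * V 1 := by
  -- The induction must retain -β_j V_{j+1}: it pays for the positive part β_{j+1} V_{j+1} of the
  -- next term.
  have key : ∀ j, 1 ≤ j → j ≤ N →
      ∑ k ∈ Finset.Icc 1 j, β k * (V k - V (k + 1)) ≤ β 1 * V 1 - β j * V (j + 1) := by
    intro j hj
    induction j, hj using Nat.le_induction with
    | base => intro _; simp; linarith
    | succ j hj ih =>
      intro hjN
      rw [Finset.sum_Icc_succ_top (by omega)]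
      have h1 := ih (by omega)
      have h2 : β (j + 1) ≤ β j := hanti ⟨hj, by omega⟩ ⟨by omega, hjN⟩ (by omega)
      have h3 := mul_le_mul_of_nonneg_right h2
        (hV (j + 1) (Finset.mem_Icc.2 ⟨by omega, by omega⟩))
      linarith
  have h1 := key N hN le_rfl
  have h2 := mul_nonneg (hβ N (Finset.mem_Icc.2 ⟨hN, le_rfl⟩))
    (hV (N + 1) (Finset.mem_Icc.2 ⟨by omega, le_rfl⟩))
  linarith

/-- The data of the generalized projection problem. -/
structure IsProxProblem {n : ℕ} (X : Set (Vec n)) (h : Vec n → ℝ) (α : ℝ) (w : Vec n → ℝ)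
    (gw : Vec n → Vec n) : Prop where
  closed : IsClosed X
  convex : Convex ℝ X
  convexOn : ConvexOn ℝ X h
  pos : 0 < α
  distGen : IsDistanceGenerating X α w gw
  solv : ∀ γ : ℝ, 0 < γ → ∀ g : Vec n, ∀ x ∈ X, ∃ u, IsProjSolution X h w gw γ g x u

namespace IsProxProblem

variable {n : ℕ} {X : Set (Vec n)} {h : Vec n → ℝ} {α : ℝ} {w : Vec n → ℝ} {gw : Vec n → Vec n}

lemma isProjSolution (hp : IsProxProblem X h α w gw) {γ : ℝ} (hγ : 0 < γ) (g : Vec n) {x : Vec n}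
    (hx : x ∈ X) : IsProjSolution X h w gw γ g x (genProj X h w gw γ g x) :=
  isProjSolution_genProj (hp.solv γ hγ g x hx)

/-- The minimizer comes from a choice, so measurability is obtained through the continuous
resolvent. `gw` is continuous only on the closed set `X` and is extended by 0. -/
lemma measurable_step (hp : IsProxProblem X h α w gw) {Ω : Type*} {𝓖 : MeasurableSpace Ω} {γ : ℝ}
    (hγ : 0 < γ) {g x : Ω → Vec n} (hg : Measurable g) (hx : Measurable x)
    (hxX : ∀ ω, x ω ∈ X) (hX : X.Nonempty) :
    Measurable (fun ω => genProj X h w gw γ (g ω) (x ω)) ∧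
      Measurable fun ω => h (genProj X h w gw γ (g ω) (x ω)) := by
  obtain ⟨x₁, hx₁⟩ := hX
  obtain ⟨T, hT, -, hhT, hTe⟩ := exists_continuous_resolvent hp.convex hp.convexOn hp.pos
    hp.distGen hγ (hp.solv γ hγ) hx₁
  have hgw : Measurable fun ω => gw (x ω) := by
    classical
    have h1 : Measurable (X.piecewise gw fun _ => 0) :=
      hp.distGen.continuousOn.measurable_piecewise continuousOn_const hp.closed.measurableSet
    have e : (fun ω => gw (x ω)) = X.piecewise gw (fun _ => 0) ∘ x := by
      ext1 ω
      exact (Set.piecewise_eq_of_mem _ _ _ (hxX ω)).symm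
    rw [e]
    exact h1.comp hx
  have hq : Measurable fun ω => γ • g ω - gw (x ω) := (hg.const_smul γ).sub hgw
  have e : ∀ ω, genProj X h w gw γ (g ω) (x ω) = T (γ • g ω - gw (x ω)) := fun ω =>
    hTe _ _ (hxX ω)
  simp_rw [e]
  exact ⟨hT.measurable.comp hq, hhT.measurable.comp hq⟩

lemma measurable_projGrad (hp : IsProxProblem X h α w gw) {Ω : Type*} {𝓖 : MeasurableSpace Ω}
    {γ : ℝ} (hγ : 0 < γ) {g x : Ω → Vec n} (hg : Measurable g) (hx : Measurable x)
    (hxX : ∀ ω, x ω ∈ X) (hX : X.Nonempty) :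
    Measurable (fun ω => projGrad X h w gw (x ω) (g ω) γ) := by
  unfold projGrad
  exact (hx.sub (hp.measurable_step hγ hg hx hxX hX).1).const_smul (1 / γ)

end IsProxProblem

/-- A stochastic projected gradient process: the direction `G k` used at step `k` is an unbiased
estimator of `g (x k)` given the past `𝓕 k`, with mean square error at most `τ k`. -/
structure IsProxProcess {n : ℕ} {Ω : Type*} {mΩ : MeasurableSpace Ω} (P : Measure Ω)
    (𝓕 : ℕ → MeasurableSpace Ω) (X : Set (Vec n)) (h w : Vec n → ℝ) (gw : Vec n → Vec n) (N : ℕ)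
    (γ : ℕ → ℝ) (g : Vec n → Vec n) (τ : ℕ → ℝ) (x₁ : Vec n) (x G : ℕ → Ω → Vec n) : Prop where
  le : ∀ k, 𝓕 k ≤ mΩ
  mono : Monotone 𝓕
  init : ∀ ω, x 1 ω = x₁
  step : ∀ k ∈ Finset.Icc 1 N, ∀ ω, x (k + 1) ω = genProj X h w gw (γ k) (G k ω) (x k ω)
  mem : ∀ k ∈ Finset.Icc 1 (N + 1), ∀ ω, x k ω ∈ X
  measurable_x : ∀ k ∈ Finset.Icc 1 (N + 1), Measurable[𝓕 k] (x k)
  measurable_G : ∀ k ∈ Finset.Icc 1 N, Measurable[𝓕 (k + 1)] (G k)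
  measurable_g : ∀ k ∈ Finset.Icc 1 N, Measurable[𝓕 k] fun ω => g (x k ω)
  memLp_error : ∀ k ∈ Finset.Icc 1 N, MemLp (fun ω => G k ω - g (x k ω)) 2 P
  variance : ∀ k ∈ Finset.Icc 1 N, ∫ ω, ‖G k ω - g (x k ω)‖ ^ 2 ∂P ≤ τ k
  orthogonal : ∀ k ∈ Finset.Icc 1 N, ∀ Y : Ω → Vec n, Measurable[𝓕 k] Y → MemLp Y 2 P →
    ∫ ω, inner ℝ (G k ω - g (x k ω)) (Y ω) ∂P = 0

namespace IsProxProcess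

variable {n : ℕ} {Ω : Type*} {mΩ : MeasurableSpace Ω} {P : Measure Ω}
  {𝓕 : ℕ → MeasurableSpace Ω} {X : Set (Vec n)} {h w : Vec n → ℝ} {gw : Vec n → Vec n} {N : ℕ}
  {γ : ℕ → ℝ} {g : Vec n → Vec n} {τ : ℕ → ℝ} {x₁ : Vec n} {x G : ℕ → Ω → Vec n} {α L : ℝ}
  {φ : Vec n → ℝ} {c : ℝ}


lemma x_succ (hs : IsProxProcess P 𝓕 X h w gw N γ g τ x₁ x G) {k : ℕ} (hk : k ∈ Finset.Icc 1 N)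
    (hγ : 0 < γ k) (ω : Ω) :
    x (k + 1) ω = x k ω - γ k • projGrad X h w gw (x k ω) (G k ω) (γ k) := by
  rw [hs.step k hk, ← sub_genProj hγ, sub_sub_cancel]

lemma mem_left (hs : IsProxProcess P 𝓕 X h w gw N γ g τ x₁ x G) {k : ℕ}
    (hk : k ∈ Finset.Icc 1 N) (ω : Ω) : x k ω ∈ X :=
  hs.mem k (Finset.Icc_subset_Icc_right (by omega) hk) ω

lemma mem_right (hs : IsProxProcess P 𝓕 X h w gw N γ g τ x₁ x G) {k : ℕ}
    (hk : k ∈ Finset.Icc 1 N) (ω : Ω) : x (k + 1) ω ∈ X := by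
  rw [Finset.mem_Icc] at hk
  exact hs.mem (k + 1) (Finset.mem_Icc.2 ⟨by omega, by omega⟩) ω

lemma measurable_x_left (hs : IsProxProcess P 𝓕 X h w gw N γ g τ x₁ x G) {k : ℕ}
    (hk : k ∈ Finset.Icc 1 N) : Measurable[𝓕 k] (x k) :=
  hs.measurable_x k (Finset.Icc_subset_Icc_right (by omega) hk)

lemma integrable_sq_error (hs : IsProxProcess P 𝓕 X h w gw N γ g τ x₁ x G) {k : ℕ}
    (hk : k ∈ Finset.Icc 1 N) : Integrable (fun ω => ‖G k ω - g (x k ω)‖ ^ 2) P :=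
  (hs.memLp_error k hk).integrable_norm_pow two_ne_zero

variable [IsProbabilityMeasure P]

lemma nonempty (hs : IsProxProcess P 𝓕 X h w gw N γ g τ x₁ x G) : X.Nonempty :=
  have : Nonempty Ω := nonempty_of_isProbabilityMeasure P
  ⟨_, hs.mem 1 (Finset.mem_Icc.2 ⟨le_rfl, by omega⟩) (Classical.arbitrary Ω)⟩

lemma measurable_projGrad (hs : IsProxProcess P 𝓕 X h w gw N γ g τ x₁ x G)
    (hp : IsProxProblem X h α w gw) {k : ℕ} (hk : k ∈ Finset.Icc 1 N) (hγ : 0 < γ k) :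
    Measurable[𝓕 (k + 1)] fun ω => projGrad X h w gw (x k ω) (G k ω) (γ k) :=
  hp.measurable_projGrad hγ (hs.measurable_G k hk)
    ((hs.measurable_x_left hk).mono (hs.mono (Nat.le_succ k)) le_rfl) (hs.mem_left hk) hs.nonempty

lemma measurable_projGrad_mean (hs : IsProxProcess P 𝓕 X h w gw N γ g τ x₁ x G)
    (hp : IsProxProblem X h α w gw) {k : ℕ} (hk : k ∈ Finset.Icc 1 N) (hγ : 0 < γ k) :
    Measurable[𝓕 k] fun ω => projGrad X h w gw (x k ω) (g (x k ω)) (γ k) :=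
  hp.measurable_projGrad hγ (hs.measurable_g k hk) (hs.measurable_x_left hk) (hs.mem_left hk)
    hs.nonempty

lemma measurable_h_succ (hs : IsProxProcess P 𝓕 X h w gw N γ g τ x₁ x G)
    (hp : IsProxProblem X h α w gw) {k : ℕ} (hk : k ∈ Finset.Icc 1 N) (hγ : 0 < γ k) :
    Measurable[𝓕 (k + 1)] fun ω => h (x (k + 1) ω) := by
  simp_rw [hs.step k hk]
  exact (hp.measurable_step hγ (hs.measurable_G k hk)
    ((hs.measurable_x_left hk).mono (hs.mono (Nat.le_succ k)) le_rfl) (hs.mem_left hk)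
    hs.nonempty).2

omit [IsProbabilityMeasure P] in
lemma descent (hs : IsProxProcess P 𝓕 X h w gw N γ g τ x₁ x G)
    (hp : IsProxProblem X h α w gw)
    (hφ : ∀ x y, φ y ≤ φ x + inner ℝ (g x) (y - x) + L / 2 * ‖y - x‖ ^ 2) {k : ℕ}
    (hk : k ∈ Finset.Icc 1 N) (hγ : 0 < γ k) (ω : Ω) :
    (α * γ k - L * γ k ^ 2 / 2) * ‖projGrad X h w gw (x k ω) (G k ω) (γ k)‖ ^ 2 ≤
      (φ (x k ω) + h (x k ω)) - (φ (x (k + 1) ω) + h (x (k + 1) ω)) +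
      γ k * inner ℝ (G k ω - g (x k ω)) (projGrad X h w gw (x k ω) (G k ω) (γ k)) := by
  rw [hs.step k hk]
  exact proj_step_descent hp.convex hp.convexOn hp.distGen hγ (hs.mem_left hk ω)
    (hp.isProjSolution hγ _ (hs.mem_left hk ω)) (hφ _ _)

omit [IsProbabilityMeasure P] in
-- A pathwise bound meant for integrability. As L γ ≤ α, the gain is at least α γ / 2; Young's
-- inequality d r ≤ d² / α + α r² / 4 spends half of that on the inner product.
lemma descent_of_error (hs : IsProxProcess P 𝓕 X h w gw N γ g τ x₁ x G)
    (hp : IsProxProblem X h α w gw)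
    (hφ : ∀ x y, φ y ≤ φ x + inner ℝ (g x) (y - x) + L / 2 * ‖y - x‖ ^ 2) {k : ℕ}
    (hk : k ∈ Finset.Icc 1 N) (hγ : 0 < γ k) (hγL : L * γ k ≤ α) (ω : Ω) :
    α * γ k / 4 * ‖projGrad X h w gw (x k ω) (G k ω) (γ k)‖ ^ 2 ≤
      (φ (x k ω) + h (x k ω)) - (φ (x (k + 1) ω) + h (x (k + 1) ω)) +
      γ k / α * ‖G k ω - g (x k ω)‖ ^ 2 := by
  have h1 := hs.descent hp hφ hk hγ ω
  have h2 := real_inner_le_norm (G k ω - g (x k ω)) (projGrad X h w gw (x k ω) (G k ω) (γ k))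
  set r := ‖projGrad X h w gw (x k ω) (G k ω) (γ k)‖
  set d := ‖G k ω - g (x k ω)‖
  have hα := hp.pos
  have h3 : d * r ≤ d ^ 2 / α + α / 4 * r ^ 2 := by
    have : 0 ≤ (d - α / 2 * r) ^ 2 / α := by positivity
    have e : (d - α / 2 * r) ^ 2 / α = d ^ 2 / α - d * r + α / 4 * r ^ 2 := by
      field_simp
      ring
    linarith
  have h4 := mul_le_mul_of_nonneg_left (h2.trans h3) hγ.le
  have h5 : L * γ k * (γ k * r ^ 2) ≤ α * (γ k * r ^ 2) :=
    mul_le_mul_of_nonneg_right hγL (by positivity)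
  have e : γ k / α * d ^ 2 = γ k * (d ^ 2 / α) := by ring
  rw [e]
  linarith

omit [IsProbabilityMeasure P] in
lemma value_add_sum_le (hs : IsProxProcess P 𝓕 X h w gw N γ g τ x₁ x G)
    (hp : IsProxProblem X h α w gw)
    (hφ : ∀ x y, φ y ≤ φ x + inner ℝ (g x) (y - x) + L / 2 * ‖y - x‖ ^ 2)
    (hγ : ∀ k ∈ Finset.Icc 1 N, 0 < γ k ∧ L * γ k ≤ α) (ω : Ω) (j : ℕ) (hj : j ≤ N) :
    φ (x (j + 1) ω) + h (x (j + 1) ω) +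
      ∑ k ∈ Finset.Icc 1 j, α * γ k / 4 * ‖projGrad X h w gw (x k ω) (G k ω) (γ k)‖ ^ 2 ≤
    φ x₁ + h x₁ + ∑ k ∈ Finset.Icc 1 j, γ k / α * ‖G k ω - g (x k ω)‖ ^ 2 := by
  have h1 := Finset.sum_le_sum (s := Finset.Icc 1 j) fun k hk => by
    have hk' : k ∈ Finset.Icc 1 N := Finset.Icc_subset_Icc_right hj hk
    exact hs.descent_of_error hp hφ hk' (hγ k hk').1 (hγ k hk').2 ω
  rw [Finset.sum_add_distrib,
    sum_Icc_sub_succ (fun k => φ (x k ω) + h (x k ω)), hs.init] at h1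
  linarith

/-- The telescoped descent, with f_μ + h bounded below, dominates the square by a constant plus
square-integrable errors. -/
lemma memLp_projGrad (hs : IsProxProcess P 𝓕 X h w gw N γ g τ x₁ x G)
    (hp : IsProxProblem X h α w gw)
    (hφ : ∀ x y, φ y ≤ φ x + inner ℝ (g x) (y - x) + L / 2 * ‖y - x‖ ^ 2)
    (hc : ∀ u ∈ X, c ≤ φ u + h u)
    (hγ : ∀ k ∈ Finset.Icc 1 N, 0 < γ k ∧ L * γ k ≤ α) {k : ℕ} (hk : k ∈ Finset.Icc 1 N) :
    MemLp (fun ω => projGrad X h w gw (x k ω) (G k ω) (γ k)) 2 P := by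
  have hα := hp.pos
  have hm := (hs.measurable_projGrad hp hk (hγ k hk).1).mono (hs.le (k + 1)) le_rfl
  rw [memLp_two_iff_integrable_sq_norm hm.aestronglyMeasurable]
  have i1 : Integrable (fun ω => φ x₁ + h x₁ - c +
      ∑ k ∈ Finset.Icc 1 N, γ k / α * ‖G k ω - g (x k ω)‖ ^ 2) P :=
    (integrable_const _).add (integrable_finsetSum _ fun k hk =>
      (hs.integrable_sq_error hk).const_mul _)
  refine (i1.const_mul (α * γ k / 4)⁻¹).mono' (hm.norm.pow_const 2).aestronglyMeasurable
    (Filter.Eventually.of_forall fun ω => ?_)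
  have hγk := (hγ k hk).1
  rw [Real.norm_eq_abs, abs_of_nonneg (by positivity), ← div_eq_inv_mul,
    le_div_iff₀ (by positivity)]
  have h1 := hs.value_add_sum_le hp hφ hγ ω N le_rfl
  have h2 := hc _ (hs.mem (N + 1) (Finset.mem_Icc.2 ⟨by omega, le_rfl⟩) ω)
  have h3 := Finset.single_le_sum (f := fun k => α * γ k / 4 *
    ‖projGrad X h w gw (x k ω) (G k ω) (γ k)‖ ^ 2) (fun j hj => by
      have := (hγ j hj).1
      positivity) hk
  linarith

lemma memLp_projGrad_mean (hs : IsProxProcess P 𝓕 X h w gw N γ g τ x₁ x G)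
    (hp : IsProxProblem X h α w gw)
    (hφ : ∀ x y, φ y ≤ φ x + inner ℝ (g x) (y - x) + L / 2 * ‖y - x‖ ^ 2)
    (hc : ∀ u ∈ X, c ≤ φ u + h u)
    (hγ : ∀ k ∈ Finset.Icc 1 N, 0 < γ k ∧ L * γ k ≤ α) {k : ℕ} (hk : k ∈ Finset.Icc 1 N) :
    MemLp (fun ω => projGrad X h w gw (x k ω) (g (x k ω)) (γ k)) 2 P := by
  have h1 := hs.memLp_projGrad hp hφ hc hγ hk
  have hm := (hs.measurable_projGrad_mean hp hk (hγ k hk).1).mono (hs.le k) le_rfl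
  have h2 := (hs.memLp_error k hk).norm.const_mul α⁻¹
  refine (h1.norm.add h2).mono' hm.aestronglyMeasurable (Filter.Eventually.of_forall fun ω => ?_)
  have h3 := norm_projGrad_sub_le hp.convex hp.convexOn hp.pos hp.distGen (hγ k hk).1
    (hp.solv _ (hγ k hk).1) (hs.mem_left hk ω) (g (x k ω)) (G k ω)
  rw [norm_sub_rev (g _)] at h3
  have h4 := norm_le_norm_add_norm_sub' (projGrad X h w gw (x k ω) (g (x k ω)) (γ k))
    (projGrad X h w gw (x k ω) (G k ω) (γ k))
  simp only [Pi.add_apply, inv_mul_eq_div]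
  linarith

/-- The weighted mean square of the stochastic projected gradients. -/
theorem sum_integral_sq_projGrad_le (hs : IsProxProcess P 𝓕 X h w gw N γ g τ x₁ x G)
    (hp : IsProxProblem X h α w gw) (hL : 0 ≤ L)
    (hφ : ∀ x y, φ y ≤ φ x + inner ℝ (g x) (y - x) + L / 2 * ‖y - x‖ ^ 2)
    (hc : ∀ u ∈ X, c ≤ φ u + h u)
    (hγ : ∀ k ∈ Finset.Icc 1 N, 0 < γ k ∧ L * γ k ≤ α) :
    ∑ k ∈ Finset.Icc 1 N, (α * γ k - L * γ k ^ 2) *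
      ∫ ω, ‖projGrad X h w gw (x k ω) (G k ω) (γ k)‖ ^ 2 ∂P ≤
    φ x₁ + h x₁ - c + ∑ k ∈ Finset.Icc 1 N, γ k / α * τ k := by
  have hα := hp.pos
  have ir : ∀ k ∈ Finset.Icc 1 N, Integrable (fun ω => (α * γ k - L * γ k ^ 2) *
      ‖projGrad X h w gw (x k ω) (G k ω) (γ k)‖ ^ 2) P := fun k hk =>
    ((hs.memLp_projGrad hp hφ hc hγ hk).integrable_norm_pow two_ne_zero).const_mul _
  have iy : ∀ k ∈ Finset.Icc 1 N, Integrable (fun ω => γ k * inner ℝ (G k ω - g (x k ω))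
      (projGrad X h w gw (x k ω) (g (x k ω)) (γ k))) P := fun k hk =>
    (integrable_inner_of_memLp (hs.memLp_error k hk)
      (hs.memLp_projGrad_mean hp hφ hc hγ hk)).const_mul _
  have id' : ∀ k ∈ Finset.Icc 1 N, Integrable (fun ω => γ k / α * ‖G k ω - g (x k ω)‖ ^ 2) P :=
    fun k hk => (hs.integrable_sq_error hk).const_mul _
  have iyd : ∀ k ∈ Finset.Icc 1 N, Integrable (fun ω => γ k * inner ℝ (G k ω - g (x k ω))
      (projGrad X h w gw (x k ω) (g (x k ω)) (γ k)) +
      γ k / α * ‖G k ω - g (x k ω)‖ ^ 2) P := fun k hk => (iy k hk).add (id' k hk)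
  have hpath : ∀ ω, ∑ k ∈ Finset.Icc 1 N, (α * γ k - L * γ k ^ 2) *
      ‖projGrad X h w gw (x k ω) (G k ω) (γ k)‖ ^ 2 ≤ φ x₁ + h x₁ - c +
      ∑ k ∈ Finset.Icc 1 N, (γ k * inner ℝ (G k ω - g (x k ω))
        (projGrad X h w gw (x k ω) (g (x k ω)) (γ k)) +
        γ k / α * ‖G k ω - g (x k ω)‖ ^ 2) := by
    intro ω
    have h1 := Finset.sum_le_sum (s := Finset.Icc 1 N)
      (f := fun k => (α * γ k - L * γ k ^ 2) *
        ‖projGrad X h w gw (x k ω) (G k ω) (γ k)‖ ^ 2)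
      (g := fun k => (φ (x k ω) + h (x k ω)) - (φ (x (k + 1) ω) + h (x (k + 1) ω)) +
        (γ k * inner ℝ (G k ω - g (x k ω)) (projGrad X h w gw (x k ω) (g (x k ω)) (γ k)) +
        γ k / α * ‖G k ω - g (x k ω)‖ ^ 2)) fun k hk => by
      have a1 := hs.descent hp hφ hk (hγ k hk).1 ω
      have hγk := (hγ k hk).1
      have a2 := norm_projGrad_sub_le hp.convex hp.convexOn hp.pos hp.distGen hγk
        (hp.solv _ hγk) (hs.mem_left hk ω) (G k ω) (g (x k ω))
      set r := projGrad X h w gw (x k ω) (G k ω) (γ k)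
      set y := projGrad X h w gw (x k ω) (g (x k ω)) (γ k)
      set d := G k ω - g (x k ω)
      -- Split ⟨d, r⟩ = ⟨d, y⟩ + ⟨d, r - y⟩: `y` is determined by the past, so the first part will
      -- vanish in mean, and ‖r - y‖ ≤ ‖d‖ / α bounds the second.
      have a3 : inner ℝ d (r - y) ≤ ‖d‖ * (‖d‖ / α) :=
        (real_inner_le_norm _ _).trans (by gcongr)
      rw [inner_sub_right] at a3
      have a4 := mul_le_mul_of_nonneg_left a3 hγk.le
      -- This part of the decrease is given up so that the weights become proportional to the law of
      -- R.
      have a5 : 0 ≤ L * γ k ^ 2 / 2 * ‖r‖ ^ 2 := by positivity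
      have e : γ k / α * ‖d‖ ^ 2 = γ k * (‖d‖ * (‖d‖ / α)) := by ring
      rw [e]
      linarith
    rw [Finset.sum_add_distrib,
      sum_Icc_sub_succ (fun k => φ (x k ω) + h (x k ω)), hs.init] at h1
    have h2 := hc _ (hs.mem (N + 1) (Finset.mem_Icc.2 ⟨by omega, le_rfl⟩) ω)
    linarith
  have hint := integral_mono (integrable_finsetSum _ ir)
    ((integrable_const _).add (integrable_finsetSum _ iyd)) hpath
  simp only [Pi.add_apply] at hint
  rw [integral_add (integrable_const _) (integrable_finsetSum _ iyd),
    integral_finsetSum _ ir, integral_finsetSum _ iyd] at hint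
  simp only [integral_const_mul, integral_const, probReal_univ, one_smul] at hint
  refine hint.trans ?_
  gcongr with k hk
  rw [integral_add (iy k hk) (id' k hk), integral_const_mul, integral_const_mul,
    hs.orthogonal k hk _ (hs.measurable_projGrad_mean hp hk (hγ k hk).1)
      (hs.memLp_projGrad_mean hp hφ hc hγ hk), mul_zero, zero_add]
  have := (hγ k hk).1
  gcongr
  exact hs.variance k hk

/-- Makes z - x_k an admissible test vector in `orthogonal`. -/
lemma memLp_x (hs : IsProxProcess P 𝓕 X h w gw N γ g τ x₁ x G)
    (hp : IsProxProblem X h α w gw)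
    (hφ : ∀ x y, φ y ≤ φ x + inner ℝ (g x) (y - x) + L / 2 * ‖y - x‖ ^ 2)
    (hc : ∀ u ∈ X, c ≤ φ u + h u)
    (hγ : ∀ k ∈ Finset.Icc 1 N, 0 < γ k ∧ L * γ k ≤ α) {k : ℕ} (hk1 : 1 ≤ k) (hkN : k ≤ N + 1) :
    MemLp (x k) 2 P := by
  induction k, hk1 using Nat.le_induction with
  | base =>
    rw [show x 1 = fun _ => x₁ from funext hs.init]
    exact memLp_const x₁
  | succ k hk ih =>
    have hkN' : k ∈ Finset.Icc 1 N := Finset.mem_Icc.2 ⟨hk, by omega⟩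
    rw [show x (k + 1) = fun ω => x k ω - γ k • projGrad X h w gw (x k ω) (G k ω) (γ k) from
      funext (hs.x_succ hkN' (hγ k hkN').1)]
    exact (ih (by omega)).sub ((hs.memLp_projGrad hp hφ hc hγ hkN').const_smul (γ k))

/-- Pathwise, the telescoped descent bounds the value from above and `c` bounds it from below. -/
lemma integrable_value_succ (hs : IsProxProcess P 𝓕 X h w gw N γ g τ x₁ x G)
    (hp : IsProxProblem X h α w gw)
    (hφ : ∀ x y, φ y ≤ φ x + inner ℝ (g x) (y - x) + L / 2 * ‖y - x‖ ^ 2)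
    (hφm : Measurable φ) (hc : ∀ u ∈ X, c ≤ φ u + h u)
    (hγ : ∀ k ∈ Finset.Icc 1 N, 0 < γ k ∧ L * γ k ≤ α) {k : ℕ} (hk : k ∈ Finset.Icc 1 N) :
    Integrable (fun ω => φ (x (k + 1) ω) + h (x (k + 1) ω)) P := by
  have hk' := Finset.mem_Icc.1 hk
  have hα := hp.pos
  have m1 : Measurable fun ω => φ (x (k + 1) ω) + h (x (k + 1) ω) :=
    (hφm.comp ((hs.measurable_x (k + 1) (Finset.mem_Icc.2 ⟨by omega, by omega⟩)).mono
      (hs.le _) le_rfl)).add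
      ((hs.measurable_h_succ hp hk (hγ k hk).1).mono (hs.le _) le_rfl)
  have i1 : Integrable (fun ω => |c| + (|φ x₁ + h x₁| +
      ∑ j ∈ Finset.Icc 1 k, γ j / α * ‖G j ω - g (x j ω)‖ ^ 2)) P :=
    (integrable_const _).add ((integrable_const _).add (integrable_finsetSum _ fun j hj =>
      (hs.integrable_sq_error (Finset.Icc_subset_Icc_right hk'.2 hj)).const_mul _))
  refine i1.mono' m1.aestronglyMeasurable (Filter.Eventually.of_forall fun ω => ?_)
  have h1 := hs.value_add_sum_le hp hφ hγ ω k hk'.2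
  have h2 := hc _ (hs.mem_right hk ω)
  have h3 : 0 ≤ ∑ j ∈ Finset.Icc 1 k, α * γ j / 4 *
      ‖projGrad X h w gw (x j ω) (G j ω) (γ j)‖ ^ 2 := Finset.sum_nonneg fun j hj => by
    have := (hγ j (Finset.Icc_subset_Icc_right hk'.2 hj)).1
    positivity
  have h4 : 0 ≤ ∑ j ∈ Finset.Icc 1 k, γ j / α * ‖G j ω - g (x j ω)‖ ^ 2 :=
    Finset.sum_nonneg fun j hj => by
      have := (hγ j (Finset.Icc_subset_Icc_right hk'.2 hj)).1
      positivity
  rw [Real.norm_eq_abs, abs_le]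
  constructor
  · linarith [neg_abs_le c, abs_nonneg (φ x₁ + h x₁)]
  · linarith [abs_nonneg c, le_abs_self (φ x₁ + h x₁)]

/-- The weighted mean optimality gaps in the convex case. -/
theorem sum_integral_value_sub_le (hs : IsProxProcess P 𝓕 X h w gw N γ g τ x₁ x G)
    (hp : IsProxProblem X h α w gw) (hL : 0 ≤ L) (hN : 1 ≤ N)
    (hφ : ∀ x y, φ y ≤ φ x + inner ℝ (g x) (y - x) + L / 2 * ‖y - x‖ ^ 2)
    (hφm : Measurable φ) (hc : ∀ u ∈ X, c ≤ φ u + h u)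
    (hφc : ∀ x y, φ x + inner ℝ (g x) (y - x) ≤ φ y)
    (hγ : ∀ k ∈ Finset.Icc 1 N, 0 < γ k ∧ L * γ k ≤ α) (hmono : MonotoneOn γ (Set.Icc 1 N))
    {z : Vec n} (hz : z ∈ X) :
    ∑ k ∈ Finset.Icc 1 N, (α * γ k - L * γ k ^ 2) *
      ∫ ω, ((φ (x (k + 1) ω) + h (x (k + 1) ω)) - (φ z + h z)) ∂P ≤
    (α - L * γ 1) * proxV w gw z x₁ + ∑ k ∈ Finset.Icc 1 N, γ k ^ 2 / 2 * τ k := by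
  have il : ∀ k ∈ Finset.Icc 1 N, Integrable (fun ω => (α * γ k - L * γ k ^ 2) *
      ((φ (x (k + 1) ω) + h (x (k + 1) ω)) - (φ z + h z))) P := fun k hk =>
    ((hs.integrable_value_succ hp hφ hφm hc hγ hk).sub (integrable_const _)).const_mul _
  have hzx : ∀ k ∈ Finset.Icc 1 N, MemLp (fun ω => z - x k ω) 2 P := fun k hk => by
    have hk' := Finset.mem_Icc.1 hk
    exact (memLp_const z).sub (hs.memLp_x hp hφ hc hγ hk'.1 (by omega))
  have iy : ∀ k ∈ Finset.Icc 1 N, Integrable (fun ω => (α * γ k - L * γ k ^ 2) *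
      inner ℝ (G k ω - g (x k ω)) (z - x k ω)) P := fun k hk =>
    (integrable_inner_of_memLp (hs.memLp_error k hk) (hzx k hk)).const_mul _
  have id' : ∀ k ∈ Finset.Icc 1 N, Integrable (fun ω => γ k ^ 2 / 2 * ‖G k ω - g (x k ω)‖ ^ 2) P :=
    fun k hk => (hs.integrable_sq_error hk).const_mul _
  have iyd : ∀ k ∈ Finset.Icc 1 N, Integrable (fun ω => (α * γ k - L * γ k ^ 2) *
      inner ℝ (G k ω - g (x k ω)) (z - x k ω) + γ k ^ 2 / 2 * ‖G k ω - g (x k ω)‖ ^ 2) P :=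
    fun k hk => (iy k hk).add (id' k hk)
  have hβ : ∀ k ∈ Finset.Icc 1 N, 0 ≤ α - L * γ k := fun k hk => sub_nonneg.2 (hγ k hk).2
  have hpath : ∀ ω, ∑ k ∈ Finset.Icc 1 N, (α * γ k - L * γ k ^ 2) *
      ((φ (x (k + 1) ω) + h (x (k + 1) ω)) - (φ z + h z)) ≤ (α - L * γ 1) * proxV w gw z x₁ +
      ∑ k ∈ Finset.Icc 1 N, ((α * γ k - L * γ k ^ 2) *
      inner ℝ (G k ω - g (x k ω)) (z - x k ω) + γ k ^ 2 / 2 * ‖G k ω - g (x k ω)‖ ^ 2) := by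
    intro ω
    have h1 := Finset.sum_le_sum (s := Finset.Icc 1 N)
      (f := fun k => (α * γ k - L * γ k ^ 2) *
        ((φ (x (k + 1) ω) + h (x (k + 1) ω)) - (φ z + h z)))
      (g := fun k => (α - L * γ k) * (proxV w gw z (x k ω) - proxV w gw z (x (k + 1) ω)) +
        ((α * γ k - L * γ k ^ 2) * inner ℝ (G k ω - g (x k ω)) (z - x k ω) +
        γ k ^ 2 / 2 * ‖G k ω - g (x k ω)‖ ^ 2)) fun k hk => by
      rw [hs.step k hk, ← add_assoc]
      exact proj_step_three_point hp.convex hp.convexOn hp.distGen (hγ k hk).1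
        (hs.mem_left hk ω) hz (hp.isProjSolution (hγ k hk).1 _ (hs.mem_left hk ω)) (hβ k hk)
        (hφ _ _) (hφc _ _)
    -- Nondecreasing stepsizes make the weights α - L γ_k nonincreasing.
    have h2 := sum_mul_sub_succ_le (β := fun k => α - L * γ k)
      (V := fun k => proxV w gw z (x k ω)) hN hβ
      (fun i hi j hj hij => by
        have := mul_le_mul_of_nonneg_left (hmono hi hj hij) hL
        simp only
        linarith)
      (fun k hk => by
        have := hp.distGen.le_proxV hp.convex hz (hs.mem k hk ω)
        have hα := hp.pos
        exact le_trans (by positivity) this)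
    simp only [hs.init] at h2
    rw [Finset.sum_add_distrib] at h1
    linarith
  have hint := integral_mono (integrable_finsetSum _ il)
    ((integrable_const _).add (integrable_finsetSum _ iyd)) hpath
  simp only [Pi.add_apply] at hint
  rw [integral_add (integrable_const _) (integrable_finsetSum _ iyd),
    integral_finsetSum _ il, integral_finsetSum _ iyd] at hint
  simp only [integral_const_mul, integral_const, probReal_univ, one_smul] at hint
  refine hint.trans ?_
  gcongr with k hk
  rw [integral_add (iy k hk) (id' k hk), integral_const_mul, integral_const_mul,
    hs.orthogonal k hk (fun ω => z - x k ω) (measurable_const.sub (hs.measurable_x_left hk)) (hzx k hk), mul_zero,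
    zero_add]
  gcongr
  exact hs.variance k hk

end IsProxProcess

/-! ### Orthogonal sums, random indices and measurability of the estimator. -/

/-- The second moment of a sum of orthogonal errors. -/
lemma integral_sq_sum_le {n : ℕ} {Ω : Type*} {mΩ : MeasurableSpace Ω} {P : Measure Ω}
    {δ : ℕ → Ω → Vec n} {s : ℝ} {m : ℕ} (h2 : ∀ i < m, MemLp (δ i) 2 P)
    (hs : ∀ i < m, ∫ ω, ‖δ i ω‖ ^ 2 ∂P ≤ s)
    (ho : ∀ i < m, ∫ ω, inner ℝ (δ i ω) (∑ j ∈ Finset.range i, δ j ω) ∂P = 0) :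
    ∫ ω, ‖∑ i ∈ Finset.range m, δ i ω‖ ^ 2 ∂P ≤ m * s := by
  induction m with
  | zero => simp
  | succ m ih =>
    have ih' := ih (fun i hi => h2 i (by omega)) (fun i hi => hs i (by omega))
      fun i hi => ho i (by omega)
    have hS : MemLp (fun ω => ∑ i ∈ Finset.range m, δ i ω) 2 P :=
      memLp_finsetSum _ fun i hi => h2 i (by rw [Finset.mem_range] at hi; omega)
    have hδ := h2 m (by omega)
    have i1 : Integrable (fun ω => ‖∑ i ∈ Finset.range m, δ i ω‖ ^ 2) P :=
      hS.integrable_norm_pow two_ne_zero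
    have i2 : Integrable (fun ω => 2 * inner ℝ (δ m ω) (∑ i ∈ Finset.range m, δ i ω)) P :=
      (integrable_inner_of_memLp hδ hS).const_mul 2
    have i3 : Integrable (fun ω => ‖δ m ω‖ ^ 2) P := hδ.integrable_norm_pow two_ne_zero
    have i12 : Integrable (fun ω => ‖∑ i ∈ Finset.range m, δ i ω‖ ^ 2 +
      2 * inner ℝ (δ m ω) (∑ i ∈ Finset.range m, δ i ω)) P := i1.add i2
    simp_rw [Finset.sum_range_succ, norm_add_sq_real, real_inner_comm (δ m _)]
    rw [integral_add i12 i3, integral_add i1 i2, integral_const_mul, ho m (by omega)]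
    push_cast
    linarith [hs m (by omega)]

/-- Averaging over an independent random index. -/
theorem integral_random_index {Ω : Type*} {𝓖 mΩ : MeasurableSpace Ω} {P : Measure Ω}
    [IsProbabilityMeasure P] {R : Ω → ℕ} (hR : Measurable R)
    (hind : Indep (MeasurableSpace.comap R inferInstance) 𝓖 P) {q : ℕ → ℝ} {A : Finset ℕ}
    (hq : ∀ k ∈ A, P.real {ω | R ω = k} = q k) (hsum : ∑ k ∈ A, q k = 1) {W : ℕ → Ω → ℝ}
    (hWm : ∀ k ∈ A, Measurable[𝓖] (W k)) (hW : ∀ k ∈ A, Integrable (W k) P) :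
    Integrable (fun ω => W (R ω) ω) P ∧ ∫ ω, W (R ω) ω ∂P = ∑ k ∈ A, q k * ∫ ω, W k ω ∂P := by
  have hms : ∀ k, MeasurableSet {ω | R ω = k} := fun k => hR (measurableSet_singleton k)
  -- The prescribed probabilities already sum to 1, so values of R outside `A` have probability 0.
  have hae : ∀ᵐ ω ∂P, R ω ∈ A := by
    have h1 : P.real (⋃ k ∈ A, {ω | R ω = k}) = 1 := by
      rw [measureReal_biUnion_finset (fun i _ j _ hij => Set.disjoint_left.2 fun ω h1 h2 =>
        hij (h1.symm.trans h2)) fun k _ => hms k, ← hsum]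
      exact Finset.sum_congr rfl hq
    have h2 : P (⋃ k ∈ A, {ω | R ω = k}) = 1 := by
      rwa [measureReal_def, ENNReal.toReal_eq_one_iff] at h1
    have h3 := (prob_compl_eq_zero_iff (Finset.measurableSet_biUnion A fun k _ => hms k)).2 h2
    rw [ae_iff]
    refine measure_mono_null (fun ω hω => ?_) h3
    simpa using hω
  have hb : ∀ k, Measurable ((fun r : ℕ => if r = k then (1 : ℝ) else 0)) := fun k =>
    measurable_from_nat
  have hi : ∀ k ∈ A, Integrable (fun ω => (if R ω = k then (1 : ℝ) else 0) * W k ω) P :=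
    fun k hk => by
      refine (hW k hk).bdd_mul (c := 1) ((hb k).comp hR).aestronglyMeasurable
        (Filter.Eventually.of_forall fun ω => ?_)
      split_ifs <;> simp
  have he : (fun ω => W (R ω) ω) =ᵐ[P]
      fun ω => ∑ k ∈ A, (if R ω = k then (1 : ℝ) else 0) * W k ω := by
    filter_upwards [hae] with ω hω
    simp [hω]
  refine ⟨(integrable_finsetSum A hi).congr he.symm, ?_⟩
  rw [integral_congr_ae he, integral_finsetSum A hi]
  refine Finset.sum_congr rfl fun k hk => ?_
  have hif : IndepFun R (W k) P :=
    indep_of_indep_of_le_right hind (hWm k hk).comap_le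
  have hif2 : IndepFun (fun ω => if R ω = k then (1 : ℝ) else 0) (W k) P :=
    hif.comp (hb k) measurable_id
  rw [hif2.integral_fun_mul_eq_mul_integral ((hb k).comp hR).aestronglyMeasurable
    (hW k hk).aestronglyMeasurable, ← hq k hk]
  congr 1
  have : (fun ω => if R ω = k then (1 : ℝ) else 0) = {ω | R ω = k}.indicator 1 := by
    ext ω
    simp [Set.indicator_apply]
  rw [this, integral_indicator_one (hms k)]

lemma measurable_gradFree {n : ℕ} {Ω S : Type*} {𝓖 : MeasurableSpace Ω} [MeasurableSpace S]
    {F : Vec n → S → ℝ} (hF : Measurable (Function.uncurry F)) {μ : ℝ} {x : Ω → Vec n}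
    (hx : Measurable x) {ξ : Ω → S} {v : Ω → Vec n} (hs : Measurable fun ω => (ξ ω, v ω)) :
    Measurable fun ω => gradFree F μ (x ω) (ξ ω) (v ω) := by
  have h1 : Measurable fun ω => F (x ω + μ • v ω) (ξ ω) :=
    hF.comp ((hx.add (hs.snd.const_smul μ)).prodMk hs.fst)
  have h2 : Measurable fun ω => F (x ω) (ξ ω) := hF.comp (hx.prodMk hs.fst)
  unfold gradFree
  exact ((h1.sub h2).div_const μ).smul hs.snd

lemma measurable_batchGrad {n : ℕ} {Ω S : Type*} {𝓖 : MeasurableSpace Ω} [MeasurableSpace S]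
    {F : Vec n → S → ℝ} (hF : Measurable (Function.uncurry F)) {μ : ℝ} {m : ℕ} {x : Ω → Vec n}
    (hx : Measurable x) {ξ : ℕ → Ω → S} {v : ℕ → Ω → Vec n}
    (hs : ∀ i < m, Measurable fun ω => (ξ i ω, v i ω)) :
    Measurable fun ω => batchGrad F μ m (x ω) (fun i => ξ i ω) (fun i => v i ω) := by
  have hsum : Measurable fun ω => ∑ i ∈ Finset.range m, gradFree F μ (x ω) (ξ i ω) (v i ω) :=
    Finset.measurable_fun_sum _ fun i hi =>
      measurable_gradFree hF hx (hs i (Finset.mem_range.1 hi))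
  unfold batchGrad
  exact hsum.const_smul (1 / (m : ℝ))

/-! ### The RSPGF run as a stochastic proximal gradient process. -/

section Past

variable {n : ℕ} {Ω S : Type*} {mΩ : MeasurableSpace Ω} [MeasurableSpace S] {m : ℕ → ℕ}
  {ξ : ℕ → ℕ → Ω → S} {v : ℕ → ℕ → Ω → Vec n}

lemma past_le (hξ : ∀ k i, Measurable (ξ k i)) (hv : ∀ k i, Measurable (v k i)) (k i : ℕ) :
    past m ξ v k i ≤ mΩ :=
  iSup_le fun l => iSup_le fun j => iSup_le fun _ => ((hξ l j).prodMk (hv l j)).comap_le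

lemma past_mono {k i k' i' : ℕ} (h : k < k' ∨ (k = k' ∧ i ≤ i')) :
    past m ξ v k i ≤ past m ξ v k' i' :=
  iSup_mono fun l => iSup_mono fun j => iSup_mono' fun hlj =>
    ⟨⟨hlj.1, hlj.2.1, by omega⟩, le_rfl⟩

lemma measurable_past {k i l j : ℕ} (hl : 1 ≤ l) (hj : j < m l) (h : l < k ∨ (l = k ∧ j < i)) :
    Measurable[past m ξ v k i] fun ω => (ξ l j ω, v l j ω) := by
  refine Measurable.mono (comap_measurable _) ?_ le_rfl
  exact le_iSup_of_le l (le_iSup_of_le j (le_iSup_of_le ⟨hl, hj, h⟩ le_rfl))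

end Past

section Run

variable {n : ℕ} {Ω S : Type*}

/-- The random iterates of the method. -/
def runIterate (X : Set (Vec n)) (h w : Vec n → ℝ) (gw : Vec n → Vec n) (F : Vec n → S → ℝ) (μ : ℝ)
    (γ : ℕ → ℝ) (m : ℕ → ℕ) (x₁ : Vec n) (ξ : ℕ → ℕ → Ω → S) (v : ℕ → ℕ → Ω → Vec n) (k : ℕ)
    (ω : Ω) : Vec n :=
  iterate X h w gw F μ γ m x₁ (fun k i => ξ k i ω) (fun k i => v k i ω) k

/-- The random directions used by the method. -/
def runGrad (X : Set (Vec n)) (h w : Vec n → ℝ) (gw : Vec n → Vec n) (F : Vec n → S → ℝ) (μ : ℝ)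
    (γ : ℕ → ℝ) (m : ℕ → ℕ) (x₁ : Vec n) (ξ : ℕ → ℕ → Ω → S) (v : ℕ → ℕ → Ω → Vec n) (k : ℕ)
    (ω : Ω) : Vec n :=
  batchGrad F μ (m k) (runIterate X h w gw F μ γ m x₁ ξ v k ω) (fun i => ξ k i ω)
    (fun i => v k i ω)

lemma runIterate_succ (X : Set (Vec n)) (h w : Vec n → ℝ) (gw : Vec n → Vec n) (F : Vec n → S → ℝ)
    (μ : ℝ) (γ : ℕ → ℝ) (m : ℕ → ℕ) (x₁ : Vec n) (ξ : ℕ → ℕ → Ω → S) (v : ℕ → ℕ → Ω → Vec n)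
    {k : ℕ} (hk : 1 ≤ k) (ω : Ω) :
    runIterate X h w gw F μ γ m x₁ ξ v (k + 1) ω =
      genProj X h w gw (γ k) (runGrad X h w gw F μ γ m x₁ ξ v k ω)
        (runIterate X h w gw F μ γ m x₁ ξ v k ω) := by
  obtain ⟨k, rfl⟩ := Nat.exists_eq_add_of_le' hk
  rfl

/-- The assumptions on the problem, the oracle and the samples. -/
structure IsRun [MeasurableSpace Ω] [MeasurableSpace S] (P : Measure Ω) (X : Set (Vec n))
    (f h : Vec n → ℝ) (α L : ℝ) (w : Vec n → ℝ) (gw : Vec n → Vec n) (x₁ : Vec n) (N : ℕ)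
    (γ : ℕ → ℝ) (m : ℕ → ℕ) (μ : ℝ) (F : Vec n → S → ℝ) (ξ : ℕ → ℕ → Ω → S)
    (v : ℕ → ℕ → Ω → Vec n) (σ M : ℝ) : Prop where
  problem : IsProxProblem X h α w gw
  L_pos : 0 < L
  x₁_mem : x₁ ∈ X
  batch_pos : ∀ k ∈ Finset.Icc 1 N, 0 < m k
  μ_pos : 0 < μ
  step_pos : ∀ k ∈ Finset.Icc 1 N, 0 < γ k
  measurable_F : Measurable (Function.uncurry F)
  measurable_ξ : ∀ k i, Measurable (ξ k i)
  measurable_v : ∀ k i, Measurable (v k i)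
  c11 : ∀ k ∈ Finset.Icc 1 N, ∀ i < m k, ∀ᵐ ω ∂P, IsC11 L (fun x => F x (ξ k i ω))
  a1 : ∀ k ∈ Finset.Icc 1 N, ∀ i < m k, AssumptionA1 P (past m ξ v k i) X f F σ (ξ k i)
  a3 : ∀ k ∈ Finset.Icc 1 N, ∀ i < m k, AssumptionA3 P (past m ξ v k i) f F (ξ k i)
  law : ∀ k ∈ Finset.Icc 1 N, ∀ i < m k, P.map (v k i) = stdGaussian (Vec n)
  indep : ∀ k ∈ Finset.Icc 1 N, ∀ i < m k, Indep (MeasurableSpace.comap (v k i) inferInstance)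
    (past m ξ v k i ⊔ MeasurableSpace.comap (ξ k i) inferInstance) P
  bound : ∀ x ∈ X, ‖∇ f x‖ ≤ M

namespace IsRun

variable {mΩ : MeasurableSpace Ω} [MeasurableSpace S] {P : Measure Ω} {X : Set (Vec n)}
  {f h : Vec n → ℝ} {α L : ℝ} {w : Vec n → ℝ} {gw : Vec n → Vec n} {x₁ : Vec n} {N : ℕ}
  {γ : ℕ → ℝ} {m : ℕ → ℕ} {μ : ℝ} {F : Vec n → S → ℝ} {ξ : ℕ → ℕ → Ω → S}
  {v : ℕ → ℕ → Ω → Vec n} {σ M : ℝ}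

lemma iterate_mem (hr : IsRun P X f h α L w gw x₁ N γ m μ F ξ v σ M) {k : ℕ} (hk1 : 1 ≤ k)
    (hkN : k ≤ N + 1) (ω : Ω) : runIterate X h w gw F μ γ m x₁ ξ v k ω ∈ X := by
  induction k, hk1 using Nat.le_induction with
  | base => exact hr.x₁_mem
  | succ k hk ih =>
    rw [runIterate_succ _ _ _ _ _ _ _ _ _ _ _ hk]
    exact (hr.problem.isProjSolution (hr.step_pos k (Finset.mem_Icc.2 ⟨hk, by omega⟩)) _
      (ih (by omega))).1

lemma measurable_runGrad_of_iterate (hr : IsRun P X f h α L w gw x₁ N γ m μ F ξ v σ M) {k : ℕ}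
    (hk : 1 ≤ k)
    (hx : Measurable[past m ξ v k 0] (runIterate X h w gw F μ γ m x₁ ξ v k)) :
    Measurable[past m ξ v (k + 1) 0] (runGrad X h w gw F μ γ m x₁ ξ v k) :=
  measurable_batchGrad hr.measurable_F (hx.mono (past_mono (by omega)) le_rfl) fun _ hi =>
    measurable_past hk hi (by omega)

lemma measurable_iterate (hr : IsRun P X f h α L w gw x₁ N γ m μ F ξ v σ M) {k : ℕ} (hk1 : 1 ≤ k)
    (hkN : k ≤ N + 1) :
    Measurable[past m ξ v k 0] (runIterate X h w gw F μ γ m x₁ ξ v k) := by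
  induction k, hk1 using Nat.le_induction with
  | base => exact measurable_const
  | succ k hk ih =>
    rw [funext (runIterate_succ X h w gw F μ γ m x₁ ξ v hk)]
    exact (hr.problem.measurable_step (hr.step_pos k (Finset.mem_Icc.2 ⟨hk, by omega⟩))
      (hr.measurable_runGrad_of_iterate hk (ih (by omega)))
      ((ih (by omega)).mono (past_mono (by omega)) le_rfl)
      (hr.iterate_mem hk (by omega)) ⟨x₁, hr.x₁_mem⟩).1

lemma isSample (hr : IsRun P X f h α L w gw x₁ N γ m μ F ξ v σ M) {k i : ℕ}
    (hk : k ∈ Finset.Icc 1 N) (hi : i < m k) :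
    IsSample (past m ξ v k i) P X L σ M f F (ξ k i) (v k i)
      (runIterate X h w gw F μ γ m x₁ ξ v k) where
  le := past_le hr.measurable_ξ hr.measurable_v k i
  measurable_F := hr.measurable_F
  measurable_ξ := hr.measurable_ξ k i
  measurable_v := hr.measurable_v k i
  c11 := hr.c11 k hk i hi
  a1 := hr.a1 k hk i hi
  a3 := hr.a3 k hk i hi
  law := hr.law k hk i hi
  indep := hr.indep k hk i hi
  measurable_x := by
    have hk' := Finset.mem_Icc.1 hk
    exact (hr.measurable_iterate hk'.1 (by omega)).mono (past_mono (by omega)) le_rfl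
  mem := by
    have hk' := Finset.mem_Icc.1 hk
    exact hr.iterate_mem hk'.1 (by omega)
  bound := hr.bound

lemma runGrad_sub (hr : IsRun P X f h α L w gw x₁ N γ m μ F ξ v σ M) {k : ℕ}
    (hk : k ∈ Finset.Icc 1 N) (a : Vec n) (ω : Ω) :
    runGrad X h w gw F μ γ m x₁ ξ v k ω - a = (1 / (m k : ℝ)) • ∑ i ∈ Finset.range (m k),
      (gradFree F μ (runIterate X h w gw F μ γ m x₁ ξ v k ω) (ξ k i ω) (v k i ω) - a) := by
  have hm : (m k : ℝ) ≠ 0 := Nat.cast_ne_zero.2 (hr.batch_pos k hk).ne'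
  rw [runGrad, batchGrad, Finset.sum_sub_distrib, smul_sub, Finset.sum_const, Finset.card_range,
    ← Nat.cast_smul_eq_nsmul ℝ, smul_smul, one_div_mul_cancel hm, one_smul]

variable [IsProbabilityMeasure P]

/-- The mean direction is `smoothGrad f μ` rather than ∇f, so no bias term is left. -/
theorem isProxProcess (hr : IsRun P X f h α L w gw x₁ N γ m μ F ξ v σ M) :
    IsProxProcess P (fun k => past m ξ v k 0) X h w gw N γ (smoothGrad f μ)
      (fun k => sigmaTildeSq n M σ μ L / m k) x₁ (runIterate X h w gw F μ γ m x₁ ξ v)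
      (runGrad X h w gw F μ γ m x₁ ξ v) where
  le k := past_le hr.measurable_ξ hr.measurable_v k 0
  mono k l hkl := past_mono (by omega)
  init ω := rfl
  step k hk ω := runIterate_succ _ _ _ _ _ _ _ _ _ _ _ (Finset.mem_Icc.1 hk).1 ω
  mem k hk ω := hr.iterate_mem (Finset.mem_Icc.1 hk).1 (Finset.mem_Icc.1 hk).2 ω
  measurable_x k hk := hr.measurable_iterate (Finset.mem_Icc.1 hk).1 (Finset.mem_Icc.1 hk).2
  measurable_G k hk := by
    have hk' := Finset.mem_Icc.1 hk
    exact hr.measurable_runGrad_of_iterate hk'.1 (hr.measurable_iterate hk'.1 (by omega))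
  measurable_g k hk := (hr.isSample hk (hr.batch_pos k hk)).measurable_smoothGrad hr.μ_pos.le
  memLp_error k hk := by
    simp_rw [hr.runGrad_sub hk]
    exact (memLp_finsetSum _ fun i hi =>
      (hr.isSample hk (Finset.mem_range.1 hi)).memLp_error hr.L_pos.le hr.μ_pos).const_smul
        (1 / (m k : ℝ))
  variance k hk := by
    have hm : (0 : ℝ) < m k := Nat.cast_pos.2 (hr.batch_pos k hk)
    -- The earlier errors of a batch are measurable with respect to the past of call `i`, so its
    -- error is orthogonal to their sum. Second moments add up to at most m_k σ̃², and the factor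
    -- 1/m_k² turns this into σ̃² / m_k.
    have h1 := integral_sq_sum_le (P := P) (m := m k) (s := sigmaTildeSq n M σ μ L)
      (δ := fun i ω => gradFree F μ (runIterate X h w gw F μ γ m x₁ ξ v k ω) (ξ k i ω) (v k i ω) -
        smoothGrad f μ (runIterate X h w gw F μ γ m x₁ ξ v k ω))
      (fun i hi => (hr.isSample hk hi).memLp_error hr.L_pos.le hr.μ_pos)
      (fun i hi => (hr.isSample hk hi).integral_sq_error_le hr.L_pos.le hr.μ_pos)
      fun i hi => by
        refine (hr.isSample hk hi).integral_inner_error hr.L_pos.le hr.μ_pos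
          (Finset.measurable_sum _ fun j hj => ?_)
          (memLp_finsetSum _ fun j hj => (hr.isSample hk
            ((Finset.mem_range.1 hj).trans hi)).memLp_error hr.L_pos.le hr.μ_pos)
        have hk' := Finset.mem_Icc.1 hk
        have hji := Finset.mem_range.1 hj
        have a1 := (hr.isSample hk hi).measurable_x
        have a2 : Measurable[past m ξ v k i] fun ω => (ξ k j ω, v k j ω) :=
          measurable_past hk'.1 (hji.trans hi) (Or.inr ⟨rfl, hji⟩)
        exact (measurable_gradFree hr.measurable_F a1 a2).sub
          ((hr.isSample hk hi).measurable_smoothGrad hr.μ_pos.le)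
    simp_rw [hr.runGrad_sub hk, norm_smul, mul_pow]
    rw [integral_const_mul, Real.norm_eq_abs, abs_of_pos (by positivity), le_div_iff₀ hm]
    calc _ ≤ (1 / (m k : ℝ)) ^ 2 * (m k * sigmaTildeSq n M σ μ L) * m k := by gcongr
      _ = _ := by field_simp
  orthogonal k hk Y hY hY2 := by
    simp_rw [hr.runGrad_sub hk, real_inner_smul_left, sum_inner]
    rw [integral_const_mul, integral_finsetSum _ fun i hi => integrable_inner_of_memLp
      ((hr.isSample hk (Finset.mem_range.1 hi)).memLp_error hr.L_pos.le hr.μ_pos) hY2,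
      Finset.sum_eq_zero, mul_zero]
    intro i hi
    exact (hr.isSample hk (Finset.mem_range.1 hi)).integral_inner_error hr.L_pos.le hr.μ_pos
      (hY.mono (past_mono (by omega)) le_rfl) hY2

end IsRun

end Run

/-! ### Return to the original objective and averaging over R. -/

lemma optValue_le {n : ℕ} {X : Set (Vec n)} {f h : Vec n → ℝ}
    (hbdd : BddBelow ((fun x => f x + h x) '' X)) {u : Vec n} (hu : u ∈ X) :
    optValue X f h ≤ f u + h u :=
  csInf_le hbdd (Set.mem_image_of_mem _ hu)

lemma mul_DPsi_sq {n : ℕ} {X : Set (Vec n)} {f h : Vec n → ℝ} {L : ℝ} (hL : 0 < L)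
    (hbdd : BddBelow ((fun x => f x + h x) '' X)) {x₁ : Vec n} (hx₁ : x₁ ∈ X) :
    L * DPsi X f h L x₁ ^ 2 = f x₁ + h x₁ - optValue X f h := by
  rw [DPsi, Real.sq_sqrt (div_nonneg (sub_nonneg.2 (optValue_le hbdd hx₁)) hL.le)]
  field_simp

lemma weight_nonneg {α L g : ℝ} (hg : 0 < g) (hgL : L * g ≤ α) : 0 ≤ α * g - L * g ^ 2 := by
  have := mul_le_mul_of_nonneg_right hgL hg.le
  linarith

lemma weightSum_pos {α L : ℝ} {γ : ℕ → ℝ} {N : ℕ} (hL : 0 < L)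
    (hγ : ∀ k ∈ Finset.Icc 1 N, 0 < γ k ∧ L * γ k ≤ α)
    (hγ' : ∃ k ∈ Finset.Icc 1 N, γ k < α / L) : 0 < weightSum α L γ N := by
  obtain ⟨k, hk, hlt⟩ := hγ'
  refine Finset.sum_pos' (fun j hj => weight_nonneg (hγ j hj).1 (hγ j hj).2) ⟨k, hk, ?_⟩
  rw [lt_div_iff₀ hL] at hlt
  have := mul_lt_mul_of_pos_right hlt (hγ k hk).1
  linarith

namespace IsRun

variable {n : ℕ} {Ω S : Type*} {mΩ : MeasurableSpace Ω} [MeasurableSpace S] {P : Measure Ω}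
  [IsProbabilityMeasure P] {X : Set (Vec n)}
  {f h : Vec n → ℝ} {α L : ℝ} {w : Vec n → ℝ} {gw : Vec n → Vec n} {x₁ : Vec n} {N : ℕ}
  {γ : ℕ → ℝ} {m : ℕ → ℕ} {μ : ℝ} {F : Vec n → S → ℝ} {ξ : ℕ → ℕ → Ω → S}
  {v : ℕ → ℕ → Ω → Vec n} {σ M : ℝ}

/-- Since N ≥ 1, call 0 of step 1 is a sample whose mean is f. -/
lemma isC11 (hr : IsRun P X f h α L w gw x₁ N γ m μ F ξ v σ M) (hN : 1 ≤ N) : IsC11 L f :=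
  have h1 : 1 ∈ Finset.Icc 1 N := Finset.mem_Icc.2 ⟨le_rfl, hN⟩
  (hr.isSample h1 (hr.batch_pos 1 h1)).isC11

lemma smooth_lower (hr : IsRun P X f h α L w gw x₁ N γ m μ F ξ v σ M) (hN : 1 ≤ N)
    (hbdd : BddBelow ((fun x => f x + h x) '' X)) :
    ∀ u ∈ X, optValue X f h - μ ^ 2 * L * n / 2 ≤ smooth f μ u + h u := fun u hu => by
  have h1 := optValue_le hbdd hu
  have h2 := (abs_le.1 ((hr.isC11 hN).abs_smooth_sub_le hr.L_pos.le hr.μ_pos.le u)).1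
  linarith

/-- The mean square of the stochastic projected gradient at a random step. -/
theorem integral_sq_random_projGrad_le (hr : IsRun P X f h α L w gw x₁ N γ m μ F ξ v σ M)
    (hbdd : BddBelow ((fun x => f x + h x) '' X))
    (hγ : ∀ k ∈ Finset.Icc 1 N, 0 < γ k ∧ L * γ k ≤ α)
    (hγ' : ∃ k ∈ Finset.Icc 1 N, γ k < α / L) {R : Ω → ℕ} (hR : Measurable R)
    (hRlaw : ∀ k ∈ Finset.Icc 1 N,
      P.real {ω | R ω = k} = (α * γ k - L * γ k ^ 2) / weightSum α L γ N)
    (hRindep : Indep (MeasurableSpace.comap R inferInstance) (past m ξ v (N + 1) 0) P) :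
    Integrable (fun ω => ‖projGrad X h w gw (runIterate X h w gw F μ γ m x₁ ξ v (R ω) ω)
      (runGrad X h w gw F μ γ m x₁ ξ v (R ω) ω) (γ (R ω))‖ ^ 2) P ∧
    ∫ ω, ‖projGrad X h w gw (runIterate X h w gw F μ γ m x₁ ξ v (R ω) ω)
      (runGrad X h w gw F μ γ m x₁ ξ v (R ω) ω) (γ (R ω))‖ ^ 2 ∂P ≤
      (L * DPsi X f h L x₁ ^ 2 + μ ^ 2 * L * n +
        (sigmaTildeSq n M σ μ L / α) * ∑ k ∈ Finset.Icc 1 N, γ k / m k) / weightSum α L γ N := by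
  have hN : 1 ≤ N := by
    obtain ⟨k, hk, -⟩ := hγ'
    have := Finset.mem_Icc.1 hk
    omega
  have hf := hr.isC11 hN
  have hs := hr.isProxProcess
  have hW := weightSum_pos hr.L_pos hγ hγ'
  have hφ := hf.smooth_le_quadratic hr.L_pos.le hr.μ_pos.le
  have hc := hr.smooth_lower hN hbdd
  have key := hs.sum_integral_sq_projGrad_le hr.problem hr.L_pos.le hφ hc hγ
  obtain ⟨hi, he⟩ := integral_random_index (P := P) hR hRindep hRlaw
    (by rw [← Finset.sum_div]; exact div_self hW.ne')
    (W := fun k ω => ‖projGrad X h w gw (runIterate X h w gw F μ γ m x₁ ξ v k ω)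
      (runGrad X h w gw F μ γ m x₁ ξ v k ω) (γ k)‖ ^ 2)
    (fun k hk => by
      have hk' := Finset.mem_Icc.1 hk
      exact (by fun_prop : Measurable fun y : Vec n => ‖y‖ ^ 2).comp
        ((hs.measurable_projGrad hr.problem hk (hγ k hk).1).mono
          (hs.mono (by omega : k + 1 ≤ N + 1)) le_rfl))
    (fun k hk => (hs.memLp_projGrad hr.problem hφ hc hγ hk).integrable_norm_pow two_ne_zero)
  refine ⟨hi, ?_⟩
  rw [he, le_div_iff₀ hW, Finset.sum_mul]
  have e1 : ∀ k ∈ Finset.Icc 1 N, (α * γ k - L * γ k ^ 2) / weightSum α L γ N *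
      (∫ ω, ‖projGrad X h w gw (runIterate X h w gw F μ γ m x₁ ξ v k ω)
        (runGrad X h w gw F μ γ m x₁ ξ v k ω) (γ k)‖ ^ 2 ∂P) * weightSum α L γ N =
      (α * γ k - L * γ k ^ 2) *
      ∫ ω, ‖projGrad X h w gw (runIterate X h w gw F μ γ m x₁ ξ v k ω)
        (runGrad X h w gw F μ γ m x₁ ξ v k ω) (γ k)‖ ^ 2 ∂P := fun k _ => by
    field_simp
  rw [Finset.sum_congr rfl e1]
  refine key.trans ?_
  -- One half of μ² L n comes from f_μ(x₁) here, the other from the lower bound `hc`.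
  have h2 := (abs_le.1 (hf.abs_smooth_sub_le hr.L_pos.le hr.μ_pos.le x₁)).2
  have e2 : ∑ k ∈ Finset.Icc 1 N, γ k / α * (sigmaTildeSq n M σ μ L / m k) =
      (sigmaTildeSq n M σ μ L / α) * ∑ k ∈ Finset.Icc 1 N, γ k / m k := by
    rw [Finset.mul_sum]
    exact Finset.sum_congr rfl fun k _ => by ring
  rw [e2, mul_DPsi_sq hr.L_pos hbdd hr.x₁_mem]
  linarith

/-- The mean optimality gap at a random step in the convex case. -/
theorem integral_random_value_sub_le (hr : IsRun P X f h α L w gw x₁ N γ m μ F ξ v σ M)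
    (hbdd : BddBelow ((fun x => f x + h x) '' X))
    (hγ : ∀ k ∈ Finset.Icc 1 N, 0 < γ k ∧ L * γ k ≤ α)
    (hγ' : ∃ k ∈ Finset.Icc 1 N, γ k < α / L) {R : Ω → ℕ} (hR : Measurable R)
    (hRlaw : ∀ k ∈ Finset.Icc 1 N,
      P.real {ω | R ω = k} = (α * γ k - L * γ k ^ 2) / weightSum α L γ N)
    (hRindep : Indep (MeasurableSpace.comap R inferInstance) (past m ξ v (N + 1) 0) P)
    (hconv : ConvexOn ℝ Set.univ f) (hmono : MonotoneOn γ (Set.Icc 1 N)) {z : Vec n}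
    (hz : z ∈ X) :
    Integrable (fun ω => (f (runIterate X h w gw F μ γ m x₁ ξ v (R ω + 1) ω) +
      h (runIterate X h w gw F μ γ m x₁ ξ v (R ω + 1) ω)) - (f z + h z)) P ∧
    ∫ ω, ((f (runIterate X h w gw F μ γ m x₁ ξ v (R ω + 1) ω) +
      h (runIterate X h w gw F μ γ m x₁ ξ v (R ω + 1) ω)) - (f z + h z)) ∂P ≤
      ((α - L * γ 1) * proxV w gw z x₁ +
        (sigmaTildeSq n M σ μ L / 2) * ∑ k ∈ Finset.Icc 1 N, γ k ^ 2 / m k) /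
        weightSum α L γ N + μ ^ 2 * L * n := by
  have hN : 1 ≤ N := by
    obtain ⟨k, hk, -⟩ := hγ'
    have := Finset.mem_Icc.1 hk
    omega
  have hf := hr.isC11 hN
  have hs := hr.isProxProcess
  have hW := weightSum_pos hr.L_pos hγ hγ'
  have hφ := hf.smooth_le_quadratic hr.L_pos.le hr.μ_pos.le
  have hc := hr.smooth_lower hN hbdd
  have hφm : Measurable (smooth f μ) := by
    have hfc := hf.1.continuous
    have : StronglyMeasurable (smooth f μ) :=
      StronglyMeasurable.integral_prod_right (f := fun x v => f (x + μ • v))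
        (Continuous.stronglyMeasurable (by fun_prop))
    exact this.measurable
  have hsm := hf.abs_smooth_sub_le hr.L_pos.le hr.μ_pos.le
  have key := hs.sum_integral_value_sub_le hr.problem hr.L_pos.le hN hφ hφm hc
    (hf.smooth_convex_le hr.L_pos.le hr.μ_pos.le hconv) hγ hmono hz
  set x := runIterate X h w gw F μ γ m x₁ ξ v with hx
  have hmeas : ∀ k ∈ Finset.Icc 1 N, Measurable[past m ξ v (N + 1) 0]
      fun ω => (f (x (k + 1) ω) + h (x (k + 1) ω)) - (f z + h z) := fun k hk => by
    have hk' := Finset.mem_Icc.1 hk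
    have hle : past m ξ v (k + 1) 0 ≤ past m ξ v (N + 1) 0 :=
      hs.mono (by omega : k + 1 ≤ N + 1)
    refine Measurable.sub_const (Measurable.add ?_ ?_) _
    · exact hf.1.continuous.measurable.comp ((hs.measurable_x (k + 1)
        (Finset.mem_Icc.2 ⟨by omega, by omega⟩)).mono hle le_rfl)
    · exact (hs.measurable_h_succ hr.problem hk (hγ k hk).1).mono hle le_rfl
  have hφi : ∀ k ∈ Finset.Icc 1 N, Integrable (fun ω => (smooth f μ (x (k + 1) ω) +
      h (x (k + 1) ω)) - (smooth f μ z + h z)) P := fun k hk =>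
    (hs.integrable_value_succ hr.problem hφ hφm hc hγ hk).sub (integrable_const _)
  have hfi : ∀ k ∈ Finset.Icc 1 N, Integrable (fun ω => (f (x (k + 1) ω) +
      h (x (k + 1) ω)) - (f z + h z)) P := fun k hk => by
    refine ((hφi k hk).abs.add (integrable_const (μ ^ 2 * L * n))).mono'
      ((hmeas k hk).mono (hs.le (N + 1)) le_rfl).aestronglyMeasurable
      (Filter.Eventually.of_forall fun ω => ?_)
    have h1 := abs_le.1 (hsm (x (k + 1) ω))
    have h2 := abs_le.1 (hsm z)
    have h3 := le_abs_self ((smooth f μ (x (k + 1) ω) + h (x (k + 1) ω)) - (smooth f μ z + h z))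
    have h4 := neg_abs_le ((smooth f μ (x (k + 1) ω) + h (x (k + 1) ω)) - (smooth f μ z + h z))
    simp only [Pi.add_apply]
    rw [Real.norm_eq_abs, abs_le]
    constructor <;> linarith
  obtain ⟨hi, he⟩ := integral_random_index (P := P) hR hRindep hRlaw
    (by rw [← Finset.sum_div]; exact div_self hW.ne') hmeas hfi
  refine ⟨hi, ?_⟩
  rw [he, ← sub_le_iff_le_add, le_div_iff₀ hW, sub_mul, Finset.sum_mul]
  have e1 : ∀ k ∈ Finset.Icc 1 N, (α * γ k - L * γ k ^ 2) / weightSum α L γ N *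
      (∫ ω, ((f (x (k + 1) ω) + h (x (k + 1) ω)) - (f z + h z)) ∂P) * weightSum α L γ N ≤
      (α * γ k - L * γ k ^ 2) *
      (∫ ω, ((smooth f μ (x (k + 1) ω) + h (x (k + 1) ω)) - (smooth f μ z + h z)) ∂P) +
      μ ^ 2 * L * n * (α * γ k - L * γ k ^ 2) := fun k hk => by
    -- f_μ is exchanged for f at x_{k+1} and at `z`, each time at cost μ² L n / 2.
    have h1 : ∫ ω, ((f (x (k + 1) ω) + h (x (k + 1) ω)) - (f z + h z)) ∂P ≤
        (∫ ω, ((smooth f μ (x (k + 1) ω) + h (x (k + 1) ω)) - (smooth f μ z + h z)) ∂P) +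
        μ ^ 2 * L * n := by
      have := integral_mono (hfi k hk) ((hφi k hk).add (integrable_const (μ ^ 2 * L * n)))
        fun ω => by
          have h1 := abs_le.1 (hsm (x (k + 1) ω))
          have h2 := abs_le.1 (hsm z)
          simp only [Pi.add_apply]
          linarith
      refine this.trans_eq ?_
      simp only [Pi.add_apply]
      rw [integral_add (hφi k hk) (integrable_const _)]
      simp
    have h2 := mul_le_mul_of_nonneg_left h1 (weight_nonneg (hγ k hk).1 (hγ k hk).2)
    calc _ = (α * γ k - L * γ k ^ 2) *
          ∫ ω, ((f (x (k + 1) ω) + h (x (k + 1) ω)) - (f z + h z)) ∂P := by field_simp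
      _ ≤ _ := h2
      _ = _ := by ring
  have e2 := Finset.sum_le_sum e1
  rw [Finset.sum_add_distrib, ← Finset.mul_sum] at e2
  have e3 : ∑ k ∈ Finset.Icc 1 N, γ k ^ 2 / 2 * (sigmaTildeSq n M σ μ L / m k) =
      (sigmaTildeSq n M σ μ L / 2) * ∑ k ∈ Finset.Icc 1 N, γ k ^ 2 / m k := by
    rw [Finset.mul_sum]
    exact Finset.sum_congr rfl fun k _ => by ring
  rw [e3] at key
  -- The smoothing cost carries the same weights, so division by `weightSum` leaves exactly μ² L n.
  have e4 : ∑ k ∈ Finset.Icc 1 N, (α * γ k - L * γ k ^ 2) = weightSum α L γ N := rfl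
  rw [e4] at e2
  linarith

end IsRun

end RSPGF

end

theorem theorem4 {n : ℕ} {Ω S : Type*} [MeasurableSpace Ω] [MeasurableSpace S]
    (P : Measure Ω) [IsProbabilityMeasure P]
    -- the problem: minimize `f + h` over `X`
    (X : Set (RSPGF.Vec n)) (hXclosed : IsClosed X) (hXconvex : Convex ℝ X)
    (f h : RSPGF.Vec n → ℝ) (hh : ConvexOn ℝ X h)
    (hbdd : BddBelow ((fun x => f x + h x) '' X))
    -- the distance generating function; the generalized projection problem is solvable
    (α L : ℝ) (hα : 0 < α) (hL : 0 < L)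
    (w : RSPGF.Vec n → ℝ) (gw : RSPGF.Vec n → RSPGF.Vec n)
    (hw : RSPGF.IsDistanceGenerating X α w gw)
    (hsolv : ∀ γ₀ : ℝ, 0 < γ₀ → ∀ g : RSPGF.Vec n, ∀ x ∈ X,
      ∃ u, RSPGF.IsProjSolution X h w gw γ₀ g x u)
    -- the input of the algorithm
    (x₁ : RSPGF.Vec n) (hx₁ : x₁ ∈ X) (N : ℕ) (γ : ℕ → ℝ) (m : ℕ → ℕ)
    (hm : ∀ k ∈ Finset.Icc 1 N, 0 < m k) (μ : ℝ) (hμ : 0 < μ)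
    (hγ : ∀ k ∈ Finset.Icc 1 N, 0 < γ k ∧ γ k ≤ α / L)
    (hγ' : ∃ k ∈ Finset.Icc 1 N, γ k < α / L)
    -- the stochastic zeroth-order oracle and the Gaussian directions
    (F : RSPGF.Vec n → S → ℝ) (hF : Measurable (Function.uncurry F))
    (ξ : ℕ → ℕ → Ω → S) (v : ℕ → ℕ → Ω → RSPGF.Vec n)
    (hξ : ∀ k i, Measurable (ξ k i)) (hv : ∀ k i, Measurable (v k i))
    (hFC11 : ∀ k ∈ Finset.Icc 1 N, ∀ i < m k, ∀ᵐ ω ∂P, RSPGF.IsC11 L (fun x => F x (ξ k i ω)))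
    (σ : ℝ)
    (hA1 : ∀ k ∈ Finset.Icc 1 N, ∀ i < m k,
      RSPGF.AssumptionA1 P (RSPGF.past m ξ v k i) X f F σ (ξ k i))
    (hA3 : ∀ k ∈ Finset.Icc 1 N, ∀ i < m k,
      RSPGF.AssumptionA3 P (RSPGF.past m ξ v k i) f F (ξ k i))
    (hvlaw : ∀ k ∈ Finset.Icc 1 N, ∀ i < m k, P.map (v k i) = stdGaussian (RSPGF.Vec n))
    (hvindep : ∀ k ∈ Finset.Icc 1 N, ∀ i < m k,
      Indep (MeasurableSpace.comap (v k i) inferInstance)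
        (RSPGF.past m ξ v k i ⊔ MeasurableSpace.comap (ξ k i) inferInstance) P)
    -- the random iteration count, independent of all samples of steps `1, …, N`
    (R : Ω → ℕ) (hR : Measurable R)
    (hRlaw : ∀ k ∈ Finset.Icc 1 N,
      P.real {ω | R ω = k} = (α * γ k - L * γ k ^ 2) / RSPGF.weightSum α L γ N)
    (hRindep : Indep (MeasurableSpace.comap R inferInstance) (RSPGF.past m ξ v (N + 1) 0) P)
    -- the gradient is bounded on `X`
    (M : ℝ) (hM : ∀ x ∈ X, ‖gradient f x‖ ≤ M) :
    -- (a)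
    (Integrable (fun ω => ‖RSPGF.stochProjGrad X h w gw F μ γ m x₁
        (fun k i => ξ k i ω) (fun k i => v k i ω) (R ω)‖ ^ 2) P ∧
      ∫ ω, ‖RSPGF.stochProjGrad X h w gw F μ γ m x₁
          (fun k i => ξ k i ω) (fun k i => v k i ω) (R ω)‖ ^ 2 ∂P ≤
        (L * RSPGF.DPsi X f h L x₁ ^ 2 + μ ^ 2 * L * n +
          (RSPGF.sigmaTildeSq n M σ μ L / α) * ∑ k ∈ Finset.Icc 1 N, γ k / m k) /
          RSPGF.weightSum α L γ N) ∧
    -- (b)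
    (ConvexOn ℝ Set.univ f → MonotoneOn γ (Set.Icc 1 N) →
      ∀ xs ∈ X, IsMinOn (fun x => f x + h x) X xs →
        Integrable (fun ω =>
          (f (RSPGF.iterate X h w gw F μ γ m x₁
              (fun k i => ξ k i ω) (fun k i => v k i ω) (R ω + 1)) +
            h (RSPGF.iterate X h w gw F μ γ m x₁
              (fun k i => ξ k i ω) (fun k i => v k i ω) (R ω + 1))) - (f xs + h xs)) P ∧
        ∫ ω, ((f (RSPGF.iterate X h w gw F μ γ m x₁
              (fun k i => ξ k i ω) (fun k i => v k i ω) (R ω + 1)) +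
            h (RSPGF.iterate X h w gw F μ γ m x₁
              (fun k i => ξ k i ω) (fun k i => v k i ω) (R ω + 1))) - (f xs + h xs)) ∂P ≤
          ((α - L * γ 1) * RSPGF.proxV w gw xs x₁ +
            (RSPGF.sigmaTildeSq n M σ μ L / 2) * ∑ k ∈ Finset.Icc 1 N, γ k ^ 2 / m k) /
            RSPGF.weightSum α L γ N + μ ^ 2 * L * n) := by
  have hγL : ∀ k ∈ Finset.Icc 1 N, 0 < γ k ∧ L * γ k ≤ α := fun k hk =>
    ⟨(hγ k hk).1, by rw [mul_comm]; exact (le_div_iff₀ hL).1 (hγ k hk).2⟩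
  have hr : RSPGF.IsRun P X f h α L w gw x₁ N γ m μ F ξ v σ M :=
    ⟨⟨hXclosed, hXconvex, hh, hα, hw, hsolv⟩, hL, hx₁, hm, hμ, fun k hk => (hγ k hk).1, hF, hξ, hv,
      hFC11, hA1, hA3, hvlaw, hvindep, hM⟩
  exact ⟨hr.integral_sq_random_projGrad_le hbdd hγL hγ' hR hRlaw hRindep,
    fun hconv hmono xs hxs _ =>
      hr.integral_random_value_sub_le hbdd hγL hγ' hR hRlaw hRindep hconv hmono hxs⟩
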